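/- **Theorem 4.4.** For a tempered distribution $f\in\mathcal S'(\mathbb R)$ let $V_\varphi f(t,\nu)=\int_{\mathbb R} f(x)\,e^{-2\pi i x\nu}\varphi(x-t)\,dx$ (understood as a distributional pairing) be its short-time Fourier transform with the Gaussian window $\varphi(x)=e^{-x^2}$, and for $1\le p,q\le\infty$ let $M^{p,q}=M^{p,q}(\mathbb R)$ be the modulation space of all $f\in\mathcal S'(\mathbb R)$ with $$\|f\|_{M^{p,q}}=\Big(\int_{\mathbb R}\Big(\int_{\mathbb R}|V_\varphi f(t,\nu)|^p\,dt\Big)^{q/p}d\nu\Big)^{1/q}<\infty$$ (with essential suprema in place of integrals for infinite exponents). For $f,g\in\mathcal S(\mathbb R)$ let $$\mathrm{BH}(f,g)(x)=\lim_{\epsilon\to0^+}\int_{|y|>\epsilon}f(x+y)\,g(x-y)\,\frac{dy}{y}\qquad(x\in\mathbb R)$$ be the bilinear Hilbert transform. Let $1\le p_0,p_1,p_2,q_1,q_2,q_3\le\infty$ satisfy $$\frac1{p_1}+\frac1{p_2}>\frac1{p_0}\qquad\text{and}\qquad \frac1{q_1}+\frac1{q_2}\ge 1+\frac1{q_3}.$$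 Then $\mathrm{BH}$, initially defined on $\mathcal S(\mathbb R)\times\mathcal S(\mathbb R)$, extends to a bounded bilinear operator from $M^{p_1,q_1}\times M^{p_2,q_2}$ into $M^{p_0,q_3}$; that is, there are a bilinear extension (again denoted $\mathrm{BH}$) and a constant $C$, depending only on the exponents, such that $$\|\mathrm{BH}(f,g)\|_{M^{p_0,q_3}}\le C\,\|f\|_{M^{p_1,q_1}}\|g\|_{M^{p_2,q_2}}\qquad\text{for all } f\in M^{p_1,q_1},\ g\in M^{p_2,q_2}.$$ In particular, for all $1\le p,q\le\infty$ with conjugate exponents $p',q'$ ($\frac1p+\frac1{p'}=1=\frac1q+\frac1{q'}$) and every $\epsilon>0$, $\mathrm{BH}$ extends to a bounded bilinear operator from $M^{p,q}\times M^{p',q'}$ into $M^{1+\epsilon,\infty}$, with $$\|\mathrm{BH}(f,g)\|_{M^{1+\epsilon,\infty}}\le C\,\|f\|_{M^{p,q}}\|g\|_{M^{p',q'}}.$$ -/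

import Mathlib

open MeasureTheory Filter Topology
open scoped ENNReal NNReal SchwartzMap ContDiff

noncomputable section

namespace ModulationBHT

/-! ### Gaussian time-frequency atoms -/

/-- The complex Gaussian `x ↦ exp (-x² + b x)`. -/
def gexp (b : ℂ) (x : ℝ) : ℂ := Complex.exp (-(x : ℂ) ^ 2 + b * x)

/-- The polynomials with `(d/dx)^n exp (-x² + b x) = (gpoly n)(b - 2 x) exp (-x² + b x)`. -/
def gpoly : ℕ → Polynomial ℂ
  | 0 => 1
  | n + 1 => Polynomial.X * gpoly n - Polynomial.C 2 * Polynomial.derivative (gpoly n)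

theorem contDiff_gexp (b : ℂ) : ContDiff ℝ ∞ (gexp b) := by
  unfold gexp
  have h : ContDiff ℝ ∞ (fun x : ℝ => (x : ℂ)) := Complex.ofRealCLM.contDiff
  exact ((h.pow 2).neg.add (contDiff_const.mul h)).cexp

theorem hasDerivAt_poly_gexp (Q : Polynomial ℂ) (b : ℂ) (x : ℝ) :
    HasDerivAt (fun x : ℝ => Q.eval (b - 2 * x) * gexp b x)
      ((Polynomial.X * Q - Polynomial.C 2 * Polynomial.derivative Q).eval (b - 2 * (x : ℂ))
        * gexp b x) x := by
  unfold gexp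
  have h1 : HasDerivAt (fun x : ℝ => (x : ℂ)) 1 x := Complex.ofRealCLM.hasDerivAt
  have h2 : HasDerivAt (fun x : ℝ => b - 2 * (x : ℂ)) (-(2 * 1)) x := (h1.const_mul 2).const_sub b
  have h3 := (Q.hasDerivAt (b - 2 * (x : ℂ))).comp x h2
  have h4 := (((h1.pow 2).neg).add (h1.const_mul b)).cexp
  refine (h3.mul h4).congr_deriv ?_
  simp only [Polynomial.eval_sub, Polynomial.eval_mul, Polynomial.eval_X, Polynomial.eval_C,
    Function.comp, Pi.add_apply, Pi.neg_apply, Pi.pow_apply]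
  push_cast
  ring

theorem iteratedDeriv_gexp (b : ℂ) (n : ℕ) :
    iteratedDeriv n (gexp b) = fun x : ℝ => (gpoly n).eval (b - 2 * (x : ℂ)) * gexp b x := by
  induction n with
  | zero => ext x; simp [gpoly]
  | succ n ih =>
    rw [iteratedDeriv_succ, ih]
    ext x
    exact (hasDerivAt_poly_gexp (gpoly n) b x).deriv

theorem gexp_bound (R : ℝ) (j : ℕ) :
    ∃ C : ℝ, ∀ b : ℂ, ‖b‖ ≤ R → ∀ x : ℝ, |x| ^ j * ‖gexp b x‖ ≤ C := by
  refine ⟨j.factorial * Real.exp ((R + 1) ^ 2 / 4), fun b hb x => ?_⟩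
  have h1 : ‖gexp b x‖ = Real.exp (-x ^ 2 + b.re * x) := by
    rw [gexp, Complex.norm_exp]
    congr 1
    simp [pow_two]
  have h2 : |x| ^ j ≤ j.factorial * Real.exp |x| := by
    have := Real.pow_div_factorial_le_exp |x| (abs_nonneg x) j
    rwa [div_le_iff₀' (by positivity)] at this
  have h3 : b.re * x ≤ R * |x| := by
    calc b.re * x ≤ |b.re * x| := le_abs_self _
      _ = |b.re| * |x| := abs_mul _ _
      _ ≤ R * |x| := by gcongr; exact (Complex.abs_re_le_norm b).trans hb
  calc |x| ^ j * ‖gexp b x‖ ≤ (j.factorial * Real.exp |x|) * Real.exp (-x ^ 2 + b.re * x) := by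
        rw [h1]; gcongr
    _ = j.factorial * Real.exp (|x| + (-x ^ 2 + b.re * x)) := by
        rw [Real.exp_add |x|, mul_assoc]
    _ ≤ _ := by
        gcongr
        nlinarith [sq_nonneg (|x| - (R + 1) / 2), sq_abs x]

theorem poly_gexp_bound (R : ℝ) (Q : Polynomial ℂ) :
    ∀ j : ℕ, ∃ C : ℝ, ∀ b : ℂ, ‖b‖ ≤ R → ∀ x : ℝ,
      |x| ^ j * ‖Q.eval (b - 2 * (x : ℂ)) * gexp b x‖ ≤ C := by
  induction Q using Polynomial.induction_on with
  | C a =>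
    intro j
    obtain ⟨C, hC⟩ := gexp_bound R j
    refine ⟨‖a‖ * C, fun b hb x => ?_⟩
    have := mul_le_mul_of_nonneg_left (hC b hb x) (norm_nonneg a)
    simp only [Polynomial.eval_C, norm_mul]
    linarith
  | add P Q hP hQ =>
    intro j
    obtain ⟨C, hC⟩ := hP j
    obtain ⟨D, hD⟩ := hQ j
    refine ⟨C + D, fun b hb x => ?_⟩
    rw [Polynomial.eval_add, add_mul]
    calc _ ≤ |x| ^ j * (‖P.eval (b - 2 * (x : ℂ)) * gexp b x‖
            + ‖Q.eval (b - 2 * (x : ℂ)) * gexp b x‖) := by gcongr; exact norm_add_le _ _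
      _ ≤ C + D := by rw [mul_add]; exact add_le_add (hC b hb x) (hD b hb x)
  | monomial n a ih =>
    intro j
    obtain ⟨C, hC⟩ := ih j
    obtain ⟨D, hD⟩ := ih (j + 1)
    refine ⟨R * C + 2 * D, fun b hb x => ?_⟩
    have e : (Polynomial.C a * Polynomial.X ^ (n + 1)).eval (b - 2 * (x : ℂ)) * gexp b x
        = (b - 2 * (x : ℂ)) *
          ((Polynomial.C a * Polynomial.X ^ n).eval (b - 2 * (x : ℂ)) * gexp b x) := by
      simp only [Polynomial.eval_mul, Polynomial.eval_C, Polynomial.eval_pow, Polynomial.eval_X]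
      ring
    rw [e, norm_mul]
    set G := ‖(Polynomial.C a * Polynomial.X ^ n).eval (b - 2 * (x : ℂ)) * gexp b x‖ with hG
    have h1 : ‖b - 2 * (x : ℂ)‖ ≤ R + 2 * |x| := by
      refine (norm_sub_le _ _).trans ?_
      simpa using hb
    have hR : 0 ≤ R := (norm_nonneg b).trans hb
    calc |x| ^ j * (‖b - 2 * (x : ℂ)‖ * G) ≤ |x| ^ j * ((R + 2 * |x|) * G) := by gcongr
      _ = R * (|x| ^ j * G) + 2 * (|x| ^ (j + 1) * G) := by ring
      _ ≤ R * C + 2 * D := by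
        have := hC b hb x
        have := hD b hb x
        gcongr

/-- `gexp b` as a Schwartz function. -/
def gaussian (b : ℂ) : 𝓢(ℝ, ℂ) where
  toFun := gexp b
  smooth' := contDiff_gexp b
  decay' := by
    intro k n
    obtain ⟨C, hC⟩ := poly_gexp_bound ‖b‖ (gpoly n) k
    refine ⟨C, fun x => ?_⟩
    rw [norm_iteratedFDeriv_eq_norm_iteratedDeriv, iteratedDeriv_gexp, Real.norm_eq_abs]
    exact hC b le_rfl x

theorem gaussian_sub_bound (R : ℝ) (k n : ℕ) :
    ∃ C : ℝ, 0 ≤ C ∧ ∀ b c : ℂ, ‖b‖ ≤ R → ‖c‖ ≤ R →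
      SchwartzMap.seminorm ℂ k n (gaussian b - gaussian c) ≤ C * ‖b - c‖ := by
  obtain ⟨C, hC⟩ := poly_gexp_bound R (Polynomial.derivative (gpoly n)) k
  obtain ⟨D, hD⟩ := poly_gexp_bound R (gpoly n) (k + 1)
  refine ⟨max 0 (C + D), le_max_left _ _, fun b c hb hc => ?_⟩
  refine SchwartzMap.seminorm_le_bound' ℂ k n _ (by positivity) fun x => ?_
  have e : iteratedDeriv n (⇑(gaussian b - gaussian c)) x
      = (gpoly n).eval (b - 2 * (x : ℂ)) * gexp b x
        - (gpoly n).eval (c - 2 * (x : ℂ)) * gexp c x := by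
    have : (⇑(gaussian b - gaussian c)) = gexp b - gexp c := rfl
    rw [this, iteratedDeriv_sub, iteratedDeriv_gexp, iteratedDeriv_gexp]
    · exact ((contDiff_gexp b).of_le (by exact_mod_cast le_top)).contDiffAt
    · exact ((contDiff_gexp c).of_le (by exact_mod_cast le_top)).contDiffAt
  rw [e]
  have hder : ∀ z : ℂ, HasDerivAt
      (fun z : ℂ => ((|x| ^ k : ℝ) : ℂ) * ((gpoly n).eval (z - 2 * (x : ℂ)) * gexp z x))
      (((|x| ^ k : ℝ) : ℂ) * ((Polynomial.derivative (gpoly n)).eval (z - 2 * (x : ℂ)) * gexp z x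
        + x * ((gpoly n).eval (z - 2 * (x : ℂ)) * gexp z x))) z := by
    intro z
    unfold gexp
    have h2 : HasDerivAt (fun z : ℂ => z - 2 * (x : ℂ)) 1 z := (hasDerivAt_id z).sub_const _
    have h3 := ((gpoly n).hasDerivAt (z - 2 * (x : ℂ))).comp z h2
    have h4 := (((hasDerivAt_id z).mul_const (x : ℂ)).const_add (-(x : ℂ) ^ 2)).cexp
    refine ((h3.mul h4).const_mul _).congr_deriv ?_
    simp only [Function.comp, id]
    ring
  have hb' : b ∈ Metric.closedBall (0 : ℂ) R := by simpa using hb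
  have hc' : c ∈ Metric.closedBall (0 : ℂ) R := by simpa using hc
  have key := (convex_closedBall (0 : ℂ) R).norm_image_sub_le_of_norm_hasDerivWithin_le
    (f := fun z : ℂ => ((|x| ^ k : ℝ) : ℂ) * ((gpoly n).eval (z - 2 * (x : ℂ)) * gexp z x))
    (C := max 0 (C + D))
    (fun z _ => (hder z).hasDerivWithinAt) (fun z hz => ?_) hc' hb'
  · refine le_trans (le_of_eq ?_) key
    rw [← mul_sub, norm_mul, Complex.norm_real, Real.norm_of_nonneg (by positivity)]
  · have hz' : ‖z‖ ≤ R := by simpa using hz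
    refine le_trans ?_ (le_max_right _ _)
    have h1 := hC z hz' x
    have h2 := hD z hz' x
    rw [norm_mul, Complex.norm_real, Real.norm_of_nonneg (by positivity)]
    calc _ ≤ |x| ^ k * (‖(Polynomial.derivative (gpoly n)).eval (z - 2 * (x : ℂ)) * gexp z x‖
          + |x| * ‖(gpoly n).eval (z - 2 * (x : ℂ)) * gexp z x‖) := by
          gcongr
          refine (norm_add_le _ _).trans ?_
          rw [norm_mul (x : ℂ), Complex.norm_real, Real.norm_eq_abs]
      _ ≤ C + D := by
          rw [mul_add, ← mul_assoc, ← pow_succ]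
          exact add_le_add h1 h2

theorem continuous_gaussian : Continuous gaussian := by
  rw [continuous_iff_continuousAt]
  intro c
  rw [ContinuousAt, (schwartz_withSeminorms ℂ ℝ ℂ).tendsto_nhds]
  rintro ⟨k, n⟩ ε hε
  obtain ⟨C, hC0, hC⟩ := gaussian_sub_bound (‖c‖ + 1) k n
  have h1 : ∀ᶠ b in 𝓝 c, ‖b‖ ≤ ‖c‖ + 1 := by
    have : ∀ᶠ b in 𝓝 c, ‖b‖ < ‖c‖ + 1 :=
      continuous_norm.continuousAt.eventually_lt continuousAt_const (by simp)
    exact this.mono fun _ h => h.le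
  have h2 : ∀ᶠ b in 𝓝 c, C * ‖b - c‖ < ε := by
    have : Tendsto (fun b : ℂ => C * ‖b - c‖) (𝓝 c) (𝓝 (C * ‖c - c‖)) :=
      (Continuous.tendsto (by fun_prop) c)
    rw [sub_self, norm_zero, mul_zero] at this
    exact this.eventually_lt_const hε
  filter_upwards [h1, h2] with b hb hb'
  exact (hC b c hb (by linarith)).trans_lt hb'

/-- The time-frequency shift of the Gaussian window: the Schwartz function
`x ↦ exp (-2 π i x ν) φ (x - t)`, with `φ x = exp (-x²)`. -/
def stftAtom (t ν : ℝ) : 𝓢(ℝ, ℂ) :=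
  Complex.exp (-(t : ℂ) ^ 2) • gaussian (2 * t - 2 * Real.pi * Complex.I * ν)

theorem stftAtom_apply (t ν x : ℝ) :
    stftAtom t ν x =
      Complex.exp (-2 * Real.pi * Complex.I * x * ν) * (Real.exp (-(x - t) ^ 2) : ℂ) := by
  have : stftAtom t ν x = Complex.exp (-(t : ℂ) ^ 2) * 
     gexp (2 * t - 2 * Real.pi * Complex.I * ν) x := rfl
  rw [this, gexp, ← Complex.exp_add]
  push_cast
  rw [← Complex.exp_add]
  congr 1
  ring

theorem continuous_stftAtom : Continuous fun z : ℝ × ℝ => stftAtom z.1 z.2 := by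
  unfold stftAtom
  have h0 : Continuous fun z : ℝ × ℝ => (2 * z.1 - 2 * Real.pi * Complex.I * z.2 : ℂ) := by
    fun_prop
  have h1 : Continuous fun z : ℝ × ℝ => Complex.exp (-(z.1 : ℂ) ^ 2) := by fun_prop
  exact h1.smul (continuous_gaussian.comp h0)

/-- The short-time Fourier transform of a tempered distribution with respect to the Gaussian
window `φ x = exp (-x²)`. When `f` is a function, this is
`∫ f(x) exp (-2 π i x ν) φ(x - t) dx`. -/
def stft (f : 𝓢'(ℝ, ℂ)) (t ν : ℝ) : ℂ := f (stftAtom t ν)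

theorem continuous_stft (f : 𝓢'(ℝ, ℂ)) : Continuous fun z : ℝ × ℝ => stft f z.1 z.2 :=
  (map_continuous f).comp continuous_stftAtom

theorem continuous_stft_left (f : 𝓢'(ℝ, ℂ)) (ν : ℝ) : Continuous fun t : ℝ => stft f t ν :=
  Continuous.comp (g := fun z : ℝ × ℝ => stft f z.1 z.2) (f := fun t : ℝ => (t, ν))
    (continuous_stft f) (by fun_prop)

theorem continuous_stft_right (f : 𝓢'(ℝ, ℂ)) (t : ℝ) : Continuous fun ν : ℝ => stft f t ν :=
  Continuous.comp (g := fun z : ℝ × ℝ => stft f z.1 z.2) (f := fun ν : ℝ => (t, ν))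
    (continuous_stft f) (by fun_prop)

/-- The modulation space norm `‖V_φ f‖_{L^{p,q}}`: the `L^p` norm in time, followed by the `L^q`
norm in frequency (with essential suprema for infinite exponents). It may be infinite. -/
def modNorm (p q : ℝ≥0∞) (f : 𝓢'(ℝ, ℂ)) : ℝ≥0∞ :=
  eLpNorm (fun ν : ℝ => eLpNorm (fun t : ℝ => stft f t ν) p volume) q volume

theorem stft_essSup_le_iff (f : 𝓢'(ℝ, ℂ)) (ν : ℝ) (a : ℝ≥0∞) :
    eLpNorm (fun t : ℝ => stft f t ν) ⊤ volume ≤ a ↔ ∀ t : ℝ, ‖stft f t ν‖ₑ ≤ a := by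
  rw [eLpNorm_exponent_top, eLpNormEssSup]
  have hct : Continuous fun t : ℝ => ‖stft f t ν‖ₑ :=
    (continuous_stft_left f ν).enorm
  constructor
  · intro h
    have hae : ∀ᵐ t : ℝ, ‖stft f t ν‖ₑ ≤ a :=
      (ENNReal.ae_le_essSup fun t : ℝ => ‖stft f t ν‖ₑ).mono fun t ht => ht.trans h
    have hd : Dense {t : ℝ | ‖stft f t ν‖ₑ ≤ a} := Measure.dense_of_ae hae
    have hcl : IsClosed {t : ℝ | ‖stft f t ν‖ₑ ≤ a} := isClosed_le hct continuous_const
    intro t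
    have h1 : t ∈ closure {t : ℝ | ‖stft f t ν‖ₑ ≤ a} := hd t
    rw [hcl.closure_eq] at h1
    exact h1
  · intro h
    exact essSup_le_of_ae_le a (Eventually.of_forall h)

theorem measurable_inner (p : ℝ≥0∞) (f : 𝓢'(ℝ, ℂ)) :
    Measurable fun ν : ℝ => eLpNorm (fun t : ℝ => stft f t ν) p volume := by
  have hc := continuous_stft f
  rcases eq_or_ne p 0 with rfl | hp0
  · simp
  rcases eq_or_ne p ⊤ with rfl | hp
  · refine measurable_of_Iic fun a => ?_
    have : (fun ν : ℝ => eLpNorm (fun t : ℝ => stft f t ν) ⊤ volume) ⁻¹' Set.Iic a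
        = ⋂ t : ℝ, {ν : ℝ | ‖stft f t ν‖ₑ ≤ a} := by
      ext ν
      rw [Set.mem_iInter]
      exact stft_essSup_le_iff f ν a
    rw [this]
    refine (isClosed_iInter fun t => ?_).measurableSet
    exact isClosed_le (continuous_stft_right f t).enorm continuous_const
  · simp only [eLpNorm_eq_lintegral_rpow_enorm_toReal hp0 hp]
    refine Measurable.pow_const ?_ _
    refine Measurable.lintegral_prod_left' (f := fun z : ℝ × ℝ => ‖stft f z.1 z.2‖ₑ ^ p.toReal) ?_
    exact hc.measurable.enorm.pow_const _

theorem aestronglyMeasurable_stft (f : 𝓢'(ℝ, ℂ)) (ν : ℝ) :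
    AEStronglyMeasurable (fun t : ℝ => stft f t ν) volume :=
  (continuous_stft_left f ν).aestronglyMeasurable

/-- The modulation space `M^{p,q}(ℝ)`: the tempered distributions with finite norm. -/
def modulationSpace (p q : ℝ≥0∞) : Submodule ℂ 𝓢'(ℝ, ℂ) where
  carrier := {f | modNorm p q f < ⊤}
  zero_mem' := by
    have : ∀ t ν : ℝ, stft 0 t ν = 0 := fun _ _ => rfl
    simp [modNorm, this]
  add_mem' := by
    intro f g hf hg
    simp only [Set.mem_ofPred_eq, modNorm] at hf hg ⊢
    have hf' : MemLp (fun ν : ℝ => eLpNorm (fun t : ℝ => stft f t ν) p volume) q volume :=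
      ⟨(measurable_inner p f).aestronglyMeasurable, hf⟩
    have hg' : MemLp (fun ν : ℝ => eLpNorm (fun t : ℝ => stft g t ν) p volume) q volume :=
      ⟨(measurable_inner p g).aestronglyMeasurable, hg⟩
    have h := eLpNorm_add_lt_top hf' hg'
    have hle : ∀ ν : ℝ, ‖eLpNorm (fun t : ℝ => stft (f + g) t ν) p volume‖ₑ ≤
        ((ENNReal.toNNReal (ENNReal.LpAddConst p) : ℝ≥0) : ℝ≥0∞) *
        ‖((fun ν : ℝ => eLpNorm (fun t : ℝ => stft f t ν) p volume) +
          (fun ν : ℝ => eLpNorm (fun t : ℝ => stft g t ν) p volume)) ν‖ₑ := by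
      intro ν
      rw [ENNReal.coe_toNNReal (ENNReal.LpAddConst_lt_top p).ne]
      simp only [enorm_eq_self, Pi.add_apply]
      exact eLpNorm_add_le' (aestronglyMeasurable_stft f ν) (aestronglyMeasurable_stft g ν) p
    have := eLpNorm_le_nnreal_smul_eLpNorm_of_ae_le_mul' (μ := volume) (Eventually.of_forall hle) q
    refine this.trans_lt ?_
    exact ENNReal.mul_lt_top ENNReal.coe_lt_top h
  smul_mem' := by
    intro c f hf
    simp only [Set.mem_ofPred_eq, modNorm] at hf ⊢
    have hle : ∀ ν : ℝ, ‖eLpNorm (fun t : ℝ => stft (c • f) t ν) p volume‖ₑ ≤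
        ((‖c‖₊ : ℝ≥0) : ℝ≥0∞) * ‖eLpNorm (fun t : ℝ => stft f t ν) p volume‖ₑ := by
      intro ν
      simp only [enorm_eq_self]
      exact eLpNorm_const_smul_le (c := c) (f := fun t : ℝ => stft f t ν)
    have := eLpNorm_le_nnreal_smul_eLpNorm_of_ae_le_mul' (μ := volume) (Eventually.of_forall hle) q
    refine this.trans_lt ?_
    exact ENNReal.mul_lt_top ENNReal.coe_lt_top hf

/-! ### Schwartz functions belong to every modulation space -/

/-- The short-time Fourier transform of a Schwartz function with a Schwartz window. -/
def schwartzStft (ψ f : 𝓢(ℝ, ℂ)) (t ν : ℝ) : ℂ :=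
  ∫ x : ℝ, f x * (Complex.exp (-2 * Real.pi * Complex.I * x * ν) * ψ (x - t))

theorem norm_char (x ν : ℝ) : ‖Complex.exp (-2 * Real.pi * Complex.I * x * ν)‖ = 1 := by
  rw [Complex.norm_exp]
  simp

theorem norm_schwartzStft_integrand_le (ψ f : 𝓢(ℝ, ℂ)) (t ν x : ℝ) :
    ‖f x * (Complex.exp (-2 * Real.pi * Complex.I * x * ν) * ψ (x - t))‖
      ≤ SchwartzMap.seminorm ℂ 0 0 ψ * ‖f x‖ := by
  rw [norm_mul, norm_mul, norm_char, one_mul, mul_comm]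
  gcongr
  exact SchwartzMap.norm_le_seminorm ℂ ψ (x - t)

theorem integrable_schwartzStft (ψ f : 𝓢(ℝ, ℂ)) (t ν : ℝ) :
    Integrable fun x : ℝ =>
      f x * (Complex.exp (-2 * Real.pi * Complex.I * x * ν) * ψ (x - t)) := by
  have hf := f.continuous
  have hψ : Continuous fun x : ℝ => ψ (x - t) := ψ.continuous.comp (by fun_prop)
  refine Integrable.mono' (f.integrable.norm.const_mul (SchwartzMap.seminorm ℂ 0 0 ψ)) ?_
    (Eventually.of_forall (norm_schwartzStft_integrand_le ψ f t ν))
  exact (hf.mul ((by fun_prop : Continuous fun x : ℝ =>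
    Complex.exp (-2 * Real.pi * Complex.I * x * ν)).mul hψ)).aestronglyMeasurable

/-- Multiplication of a Schwartz function by the variable. -/
def mulX (f : 𝓢(ℝ, ℂ)) : 𝓢(ℝ, ℂ) := SchwartzMap.smulLeftCLM ℂ (fun x : ℝ => (x : ℂ)) f

theorem mulX_apply (f : 𝓢(ℝ, ℂ)) (x : ℝ) : mulX f x = x * f x :=
  SchwartzMap.smulLeftCLM_apply_apply Function.Complex.hasTemperateGrowth_ofReal f x

theorem time_mul_schwartzStft (ψ f : 𝓢(ℝ, ℂ)) (t ν : ℝ) :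
    (t : ℂ) * schwartzStft ψ f t ν
      = schwartzStft ψ (mulX f) t ν - schwartzStft (mulX ψ) f t ν := by
  unfold schwartzStft
  rw [← integral_const_mul,
    ← integral_sub (integrable_schwartzStft _ _ _ _) (integrable_schwartzStft _ _ _ _)]
  congr 1
  ext x
  rw [mulX_apply, mulX_apply]
  push_cast
  ring

theorem freq_mul_schwartzStft (ψ f : 𝓢(ℝ, ℂ)) (t ν : ℝ) :
    (2 * Real.pi * Complex.I * ν) * schwartzStft ψ f t ν
      = schwartzStft ψ (SchwartzMap.derivCLM ℂ ℂ f) t ν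
        + schwartzStft (SchwartzMap.derivCLM ℂ ℂ ψ) f t ν := by
  have hu : ∀ x : ℝ, HasDerivAt (fun x : ℝ => f x * ψ (x - t))
      (deriv f x * ψ (x - t) + f x * deriv ψ (x - t)) x := by
    intro x
    exact (f.hasDerivAt x).mul ((ψ.hasDerivAt (x - t)).comp_sub_const x t)
  have hv : ∀ x : ℝ, HasDerivAt (fun x : ℝ => Complex.exp (-2 * Real.pi * Complex.I * x * ν))
      (Complex.exp (-2 * Real.pi * Complex.I * x * ν) * (-2 * Real.pi * Complex.I * ν)) x := by
    intro x
    have h1 : HasDerivAt (fun x : ℝ => (x : ℂ)) 1 x := Complex.ofRealCLM.hasDerivAt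
    refine (((h1.const_mul (-2 * Real.pi * Complex.I)).mul_const (ν : ℂ)).cexp).congr_deriv ?_
    ring
  have i0 := integrable_schwartzStft ψ f t ν
  have i1 := integrable_schwartzStft ψ (SchwartzMap.derivCLM ℂ ℂ f) t ν
  have i2 := integrable_schwartzStft (SchwartzMap.derivCLM ℂ ℂ ψ) f t ν
  have key := integral_mul_deriv_eq_deriv_mul_of_integrable (fun x _ => hu x) (fun x _ => hv x)
    ((i0.const_mul (-2 * Real.pi * Complex.I * ν)).congr
      (Eventually.of_forall fun x => by simp only [Pi.mul_apply]; ring))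
    ((i1.add i2).congr (Eventually.of_forall fun x => by
      simp only [Pi.mul_apply, Pi.add_apply, SchwartzMap.derivCLM_apply]; ring))
    (i0.congr (Eventually.of_forall fun x => by simp only [Pi.mul_apply]; ring))
  unfold schwartzStft
  rw [← integral_const_mul, ← integral_add i1 i2]
  have e1 : ∫ x : ℝ, f x * ψ (x - t) * (Complex.exp (-2 * Real.pi * Complex.I * x * ν)
        * (-2 * Real.pi * Complex.I * ν))
      = - ∫ x : ℝ, 2 * Real.pi * Complex.I * ν *
        (f x * (Complex.exp (-2 * Real.pi * Complex.I * x * ν) * ψ (x - t))) := by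
    rw [← integral_neg]
    congr 1
    ext x
    ring
  rw [e1] at key
  rw [neg_injective key]
  congr 1
  ext x
  simp only [SchwartzMap.derivCLM_apply]
  ring

theorem schwartzStft_decay (a b : ℕ) : ∀ ψ f : 𝓢(ℝ, ℂ), ∃ C : ℝ, ∀ t ν : ℝ,
    |t| ^ a * |ν| ^ b * ‖schwartzStft ψ f t ν‖ ≤ C := by
  induction a with
  | zero =>
    induction b with
    | zero =>
      intro ψ f
      refine ⟨∫ x, SchwartzMap.seminorm ℂ 0 0 ψ * ‖f x‖, fun t ν => ?_⟩
      rw [pow_zero, pow_zero, one_mul, one_mul]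
      exact norm_integral_le_of_norm_le (f.integrable.norm.const_mul _)
        (Eventually.of_forall (norm_schwartzStft_integrand_le ψ f t ν))
    | succ b ih =>
      intro ψ f
      obtain ⟨C, hC⟩ := ih ψ (SchwartzMap.derivCLM ℂ ℂ f)
      obtain ⟨D, hD⟩ := ih (SchwartzMap.derivCLM ℂ ℂ ψ) f
      refine ⟨(C + D) / (2 * Real.pi), fun t ν => ?_⟩
      rw [le_div_iff₀ (by positivity)]
      have e : 2 * Real.pi * |ν| * ‖schwartzStft ψ f t ν‖
          ≤ ‖schwartzStft ψ (SchwartzMap.derivCLM ℂ ℂ f) t ν‖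
            + ‖schwartzStft (SchwartzMap.derivCLM ℂ ℂ ψ) f t ν‖ := by
        refine le_trans (le_of_eq ?_) (norm_add_le _ _)
        rw [← freq_mul_schwartzStft, norm_mul]
        simp [abs_of_pos Real.pi_pos]
      calc |t| ^ 0 * |ν| ^ (b + 1) * ‖schwartzStft ψ f t ν‖ * (2 * Real.pi)
          = |t| ^ 0 * |ν| ^ b * (2 * Real.pi * |ν| * ‖schwartzStft ψ f t ν‖) := by ring
        _ ≤ |t| ^ 0 * |ν| ^ b * (‖schwartzStft ψ (SchwartzMap.derivCLM ℂ ℂ f) t ν‖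
            + ‖schwartzStft (SchwartzMap.derivCLM ℂ ℂ ψ) f t ν‖) := by gcongr
        _ ≤ C + D := by rw [mul_add]; exact add_le_add (hC t ν) (hD t ν)
  | succ a ih =>
    intro ψ f
    obtain ⟨C, hC⟩ := ih ψ (mulX f)
    obtain ⟨D, hD⟩ := ih (mulX ψ) f
    refine ⟨C + D, fun t ν => ?_⟩
    have e : |t| * ‖schwartzStft ψ f t ν‖
        ≤ ‖schwartzStft ψ (mulX f) t ν‖ + ‖schwartzStft (mulX ψ) f t ν‖ := by
      refine le_trans (le_of_eq ?_) (norm_sub_le _ _)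
      rw [← time_mul_schwartzStft, norm_mul, Complex.norm_real, Real.norm_eq_abs]
    calc |t| ^ (a + 1) * |ν| ^ b * ‖schwartzStft ψ f t ν‖
        = |t| ^ a * |ν| ^ b * (|t| * ‖schwartzStft ψ f t ν‖) := by ring
      _ ≤ |t| ^ a * |ν| ^ b *
          (‖schwartzStft ψ (mulX f) t ν‖ + ‖schwartzStft (mulX ψ) f t ν‖) := by gcongr
      _ ≤ C + D := by rw [mul_add]; exact add_le_add (hC t ν) (hD t ν)

theorem stft_coe_eq (f : 𝓢(ℝ, ℂ)) (t ν : ℝ) :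
    stft (f : 𝓢'(ℝ, ℂ)) t ν = schwartzStft (gaussian 0) f t ν := by
  rw [stft, SchwartzMap.coe_apply, schwartzStft]
  congr 1
  ext x
  have : (gaussian 0) (x - t) = gexp 0 (x - t) := rfl
  rw [stftAtom_apply, this, gexp, smul_eq_mul, mul_comm]
  push_cast
  ring_nf

theorem stft_coe_decay (f : 𝓢(ℝ, ℂ)) (a b : ℕ) : ∃ C : ℝ, ∀ t ν : ℝ,
    ‖stft (f : 𝓢'(ℝ, ℂ)) t ν‖ ≤ C * ((1 + ‖t‖) ^ (-a : ℝ) * (1 + ‖ν‖) ^ (-b : ℝ)) := by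
  obtain ⟨C0, h0⟩ := schwartzStft_decay 0 0 (gaussian 0) f
  obtain ⟨C1, h1⟩ := schwartzStft_decay a 0 (gaussian 0) f
  obtain ⟨C2, h2⟩ := schwartzStft_decay 0 b (gaussian 0) f
  obtain ⟨C3, h3⟩ := schwartzStft_decay a b (gaussian 0) f
  refine ⟨2 ^ a * 2 ^ b * (C0 + C1 + C2 + C3), fun t ν => ?_⟩
  rw [stft_coe_eq, Real.rpow_neg (by positivity), Real.rpow_neg (by positivity),
    Real.rpow_natCast, Real.rpow_natCast, ← mul_inv, ← div_eq_mul_inv, le_div_iff₀ (by positivity),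
    Real.norm_eq_abs, Real.norm_eq_abs]
  have hp : ∀ (s : ℝ) (n : ℕ), (1 + |s|) ^ n ≤ 2 ^ n * (1 + |s| ^ n) := by
    intro s n
    have h2 : (1 + |s|) ^ n ≤ (2 * max 1 |s|) ^ n := by
      gcongr
      linarith [le_max_left 1 |s|, le_max_right 1 |s|]
    refine h2.trans ?_
    rw [mul_pow]
    gcongr
    rcases max_choice 1 |s| with h | h <;> rw [h]
    · rw [one_pow]; linarith [pow_nonneg (abs_nonneg s) n]
    · linarith
  set G := ‖schwartzStft (gaussian 0) f t ν‖
  calc G * ((1 + |t|) ^ a * (1 + |ν|) ^ b)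
      ≤ G * ((2 ^ a * (1 + |t| ^ a)) * (2 ^ b * (1 + |ν| ^ b))) := by
        gcongr
        · exact hp t a
        · exact hp ν b
    _ = 2 ^ a * 2 ^ b * (|t| ^ 0 * |ν| ^ 0 * G + |t| ^ a * |ν| ^ 0 * G + |t| ^ 0 * |ν| ^ b * G
          + |t| ^ a * |ν| ^ b * G) := by ring
    _ ≤ _ := by
        have := h0 t ν
        have := h1 t ν
        have := h2 t ν
        have := h3 t ν
        gcongr

theorem schwartz_mem_modulationSpace (p q : ℝ≥0∞) (f : 𝓢(ℝ, ℂ)) :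
    (f : 𝓢'(ℝ, ℂ)) ∈ modulationSpace p q := by
  obtain ⟨a, ha⟩ := Measure.HasTemperateGrowth.exists_eLpNorm_lt_top p
    (μ := (volume : Measure ℝ)) inferInstance
  obtain ⟨b, hb⟩ := Measure.HasTemperateGrowth.exists_eLpNorm_lt_top q
    (μ := (volume : Measure ℝ)) inferInstance
  obtain ⟨C, hC⟩ := stft_coe_decay f a b
  set N := eLpNorm (fun x : ℝ => (1 + ‖x‖) ^ (-a : ℝ)) p volume with hN
  have hle : ∀ ν : ℝ, ‖eLpNorm (fun t : ℝ => stft (f : 𝓢'(ℝ, ℂ)) t ν) p volume‖ₑ ≤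
      ((‖C‖₊ * N.toNNReal : ℝ≥0) : ℝ≥0∞) * ‖(1 + ‖ν‖) ^ (-b : ℝ)‖ₑ := by
    intro ν
    have h1 : ∀ t : ℝ, ‖stft (f : 𝓢'(ℝ, ℂ)) t ν‖ ≤
        ‖C * (1 + ‖ν‖) ^ (-b : ℝ)‖ * ‖(1 + ‖t‖) ^ (-a : ℝ)‖ := by
      intro t
      refine (hC t ν).trans ((le_abs_self _).trans (le_of_eq ?_))
      rw [← Real.norm_eq_abs, norm_mul, norm_mul, norm_mul]
      ring
    have h2 := eLpNorm_le_mul_eLpNorm_of_ae_le_mul (μ := volume) (Eventually.of_forall h1) p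
    rw [enorm_eq_self]
    refine h2.trans (le_of_eq ?_)
    rw [ENNReal.coe_mul, ENNReal.coe_toNNReal ha.ne, ofReal_norm, enorm_mul]
    change _ * N = _
    rw [← enorm_eq_nnnorm]
    ring
  have h3 := eLpNorm_le_nnreal_smul_eLpNorm_of_ae_le_mul' (μ := volume)
    (Eventually.of_forall hle) q
  refine h3.trans_lt ?_
  exact ENNReal.mul_lt_top ENNReal.coe_lt_top hb

/-- A Schwartz function regarded as an element of `M^{p,q}(ℝ)`. -/
def ofSchwartz (p q : ℝ≥0∞) (f : 𝓢(ℝ, ℂ)) : modulationSpace p q :=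
  ⟨(f : 𝓢'(ℝ, ℂ)), schwartz_mem_modulationSpace p q f⟩

/-! ### The bilinear Hilbert transform -/

/-- The truncated integral `∫_{|y| > ε} f(x + y) g(x - y) dy / y`. -/
def truncatedBHT (f g : 𝓢(ℝ, ℂ)) (x ε : ℝ) : ℂ :=
  ∫ y : ℝ in {y : ℝ | ε < |y|}, f (x + y) * g (x - y) / (y : ℂ)

/-- The tempered distribution `T` is (integration against) the bilinear Hilbert transform
`BH(f, g)` of two Schwartz functions: the principal value
`h x = lim_{ε → 0+} ∫_{|y| > ε} f(x + y) g(x - y) dy / y` exists at every `x`, and `T` is the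
distribution given by the function `h`. -/
def IsBHT (f g : 𝓢(ℝ, ℂ)) (T : 𝓢'(ℝ, ℂ)) : Prop :=
  ∃ h : ℝ → ℂ, (∀ x : ℝ, Tendsto (truncatedBHT f g x) (𝓝[>] 0) (𝓝 (h x))) ∧
    ∀ u : 𝓢(ℝ, ℂ), Integrable (fun x : ℝ => u x * h x) ∧ T u = ∫ x : ℝ, u x * h x

/-- The bilinear Hilbert transform, initially defined on pairs of Schwartz functions, extends to a
bounded bilinear operator `M^{p₁,q₁} × M^{p₂,q₂} → M^{p₀,q₃}`. -/
def BHTExtendsBoundedly (p₁ q₁ p₂ q₂ p₀ q₃ : ℝ≥0∞) : Prop :=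
  ∃ (B : modulationSpace p₁ q₁ →ₗ[ℂ] modulationSpace p₂ q₂ →ₗ[ℂ] modulationSpace p₀ q₃) (C : ℝ≥0),
    (∀ f g : 𝓢(ℝ, ℂ), IsBHT f g (B (ofSchwartz p₁ q₁ f) (ofSchwartz p₂ q₂ g) : 𝓢'(ℝ, ℂ))) ∧
    ∀ (F : modulationSpace p₁ q₁) (G : modulationSpace p₂ q₂),
      modNorm p₀ q₃ (B F G : 𝓢'(ℝ, ℂ)) ≤
        C * modNorm p₁ q₁ (F : 𝓢'(ℝ, ℂ)) * modNorm p₂ q₂ (G : 𝓢'(ℝ, ℂ))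

end ModulationBHT

end

noncomputable section

namespace ModulationBHT

/-! ### Multilinear inequalities for nonnegative kernels -/

/-! Expand `f` and `g` into Gaussian time-frequency atoms at `(t₁, ν₁)` and `(t₂, ν₂)`, weighted by
their short-time Fourier transforms. In the product of two atoms at `x + y` and `x - y`, the
parallelogram identity separates `x` from `y` (`atomProd_eq`): what remains is an atom in `x` at
time `(t₁ + t₂)/2` and frequency `ν₁ + ν₂`, times a Gaussian in `y` centred at `b = (t₁ - t₂)/2`
with frequency `ξ = ν₁ - ν₂`. Integrating the latter against `dy / y` gives a number `bhtKer b ξ` of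
size `O(1 / (1 + |b|))`, uniformly in `ξ` (`exists_norm_bhtKer_le`). Uniformity in `ξ` is the
cancellation of the Hilbert kernel; the decay in `b` is that of `1 / y`.

Hence the transform of `BH(f, g)` at `(t, ν)` is dominated by a positive bilinear operator `phaseOp`
applied to the absolute transforms of `f` and `g` (`exists_absStft_bhtDist_le`), whose kernel is a
time factor times a frequency factor. Minkowski's inequality separates the two
(`mixedNorm_phaseOp_le`). The frequency part is a convolution with an integrable bounded kernel,
handled by Young's inequality. The time part has kernel `wt (t₁ - t₂) wt (2t - t₁ - t₂)²`; its first
factor lies in `L^r` only for `r > 1`, whence the strict inequality between the `p`'s. It is treated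
by the pointwise inequality `rpow_mul_rpow_mul_rpow_le`, which replaces multilinear interpolation,
and by local averaging, which raises the exponents.

The extension is the phase-space integral itself, paired with test functions. It converges
absolutely on the modulation spaces, so no density argument is needed, even for infinite exponents.
For Schwartz functions, Gaussian inversion and Fubini identify it with the principal value. -/

theorem rpow_mul_rpow_mul_rpow_le_of_sorted {f g w : ℝ≥0∞} (hfg : g ≤ f) (hgw : w ≤ g)
    {a b c s : ℝ} (ha0 : 0 ≤ a) (hb0 : 0 ≤ b) (hc0 : 0 ≤ c) (ha : a ≤ 1) (hs0 : 0 ≤ s)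
    (hs1 : s ≤ 1) (h : a + b + c = 1 + s) :
    f ^ a * g ^ b * w ^ c ≤ (f * g) ^ s * f ^ (1 - s) := by
  have h1 : f ^ s * f ^ (1 - s) = f := by
    rw [← ENNReal.rpow_add_of_nonneg _ _ hs0 (by linarith)]; simp
  have h2 : f ^ a * f ^ (1 - a) = f := by
    rw [← ENNReal.rpow_add_of_nonneg _ _ ha0 (by linarith)]; simp
  -- Exponent is moved towards the larger bases: all of `c` to `g`, then the part `1 - a` of `b + c
  -- = (1 - a) + s` from `g` to `f`.
  calc f ^ a * g ^ b * w ^ c ≤ f ^ a * g ^ b * g ^ c := by gcongr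
    _ = f ^ a * (g ^ (1 - a) * g ^ s) := by
      rw [mul_assoc, ← ENNReal.rpow_add_of_nonneg _ _ hb0 hc0,
        ← ENNReal.rpow_add_of_nonneg _ _ (by linarith) hs0]
      congr 2; linarith
    _ ≤ f ^ a * (f ^ (1 - a) * g ^ s) := by gcongr
    _ = f * g ^ s := by rw [← mul_assoc, h2]
    _ = (f * g) ^ s * f ^ (1 - s) := by
      rw [ENNReal.mul_rpow_of_nonneg _ _ hs0]
      nth_rw 1 [← h1]
      ring

/-- Among exponents in the unit cube with sum `1 + s`, the product is largest with `1` on the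
largest base, `s` on the middle one and `0` on the smallest. In the applications the pair products
have finite total mass and the single functions finite mass on fibres, as the fibrewise Hölder
argument requires. -/
theorem rpow_mul_rpow_mul_rpow_le (f g w : ℝ≥0∞) {a b c s : ℝ} (ha0 : 0 ≤ a) (hb0 : 0 ≤ b)
    (hc0 : 0 ≤ c) (ha : a ≤ 1) (hb : b ≤ 1) (hc : c ≤ 1) (hs0 : 0 ≤ s) (hs1 : s ≤ 1)
    (h : a + b + c = 1 + s) :
    f ^ a * g ^ b * w ^ c ≤ (f * g + f * w + g * w) ^ s * (f + g + w) ^ (1 - s) := by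
  have hs : 0 ≤ 1 - s := by linarith
  have key : ∀ x y z : ℝ≥0∞, y ≤ x → z ≤ y → ∀ a b c : ℝ, 0 ≤ a → 0 ≤ b → 0 ≤ c → a ≤ 1 →
      a + b + c = 1 + s → x ^ a * y ^ b * z ^ c ≤
        (x * y + x * z + y * z) ^ s * (x + y + z) ^ (1 - s) := by
    intro x y z hxy hyz a b c ha0 hb0 hc0 ha h
    refine (rpow_mul_rpow_mul_rpow_le_of_sorted hxy hyz ha0 hb0 hc0 ha hs0 hs1 h).trans ?_
    gcongr
    · rw [add_assoc]; exact le_self_add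
    · rw [add_assoc]; exact le_self_add
  -- Eight sign patterns for six orderings: the second and the seventh are cyclic, hence force
  -- equality, and share the ordering of a neighbour.
  rcases le_total f g with h1 | h1 <;> rcases le_total g w with h2 | h2 <;>
    rcases le_total f w with h3 | h3
  · convert key w g f h2 h1 c b a hc0 hb0 ha0 hc (by linarith) using 1 <;> ring_nf
  · convert key w g f h2 h1 c b a hc0 hb0 ha0 hc (by linarith) using 1 <;> ring_nf
  · convert key g w f h2 h3 b c a hb0 hc0 ha0 hb (by linarith) using 1 <;> ring_nf
  · convert key g f w h1 h3 b a c hb0 ha0 hc0 hb (by linarith) using 1 <;> ring_nf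
  · convert key w f g h3 h1 c a b hc0 ha0 hb0 hc (by linarith) using 1 <;> ring_nf
  · convert key f w g h3 h2 a c b ha0 hc0 hb0 ha (by linarith) using 1 <;> ring_nf
  · exact key f g w h1 h2 a b c ha0 hb0 hc0 ha h
  · exact key f g w h1 h2 a b c ha0 hb0 hc0 ha h

section Core

variable {α β : Type*} [MeasurableSpace α] [MeasurableSpace β] {μ : Measure α} {ν : Measure β}

theorem toReal_inv_nonneg (p : ℝ≥0∞) : 0 ≤ (p⁻¹).toReal := ENNReal.toReal_nonneg

theorem toReal_inv_le_one {p : ℝ≥0∞} (hp : 1 ≤ p) : (p⁻¹).toReal ≤ 1 := by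
  have := ENNReal.toReal_mono ENNReal.one_ne_top (ENNReal.inv_le_one.2 hp)
  simpa using this

/-- If a kernel is dominated by `c P^{1/p} Q^{1-1/p}`, where `P` has total mass at most `K` and the
fibres of `Q` have mass at most `K`, then its marginal has `L^p` norm at most `c K`. -/
theorem eLpNorm_lintegral_le_of_le_rpow_mul_rpow [SFinite ν] {p : ℝ≥0∞} (hp : 1 ≤ p)
    {H P Q : α → β → ℝ≥0∞} (hP : Measurable (Function.uncurry P))
    (hQ : Measurable (Function.uncurry Q)) {c K : ℝ≥0∞}
    (hH : ∀ᵐ a ∂μ, ∀ᵐ b ∂ν, H a b ≤ c * (P a b ^ (p⁻¹).toReal * Q a b ^ (1 - (p⁻¹).toReal)))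
    (hPK : ∫⁻ a, ∫⁻ b, P a b ∂ν ∂μ ≤ K) (hQK : ∀ a, ∫⁻ b, Q a b ∂ν ≤ K) :
    eLpNorm (fun a => ∫⁻ b, H a b ∂ν) p μ ≤ c * K := by
  have hs0 := toReal_inv_nonneg p
  have hs1 := toReal_inv_le_one hp
  set s := (p⁻¹).toReal with hs
  have hPm : ∀ a, Measurable (P a) := fun a => hP.comp measurable_prodMk_left
  have hQm : ∀ a, Measurable (Q a) := fun a => hQ.comp measurable_prodMk_left
  -- Hölder on each fibre with weights `s` and `1 - s`. Taking `p`-th powers turns `(∫ P) ^ s` into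
  -- `∫ P`, since `s p = 1`; for `p = ∞` one has `s = 0` and the bound is already uniform.
  have h1 : ∀ᵐ a ∂μ, ∫⁻ b, H a b ∂ν ≤ c * ((∫⁻ b, P a b ∂ν) ^ s * K ^ (1 - s)) := by
    filter_upwards [hH] with a ha
    calc ∫⁻ b, H a b ∂ν ≤ ∫⁻ b, c * (P a b ^ s * Q a b ^ (1 - s)) ∂ν := lintegral_mono_ae ha
      _ = c * ∫⁻ b, P a b ^ s * Q a b ^ (1 - s) ∂ν :=
        lintegral_const_mul _ (((hPm a).pow_const _).mul ((hQm a).pow_const _))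
      _ ≤ c * ((∫⁻ b, P a b ∂ν) ^ s * (∫⁻ b, Q a b ∂ν) ^ (1 - s)) := by
        gcongr
        exact ENNReal.lintegral_mul_norm_pow_le (hPm a).aemeasurable (hQm a).aemeasurable hs0
          (by linarith) (by ring)
      _ ≤ _ := by
        gcongr
        exact hQK a
  rcases eq_or_ne p ⊤ with rfl | hpt
  · rw [eLpNorm_exponent_top, eLpNormEssSup]
    refine essSup_le_of_ae_le _ ?_
    filter_upwards [h1] with a ha
    simpa [hs] using ha
  · have hp0 : p ≠ 0 := (zero_lt_one.trans_le hp).ne'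
    have hpr : 0 < p.toReal := ENNReal.toReal_pos hp0 hpt
    have hsp : s * p.toReal = 1 := by
      rw [hs, ENNReal.toReal_inv]; field_simp
    rw [eLpNorm_eq_lintegral_rpow_enorm_toReal hp0 hpt]
    have hmP : Measurable fun a => ∫⁻ b, P a b ∂ν := hP.lintegral_prod_right'
    have h2 : ∫⁻ a, ‖∫⁻ b, H a b ∂ν‖ₑ ^ p.toReal ∂μ
        ≤ (c * K ^ (1 - s)) ^ p.toReal * K := by
      calc _ ≤ ∫⁻ a, (c * K ^ (1 - s)) ^ p.toReal * ∫⁻ b, P a b ∂ν ∂μ := by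
            refine lintegral_mono_ae ?_
            filter_upwards [h1] with a ha
            rw [enorm_eq_self]
            calc _ ≤ (c * ((∫⁻ b, P a b ∂ν) ^ s * K ^ (1 - s))) ^ p.toReal := by gcongr
              _ = (c * K ^ (1 - s)) ^ p.toReal * ((∫⁻ b, P a b ∂ν) ^ s) ^ p.toReal := by
                rw [← ENNReal.mul_rpow_of_nonneg _ _ hpr.le]; ring_nf
              _ = _ := by rw [← ENNReal.rpow_mul, hsp, ENNReal.rpow_one]
        _ = (c * K ^ (1 - s)) ^ p.toReal * ∫⁻ a, ∫⁻ b, P a b ∂ν ∂μ :=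
          lintegral_const_mul _ hmP
        _ ≤ _ := by gcongr
    calc _ ≤ ((c * K ^ (1 - s)) ^ p.toReal * K) ^ (1 / p.toReal) := by gcongr
      _ = c * K ^ (1 - s) * K ^ s := by
        rw [ENNReal.mul_rpow_of_nonneg _ _ (by positivity), ← ENNReal.rpow_mul]
        have : s = 1 / p.toReal := by field_simp; linarith
        rw [← this, mul_comm p.toReal s, hsp, ENNReal.rpow_one]
      _ = c * K := by
        rw [mul_assoc, ← ENNReal.rpow_add_of_nonneg _ _ (by linarith) hs0]
        simp

/-- Minkowski's integral inequality. -/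
theorem eLpNorm_lintegral_le_lintegral [SFinite μ] [SFinite ν] {p : ℝ≥0∞} (hp : 1 ≤ p)
    {h : α → β → ℝ≥0∞} (hh : Measurable (Function.uncurry h)) {M : β → ℝ≥0∞} (hM : Measurable M)
    (hle : ∀ b, eLpNorm (fun a => h a b) p μ ≤ M b) :
    eLpNorm (fun a => ∫⁻ b, h a b ∂ν) p μ ≤ ∫⁻ b, M b ∂ν := by
  rcases eq_or_ne (∫⁻ b, M b ∂ν) ⊤ with htop | htop
  · rw [htop]; exact le_top
  have hfin : ∀ᵐ b ∂ν, M b < ⊤ := ae_lt_top hM htop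
  have hp0 : p ≠ 0 := (zero_lt_one.trans_le hp).ne'
  have hmb : ∀ b, Measurable fun a => h a b := fun b => hh.comp measurable_prodMk_right
  rcases eq_or_ne p ⊤ with rfl | hpt
  · rw [eLpNorm_exponent_top, eLpNormEssSup]
    refine essSup_le_of_ae_le _ ?_
    have h1 : ∀ᵐ a ∂μ, ∀ᵐ b ∂ν, h a b ≤ M b := by
      rw [Measure.ae_ae_comm (p := fun a b => h a b ≤ M b)
        (measurableSet_le hh (hM.comp measurable_snd))]
      refine Eventually.of_forall fun b => ?_
      have h2 := hle b
      rw [eLpNorm_exponent_top, eLpNormEssSup] at h2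
      exact (ENNReal.ae_le_essSup fun a => ‖h a b‖ₑ).mono fun a ha => ha.trans h2
    filter_upwards [h1] with a ha
    exact lintegral_mono_ae ha
  · have hpr : 0 < p.toReal := ENNReal.toReal_pos hp0 hpt
    have hpr1 : 1 ≤ p.toReal := by
      rw [← ENNReal.toReal_one]; exact ENNReal.toReal_mono hpt hp
    have hsp : (p⁻¹).toReal = 1 / p.toReal := by rw [ENNReal.toReal_inv, one_div]
    have hint : ∀ b, ∫⁻ a, h a b ^ p.toReal ∂μ ≤ M b ^ p.toReal := by
      intro b
      have h2 := hle b
      rw [eLpNorm_eq_lintegral_rpow_enorm_toReal hp0 hpt] at h2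
      have h3 := ENNReal.rpow_le_rpow h2 hpr.le
      rw [← ENNReal.rpow_mul, one_div_mul_cancel hpr.ne', ENNReal.rpow_one] at h3
      exact h3
    -- Where `M b = 0` the power of `M b` in the factorization below need not cancel against its
    -- inverse, so the vanishing of `h` there is needed separately.
    have hzero : ∀ᵐ a ∂μ, ∀ᵐ b ∂ν, M b = 0 → h a b = 0 := by
      rw [Measure.ae_ae_comm (p := fun a b => M b = 0 → h a b = 0)
        ((measurableSet_eq_fun (hM.comp measurable_snd) measurable_const).compl.union
          (measurableSet_eq_fun hh measurable_const) |> fun hset => by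
            convert hset using 1
            ext x
            simp only [Set.mem_ofPred_eq, Set.mem_union, Set.mem_compl_iff, Function.comp,
              Function.uncurry]
            tauto)]
      refine Eventually.of_forall fun b => ?_
      by_cases hb : M b = 0
      · have h2 := hle b
        rw [hb, nonpos_iff_eq_zero, eLpNorm_eq_zero_iff (hmb b).aestronglyMeasurable hp0] at h2
        filter_upwards [h2] with a ha _
        exact ha
      · exact Eventually.of_forall fun a h' => absurd h' hb
    -- Formally `h = P ^ (1/p) Q ^ (1 - 1/p)` with `P = h ^ p M ^ (1 - p)` and `Q = M`; the
    -- hypothesis on `h` gives `∫ P da ≤ M b`, so both masses are at most `∫ M`.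
    have key := eLpNorm_lintegral_le_of_le_rpow_mul_rpow (μ := μ) (ν := ν) hp (H := h)
      (P := fun a b => h a b ^ p.toReal * (M b ^ (p.toReal - 1))⁻¹) (Q := fun _ b => M b)
      (c := 1) (K := ∫⁻ b, M b ∂ν) ?_ (hM.comp measurable_snd) ?_ ?_ (fun a => le_rfl)
    · simpa using key
    · exact (hh.pow_const _).mul ((hM.comp measurable_snd).pow_const _).inv
    · filter_upwards [hzero] with a ha
      filter_upwards [ha, hfin] with b hb hb'
      rcases eq_or_ne (M b) 0 with h0 | h0
      · simp [hb h0]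
      rw [one_mul, hsp, ENNReal.mul_rpow_of_nonneg _ _ (by positivity), ← ENNReal.rpow_mul,
        mul_one_div_cancel hpr.ne', ENNReal.rpow_one, ← ENNReal.rpow_neg, ← ENNReal.rpow_mul,
        mul_assoc, ← ENNReal.rpow_add _ _ h0 hb'.ne]
      have : -(p.toReal - 1) * (1 / p.toReal) + (1 - 1 / p.toReal) = 0 := by
        field_simp; ring
      rw [this]; simp
    · rw [lintegral_lintegral_swap
        ((hh.pow_const _).mul ((hM.comp measurable_snd).pow_const _).inv).aemeasurable]
      refine lintegral_mono_ae ?_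
      filter_upwards [hfin] with b hb
      rw [lintegral_mul_const _ ((hmb b).pow_const _)]
      rcases eq_or_ne (M b) 0 with h0 | h0
      · have := hint b
        rw [h0, ENNReal.zero_rpow_of_pos hpr, nonpos_iff_eq_zero] at this
        rw [this]; simp
      calc _ ≤ M b ^ p.toReal * (M b ^ (p.toReal - 1))⁻¹ := by gcongr; exact hint b
        _ = M b := by
          rw [← ENNReal.rpow_neg, ← ENNReal.rpow_add _ _ h0 hb.ne]
          simp

/-- Every function is dominated by its `L^p` norm times the `1/p`-th power of a function of unit
mass. -/
theorem exists_le_eLpNorm_mul_rpow [SigmaFinite μ] {p : ℝ≥0∞} (hp : 1 ≤ p) {F : α → ℝ≥0∞}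
    (hF : Measurable F) : ∃ f : α → ℝ≥0∞, Measurable f ∧ ∫⁻ x, f x ∂μ ≤ 1 ∧
      ∀ᵐ x ∂μ, F x ≤ eLpNorm F p μ * f x ^ (p⁻¹).toReal := by
  have hp0 : p ≠ 0 := (zero_lt_one.trans_le hp).ne'
  rcases eq_or_ne (eLpNorm F p μ) ⊤ with htop | htop
  -- For infinite norm any strictly positive function of mass below one will do: the right-hand side
  -- is then infinite everywhere.
  · obtain ⟨g, hg0, hgm, hg⟩ := exists_pos_lintegral_lt_of_sigmaFinite μ (ε := 1) one_ne_zero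
    refine ⟨fun x => g x, hgm.coe_nnreal_ennreal, hg.le, Eventually.of_forall fun x => ?_⟩
    rw [htop, ENNReal.top_mul]
    · exact le_top
    · exact (ENNReal.rpow_pos (by exact_mod_cast hg0 x) ENNReal.coe_ne_top).ne'
  rcases eq_or_ne p ⊤ with rfl | hpt
  · refine ⟨0, measurable_zero, by simp, ?_⟩
    rw [eLpNorm_exponent_top, eLpNormEssSup]
    filter_upwards [ENNReal.ae_le_essSup fun a => ‖F a‖ₑ] with x hx
    simpa using hx
  rcases eq_or_ne (eLpNorm F p μ) 0 with h0 | h0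
  · refine ⟨0, measurable_zero, by simp, ?_⟩
    have := (eLpNorm_eq_zero_iff hF.aestronglyMeasurable hp0).1 h0
    filter_upwards [this] with x hx
    rw [hx]; simp
  have hpr : 0 < p.toReal := ENNReal.toReal_pos hp0 hpt
  set N := eLpNorm F p μ with hN
  refine ⟨fun x => (N⁻¹ * F x) ^ p.toReal, (hF.const_mul _).pow_const _, ?_,
    Eventually.of_forall fun x => ?_⟩
  · have h1 : ∫⁻ x, F x ^ p.toReal ∂μ = N ^ p.toReal := by
      rw [hN, eLpNorm_eq_lintegral_rpow_enorm_toReal hp0 hpt, ← ENNReal.rpow_mul,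
        one_div_mul_cancel hpr.ne', ENNReal.rpow_one]
      rfl
    simp_rw [ENNReal.mul_rpow_of_nonneg _ _ hpr.le]
    rw [lintegral_const_mul _ (hF.pow_const _), h1, ← ENNReal.mul_rpow_of_nonneg _ _ hpr.le,
      ENNReal.inv_mul_cancel h0 htop]
    simp
  · rw [← ENNReal.rpow_mul, ENNReal.toReal_inv, mul_inv_cancel₀ hpr.ne', ENNReal.rpow_one,
      ← mul_assoc, ENNReal.mul_inv_cancel h0 htop, one_mul]

end Core

/-! ### Convolution inequalities on the line -/

/-- Young's inequality, for functions dominated by powers of integrable functions. -/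
theorem eLpNorm_conv_le_of_le_rpow {r : ℝ≥0∞} (hr : 1 ≤ r) {a b : ℝ} (ha0 : 0 ≤ a) (hb0 : 0 ≤ b)
    (ha1 : a ≤ 1) (hb1 : b ≤ 1) (hab : a + b = 1 + (r⁻¹).toReal) {F G f g : ℝ → ℝ≥0∞}
    (hf : Measurable f) (hg : Measurable g) {c d K : ℝ≥0∞} (hK : 1 ≤ K)
    (hfK : ∫⁻ x, f x ≤ K) (hgK : ∫⁻ x, g x ≤ K)
    (hF : ∀ᵐ x, F x ≤ c * f x ^ a) (hG : ∀ᵐ x, G x ≤ d * g x ^ b) :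
    eLpNorm (fun x => ∫⁻ y, F y * G (x - y)) r volume ≤ c * d * (2 * K ^ 2) := by
  have hs0 := toReal_inv_nonneg r
  have hs1 := toReal_inv_le_one hr
  have hm : Measurable fun z : ℝ × ℝ => f z.2 * g (z.1 - z.2) := by fun_prop
  refine eLpNorm_lintegral_le_of_le_rpow_mul_rpow hr (P := fun x y => f y * g (x - y))
    (Q := fun x y => f y + g (x - y)) hm (by simp only [Function.uncurry_def]; fun_prop) ?_ ?_ ?_
  · refine Eventually.of_forall fun x => ?_
    filter_upwards [hF, (quasiMeasurePreserving_sub_left volume x).ae hG] with y h1 h2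
    -- A zero base with exponent zero reduces the trilinear inequality to its bilinear form.
    have := rpow_mul_rpow_mul_rpow_le (f y) (g (x - y)) 0 ha0 hb0 le_rfl ha1 hb1 zero_le_one hs0
      hs1 (by linarith)
    simp only [ENNReal.rpow_zero, mul_one, mul_zero, add_zero] at this
    calc F y * G (x - y) ≤ (c * f y ^ a) * (d * g (x - y) ^ b) := mul_le_mul' h1 h2
      _ = c * d * (f y ^ a * g (x - y) ^ b) := by ring
      _ ≤ _ := by gcongr
  · rw [lintegral_lintegral_swap hm.aemeasurable]
    calc ∫⁻ y, ∫⁻ x, f y * g (x - y) = ∫⁻ y, f y * ∫⁻ x, g x := by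
          congr 1; ext y
          rw [lintegral_const_mul _ (by fun_prop), lintegral_sub_right_eq_self]
      _ = (∫⁻ y, f y) * ∫⁻ x, g x := lintegral_mul_const _ hf
      _ ≤ K * K := mul_le_mul' hfK hgK
      _ ≤ 2 * K ^ 2 := by rw [← pow_two, two_mul]; exact le_self_add
  · intro x
    rw [lintegral_add_left hf, lintegral_sub_left_eq_self]
    calc _ ≤ K + K := add_le_add hfK hgK
      _ = 2 * (K * 1) := by ring
      _ ≤ 2 * (K * K) := by gcongr
      _ = _ := by ring

/-- Young's inequality, up to a constant. -/
theorem eLpNorm_conv_le {p q r : ℝ≥0∞} (hp : 1 ≤ p) (hq : 1 ≤ q) (hr : 1 ≤ r)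
    (hpqr : (p⁻¹).toReal + (q⁻¹).toReal = 1 + (r⁻¹).toReal) {F G : ℝ → ℝ≥0∞}
    (hF : Measurable F) (hG : Measurable G) :
    eLpNorm (fun x => ∫⁻ y, F y * G (x - y)) r volume ≤
      eLpNorm F p volume * eLpNorm G q volume * 2 := by
  obtain ⟨f, hf, hf1, hFf⟩ := exists_le_eLpNorm_mul_rpow (μ := volume) hp hF
  obtain ⟨g, hg, hg1, hGg⟩ := exists_le_eLpNorm_mul_rpow (μ := volume) hq hG
  simpa using eLpNorm_conv_le_of_le_rpow hr (toReal_inv_nonneg p) (toReal_inv_nonneg q)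
    (toReal_inv_le_one hp) (toReal_inv_le_one hq) hpqr hf hg le_rfl hf1 hg1 hFf hGg

/-- Convolution with a bounded integrable kernel maps `L^p` to `L^r` for `p ≤ r`. -/
theorem eLpNorm_conv_kernel_le {p r : ℝ≥0∞} (hp : 1 ≤ p) (hpr : (r⁻¹).toReal ≤ (p⁻¹).toReal)
    (hr : 1 ≤ r) {F κ : ℝ → ℝ≥0∞} (hF : Measurable F) (hκ : Measurable κ) (hκ1 : ∀ x, κ x ≤ 1)
    {K : ℝ≥0∞} (hK : 1 ≤ K) (hκK : ∫⁻ x, κ x ≤ K) :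
    eLpNorm (fun x => ∫⁻ y, F y * κ (x - y)) r volume ≤ eLpNorm F p volume * (2 * K ^ 2) := by
  obtain ⟨f, hf, hf1, hFf⟩ := exists_le_eLpNorm_mul_rpow (μ := volume) hp hF
  have h1 := toReal_inv_nonneg r
  have h2 := toReal_inv_le_one hp
  -- As `κ ≤ 1`, it is below each of its powers with exponent in `[0, 1]`, in particular the one
  -- that Young's relation dictates.
  have := eLpNorm_conv_le_of_le_rpow (b := 1 + (r⁻¹).toReal - (p⁻¹).toReal) (G := κ) (d := 1) hr
    (toReal_inv_nonneg p) (by linarith) h2 (by linarith) (by ring) hf hκ hK (hf1.trans hK) hκK hFf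
    (Eventually.of_forall fun x => ?_)
  · simpa using this
  · rw [one_mul]
    calc κ x = κ x ^ (1 : ℝ) := (ENNReal.rpow_one _).symm
      _ ≤ _ := ENNReal.rpow_le_rpow_of_exponent_ge (hκ1 x) (by linarith)

/-! ### The weight `1 / (1 + |x|)` -/

/-- The weight `1 / (1 + |x|)`. -/
def wt (x : ℝ) : ℝ≥0∞ := ENNReal.ofReal (1 + |x|)⁻¹

theorem measurable_wt : Measurable wt := by unfold wt; fun_prop

theorem wt_le_one (x : ℝ) : wt x ≤ 1 := by
  rw [wt, ENNReal.ofReal_le_one]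
  exact inv_le_one_of_one_le₀ (by linarith [abs_nonneg x])

theorem wt_le_mul_wt {x y c : ℝ} (hc : 0 ≤ c) (h : 1 + |y| ≤ c * (1 + |x|)) :
    wt x ≤ ENNReal.ofReal c * wt y := by
  rw [wt, wt, ← ENNReal.ofReal_mul hc]
  apply ENNReal.ofReal_le_ofReal
  rw [← div_eq_mul_inv, inv_eq_one_div, div_le_div_iff₀ (by positivity) (by positivity)]
  linarith

theorem wt_le_wt {x y : ℝ} (h : |y| ≤ |x|) : wt x ≤ wt y := by
  simpa using wt_le_mul_wt (c := 1) zero_le_one (by linarith)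

theorem wt_le_two_mul_wt_add {x u : ℝ} (hu : |u| ≤ 1) : wt x ≤ 2 * wt (x + u) := by
  have := abs_add_le x u
  simpa using wt_le_mul_wt (x := x) (y := x + u) (c := 2) zero_le_two
    (by linarith [abs_nonneg x])

/-- The weight itself just fails to be integrable. This missing endpoint is the source of the strict
inequality required of the time exponents. -/
theorem lintegral_wt_rpow_lt_top {r : ℝ} (hr : 1 < r) : ∫⁻ x, wt x ^ r < ⊤ := by
  have := finite_integral_one_add_norm (E := ℝ) (μ := volume) (r := r) (by simpa using hr)
  convert this using 2
  ext x
  rw [wt, ENNReal.ofReal_rpow_of_nonneg (by positivity) (by linarith),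
    Real.inv_rpow (by positivity), Real.rpow_neg (by positivity), Real.norm_eq_abs]

/-- The total mass of `1 / (1 + |x|) ^ 2`. -/
def wtMass : ℝ≥0∞ := ∫⁻ x, wt x ^ 2

theorem wtMass_lt_top : wtMass < ⊤ := by
  have := lintegral_wt_rpow_lt_top (r := 2) (by norm_num)
  simp only [ENNReal.rpow_two] at this
  exact this

theorem measurable_wt_sq : Measurable fun x => wt x ^ 2 := measurable_wt.pow_const 2

theorem lintegral_wt_two_mul_sub_le (c : ℝ) : ∫⁻ x, wt (2 * x - c) ^ 2 ≤ wtMass := by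
  calc ∫⁻ x, wt (2 * x - c) ^ 2 ≤ ∫⁻ x, wt (x - c / 2) ^ 2 := by
        gcongr with x
        refine wt_le_wt ?_
        have : 2 * x - c = 2 * (x - c / 2) := by ring
        rw [this, abs_mul, abs_two]
        linarith [abs_nonneg (x - c / 2)]
    _ = wtMass := lintegral_sub_right_eq_self (fun x => wt x ^ 2) _

theorem lintegral_wt_sub_two_mul_le (c : ℝ) : ∫⁻ x, wt (c - 2 * x) ^ 2 ≤ wtMass := by
  refine le_of_eq_of_le ?_ (lintegral_wt_two_mul_sub_le c)
  congr 1; ext x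
  simp only [wt, abs_sub_comm]

/-- The indicator function of `[-1, 1]`. -/
def box : ℝ → ℝ≥0∞ := Set.indicator (Set.Icc (-1) 1) 1

theorem measurable_box : Measurable box := measurable_one.indicator measurableSet_Icc

theorem box_le_one (x : ℝ) : box x ≤ 1 := by
  unfold box; exact Set.indicator_le_self' (by simp) x

theorem lintegral_box : ∫⁻ x, box x = 2 := by
  unfold box
  rw [lintegral_indicator_one measurableSet_Icc, Real.volume_Icc]
  norm_num

/-- The local average `F * 1_{[-1,1]}`. -/
def smear (F : ℝ → ℝ≥0∞) (x : ℝ) : ℝ≥0∞ := ∫⁻ y, F y * box (x - y)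

theorem measurable_smear {F : ℝ → ℝ≥0∞} (hF : Measurable F) : Measurable (smear F) := by
  have := measurable_box
  have hm : Measurable fun z : ℝ × ℝ => F z.2 * box (z.1 - z.2) := by fun_prop
  exact hm.lintegral_prod_right'

theorem eLpNorm_smear_le {p r : ℝ≥0∞} (hp : 1 ≤ p) (hpr : (r⁻¹).toReal ≤ (p⁻¹).toReal)
    (hr : 1 ≤ r) {F : ℝ → ℝ≥0∞} (hF : Measurable F) :
    eLpNorm (smear F) r volume ≤ eLpNorm F p volume * 8 := by
  have := eLpNorm_conv_kernel_le hp hpr hr hF measurable_box box_le_one (K := 2) (by norm_num)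
    lintegral_box.le
  refine this.trans (le_of_eq ?_)
  norm_num

/-- A kernel that is slowly varying at unit scale does not distinguish a function from its local
averages. -/
theorem lintegral_mul_le_lintegral_smear_mul {F κ : ℝ → ℝ≥0∞} (hF : Measurable F)
    (hκ : Measurable κ) {C : ℝ≥0∞} (hC : ∀ x u, |u| ≤ 1 → κ x ≤ C * κ (x + u)) :
    ∫⁻ x, F x * κ x ≤ C * ∫⁻ x, smear F x * κ x := by
  have hbox := measurable_box
  have h1 : ∀ y, κ y ≤ C * ∫⁻ x, box (x - y) * κ x := by
    intro y
    -- The factor `2` is the mass of `box`; it is wasted so that `κ y` can be spread over a unit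
    -- neighbourhood of `y`.
    calc κ y ≤ κ y * 2 := by rw [mul_two]; exact le_self_add
      _ = ∫⁻ u, κ y * box u := by rw [lintegral_const_mul _ hbox, lintegral_box]
      _ ≤ ∫⁻ u, C * (box u * κ (u + y)) := by
        refine lintegral_mono fun u => ?_
        by_cases hu : u ∈ Set.Icc (-1 : ℝ) 1
        · have := hC y u (abs_le.2 hu)
          simp only [box, Set.indicator_of_mem hu, Pi.one_apply, mul_one, one_mul]
          rwa [add_comm u y]
        · simp [box, Set.indicator_of_notMem hu]
      _ = C * ∫⁻ u, box u * κ (u + y) := lintegral_const_mul _ (by fun_prop)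
      _ = C * ∫⁻ x, box (x - y) * κ x := by
        rw [← lintegral_add_right_eq_self (fun x => box (x - y) * κ x) y]
        simp
  calc ∫⁻ x, F x * κ x ≤ ∫⁻ y, F y * (C * ∫⁻ x, box (x - y) * κ x) := by
        gcongr with y; exact h1 y
    _ = C * ∫⁻ y, ∫⁻ x, F y * box (x - y) * κ x := by
      have hm : Measurable fun y => ∫⁻ x, F y * box (x - y) * κ x := by
        have : Measurable fun z : ℝ × ℝ => F z.1 * box (z.2 - z.1) * κ z.2 := by fun_prop
        exact this.lintegral_prod_right'
      rw [← lintegral_const_mul _ hm]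
      congr 1; ext y
      have : ∫⁻ x, F y * box (x - y) * κ x = F y * ∫⁻ x, box (x - y) * κ x := by
        rw [← lintegral_const_mul _ (by fun_prop)]
        congr 1; ext x; ring
      rw [this]; ring
    _ = C * ∫⁻ x, smear F x * κ x := by
      have hm : Measurable fun z : ℝ × ℝ => F z.1 * box (z.2 - z.1) * κ z.2 := by fun_prop
      rw [lintegral_lintegral_swap hm.aemeasurable]
      congr 2; ext x
      rw [smear, lintegral_mul_const _ (by fun_prop)]

/-- The one-variable averaging is applied to the second variable, then, after Tonelli, to the first;
each costs a factor `C`. -/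
theorem lintegral_prod_mul_le_smear {F G : ℝ → ℝ≥0∞} (hF : Measurable F) (hG : Measurable G)
    {k : ℝ × ℝ → ℝ≥0∞} (hk : Measurable k) {C : ℝ≥0∞}
    (k1 : ∀ x y u, |u| ≤ 1 → k (x, y) ≤ C * k (x + u, y))
    (k2 : ∀ x y u, |u| ≤ 1 → k (x, y) ≤ C * k (x, y + u)) :
    ∫⁻ τ : ℝ × ℝ, F τ.1 * G τ.2 * k τ ≤ C * C * ∫⁻ τ : ℝ × ℝ, smear F τ.1 * smear G τ.2 * k τ := by
  have hsF := measurable_smear hF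
  have hsG := measurable_smear hG
  have hm2 : Measurable fun x => ∫⁻ y, smear G y * k (x, y) := by
    have : Measurable fun z : ℝ × ℝ => smear G z.2 * k z := by fun_prop
    exact this.lintegral_prod_right'
  have hm1 : Measurable fun y => ∫⁻ x, smear F x * k (x, y) := by
    have : Measurable fun z : ℝ × ℝ => smear F z.1 * k z := by fun_prop
    exact this.lintegral_prod_left'
  calc ∫⁻ τ : ℝ × ℝ, F τ.1 * G τ.2 * k τ
      = ∫⁻ x, F x * ∫⁻ y, G y * k (x, y) := by
        rw [Measure.volume_eq_prod, lintegral_prod _ (by fun_prop)]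
        congr 1; ext x
        rw [← lintegral_const_mul _ (by fun_prop)]
        congr 1; ext y; ring
    _ ≤ ∫⁻ x, F x * (C * ∫⁻ y, smear G y * k (x, y)) := by
        refine lintegral_mono fun x => ?_
        dsimp only
        gcongr
        exact lintegral_mul_le_lintegral_smear_mul hG (by fun_prop) (k2 x)
    _ = C * ∫⁻ x, F x * ∫⁻ y, smear G y * k (x, y) := by
        rw [← lintegral_const_mul _ (by fun_prop)]
        congr 1; ext x; ring
    _ = C * ∫⁻ y, smear G y * ∫⁻ x, F x * k (x, y) := by
        have e1 : ∀ x, F x * ∫⁻ y, smear G y * k (x, y)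
            = ∫⁻ y, smear G y * (F x * k (x, y)) := by
          intro x
          rw [← lintegral_const_mul _ (by fun_prop)]
          congr 1; ext y; ring
        simp_rw [e1]
        rw [lintegral_lintegral_swap]
        · congr 2; ext y
          rw [lintegral_const_mul _ (by fun_prop)]
        · simp only [Function.uncurry_def]; fun_prop
    _ ≤ C * ∫⁻ y, smear G y * (C * ∫⁻ x, smear F x * k (x, y)) := by
        gcongr
        refine lintegral_mul_le_lintegral_smear_mul hF (by fun_prop) (fun x u => k1 x _ u)
    _ = C * C * ∫⁻ y, ∫⁻ x, smear F x * smear G y * k (x, y) := by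
        have hm' : Measurable fun y => ∫⁻ x, smear F x * smear G y * k (x, y) := by
          have : Measurable fun z : ℝ × ℝ => smear F z.1 * smear G z.2 * k z := by fun_prop
          exact this.lintegral_prod_left'
        rw [mul_assoc, ← lintegral_const_mul _ hm']
        congr 2; ext y
        have : ∫⁻ x, smear F x * smear G y * k (x, y)
            = smear G y * ∫⁻ x, smear F x * k (x, y) := by
          rw [← lintegral_const_mul _ (by fun_prop)]
          congr 1; ext x; ring
        rw [this]; ring
    _ = _ := by
        rw [Measure.volume_eq_prod, lintegral_prod_symm _ (by fun_prop)]

/-! ### The bilinear time operator -/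

/-- The kernel `wt (t₁ - t₂) wt (2 t - t₁ - t₂) ^ 2`. -/
def timeKer (t : ℝ) (τ : ℝ × ℝ) : ℝ≥0∞ := wt (τ.1 - τ.2) * wt (2 * t - τ.1 - τ.2) ^ 2

theorem measurable_timeKer : Measurable fun z : ℝ × (ℝ × ℝ) => timeKer z.1 z.2 := by
  have := measurable_wt
  unfold timeKer
  fun_prop

/-- The positive bilinear operator with kernel `timeKer`. -/
def timeOp (F G : ℝ → ℝ≥0∞) (t : ℝ) : ℝ≥0∞ := ∫⁻ τ : ℝ × ℝ, F τ.1 * G τ.2 * timeKer t τ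

/-- A unit shift of one time variable costs `2` in the first weight and `2²` in the squared one,
hence `8` per variable. The gain is that local averages of an `L^p` function lie in every `L^r` with
`r ≥ p`. -/
theorem timeOp_le_timeOp_smear {F G : ℝ → ℝ≥0∞} (hF : Measurable F) (hG : Measurable G) (t : ℝ) :
    timeOp F G t ≤ 8 * 8 * timeOp (smear F) (smear G) t := by
  have hwt := measurable_wt
  refine lintegral_prod_mul_le_smear hF hG (by unfold timeKer; fun_prop) ?_ ?_
  · intro x y u hu
    have h1 := wt_le_two_mul_wt_add (x := x - y) (u := u) hu
    have h2 := wt_le_two_mul_wt_add (x := 2 * t - x - y) (u := -u) (by simpa using hu)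
    unfold timeKer
    calc wt (x - y) * wt (2 * t - x - y) ^ 2
        ≤ (2 * wt (x - y + u)) * (2 * wt (2 * t - x - y + -u)) ^ 2 := by gcongr
      _ = 8 * (wt (x + u - y) * wt (2 * t - (x + u) - y) ^ 2) := by ring_nf
  · intro x y u hu
    have h1 := wt_le_two_mul_wt_add (x := x - y) (u := -u) (by simpa using hu)
    have h2 := wt_le_two_mul_wt_add (x := 2 * t - x - y) (u := -u) (by simpa using hu)
    unfold timeKer
    calc wt (x - y) * wt (2 * t - x - y) ^ 2
        ≤ (2 * wt (x - y + -u)) * (2 * wt (2 * t - x - y + -u)) ^ 2 := by gcongr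
      _ = 8 * (wt (x - (y + u)) * wt (2 * t - x - (y + u)) ^ 2) := by ring_nf

/-- Here `(1 + δ)(1 - δ) ≤ 1` and `wt ≤ 1`. For `δ > 0` the inner function is integrable, so the
weight can act as the third base of the trilinear inequality, with exponent `1 - δ`. -/
theorem wt_le_rpow_rpow {δ : ℝ} (x : ℝ) : wt x ≤ (wt x ^ (1 + δ)) ^ (1 - δ) := by
  rw [← ENNReal.rpow_mul]
  calc wt x = wt x ^ (1 : ℝ) := (ENNReal.rpow_one _).symm
    _ ≤ _ := ENNReal.rpow_le_rpow_of_exponent_ge (wt_le_one x) (by nlinarith [sq_nonneg δ])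

/-- The trilinear inequality is applied to the unit-mass densities `f`, `g` of `F`, `G` and to `w
(τ₁ - τ₂)`, with exponents `1/p₁`, `1/p₂`, `1 - δ` of sum `1 + 1/p₀`. Any two of the linear forms
`τ₁`, `τ₂`, `τ₁ - τ₂` are independent, so the pair products `A` are integrable on the plane; each
one is independent of `τ₁ + τ₂`, so `k t * B` is integrable for every `t`. -/
theorem eLpNorm_timeOp_le_of_add_eq {p₀ p₁ p₂ : ℝ≥0∞} (h₀ : 1 ≤ p₀) (h₁ : 1 ≤ p₁) (h₂ : 1 ≤ p₂)
    {δ : ℝ} (hδ0 : 0 < δ) (hδ1 : δ ≤ 1)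
    (h : (p₁⁻¹).toReal + (p₂⁻¹).toReal = (p₀⁻¹).toReal + δ) :
    ∃ K : ℝ≥0∞, K < ⊤ ∧ ∀ F G : ℝ → ℝ≥0∞, Measurable F → Measurable G →
      eLpNorm (timeOp F G) p₀ volume ≤ eLpNorm F p₁ volume * eLpNorm G p₂ volume * K := by
  have hwt := measurable_wt
  have hKw : ∫⁻ x, wt x ^ (1 + δ) < ⊤ := lintegral_wt_rpow_lt_top (by linarith)
  set Kw := ∫⁻ x, wt x ^ (1 + δ) with hKw_def
  have hM := wtMass_lt_top
  -- One constant for both masses: the pair products give `1 + 2 Kw`, the single functions `2 + Kw`,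
  -- each times `wtMass`.
  refine ⟨(2 + 2 * Kw) * wtMass, ENNReal.mul_lt_top (by simp [ENNReal.mul_lt_top_iff, hKw]) hM,
    fun F G hF hG => ?_⟩
  obtain ⟨f, hf, hf1, hFf⟩ := exists_le_eLpNorm_mul_rpow (μ := volume) h₁ hF
  obtain ⟨g, hg, hg1, hGg⟩ := exists_le_eLpNorm_mul_rpow (μ := volume) h₂ hG
  set N₁ := eLpNorm F p₁ volume
  set N₂ := eLpNorm G p₂ volume
  have hs0 := toReal_inv_nonneg p₀
  have hs1 := toReal_inv_le_one h₀
  set s := (p₀⁻¹).toReal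
  set w : ℝ → ℝ≥0∞ := fun x => wt x ^ (1 + δ) with hw_def
  have hw : Measurable w := by fun_prop
  set A : ℝ × ℝ → ℝ≥0∞ := fun τ => f τ.1 * g τ.2 + f τ.1 * w (τ.1 - τ.2) + g τ.2 * w (τ.1 - τ.2)
    with hA_def
  set B : ℝ × ℝ → ℝ≥0∞ := fun τ => f τ.1 + g τ.2 + w (τ.1 - τ.2) with hB_def
  set k : ℝ → ℝ × ℝ → ℝ≥0∞ := fun t τ => wt (2 * t - τ.1 - τ.2) ^ 2 with hk_def
  have hA : Measurable A := by fun_prop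
  have hB : Measurable B := by fun_prop
  have hk : Measurable fun z : ℝ × (ℝ × ℝ) => k z.1 z.2 := by
    simp only [hk_def]; fun_prop
  have hAint : ∫⁻ τ, A τ ≤ 2 + 2 * Kw := by
    have e1 : ∫⁻ τ : ℝ × ℝ, f τ.1 * g τ.2 ≤ 1 := by
      rw [Measure.volume_eq_prod, lintegral_prod_mul hf.aemeasurable hg.aemeasurable]
      exact mul_le_one' hf1 hg1
    have e2 : ∫⁻ τ : ℝ × ℝ, f τ.1 * w (τ.1 - τ.2) ≤ Kw := by
      rw [Measure.volume_eq_prod, lintegral_prod _ (by fun_prop)]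
      calc ∫⁻ x, ∫⁻ y, f x * w (x - y) = ∫⁻ x, f x * Kw := by
            congr 1; ext x
            rw [lintegral_const_mul _ (by fun_prop), lintegral_sub_left_eq_self]
        _ = (∫⁻ x, f x) * Kw := lintegral_mul_const _ hf
        _ ≤ 1 * Kw := by gcongr
        _ = Kw := one_mul _
    have e3 : ∫⁻ τ : ℝ × ℝ, g τ.2 * w (τ.1 - τ.2) ≤ Kw := by
      rw [Measure.volume_eq_prod, lintegral_prod_symm _ (by fun_prop)]
      calc ∫⁻ y, ∫⁻ x, g y * w (x - y) = ∫⁻ y, g y * Kw := by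
            congr 1; ext y
            rw [lintegral_const_mul _ (by fun_prop), lintegral_sub_right_eq_self]
        _ = (∫⁻ x, g x) * Kw := lintegral_mul_const _ hg
        _ ≤ 1 * Kw := by gcongr
        _ = Kw := one_mul _
    rw [hA_def, lintegral_add_left (by fun_prop), lintegral_add_left (by fun_prop)]
    calc _ ≤ 1 + Kw + Kw := by gcongr
      _ ≤ 2 + Kw + Kw := by gcongr; norm_num
      _ = _ := by ring
  refine eLpNorm_lintegral_le_of_le_rpow_mul_rpow h₀ (P := fun t τ => k t τ * A τ)
    (Q := fun t τ => k t τ * B τ) (c := N₁ * N₂) (hk.mul (hA.comp measurable_snd))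
    (hk.mul (hB.comp measurable_snd)) ?_ ?_ ?_
  · refine Eventually.of_forall fun t => ?_
    filter_upwards [Measure.quasiMeasurePreserving_fst.ae hFf,
      Measure.quasiMeasurePreserving_snd.ae hGg] with τ h1 h2
    have h3 := rpow_mul_rpow_mul_rpow_le (f τ.1) (g τ.2) (w (τ.1 - τ.2)) (toReal_inv_nonneg p₁)
      (toReal_inv_nonneg p₂) (by linarith : 0 ≤ 1 - δ) (toReal_inv_le_one h₁)
      (toReal_inv_le_one h₂) (by linarith) hs0 hs1 (by linarith)
    have h4 : k t τ ^ s * k t τ ^ (1 - s) = k t τ := by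
      rw [← ENNReal.rpow_add_of_nonneg _ _ hs0 (by linarith)]; simp
    calc F τ.1 * G τ.2 * timeKer t τ
        ≤ (N₁ * f τ.1 ^ (p₁⁻¹).toReal) * (N₂ * g τ.2 ^ (p₂⁻¹).toReal)
          * (w (τ.1 - τ.2) ^ (1 - δ) * k t τ) := by
          unfold timeKer
          gcongr
          exact wt_le_rpow_rpow _
      _ = N₁ * N₂ * (k t τ * (f τ.1 ^ (p₁⁻¹).toReal * g τ.2 ^ (p₂⁻¹).toReal
          * w (τ.1 - τ.2) ^ (1 - δ))) := by ring
      _ ≤ N₁ * N₂ * (k t τ * (A τ ^ s * B τ ^ (1 - s))) := by gcongr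
      _ = N₁ * N₂ * ((k t τ * A τ) ^ s * (k t τ * B τ) ^ (1 - s)) := by
        rw [ENNReal.mul_rpow_of_nonneg _ _ hs0, ENNReal.mul_rpow_of_nonneg _ _ (by linarith)]
        nth_rw 1 [← h4]
        ring
  · rw [lintegral_lintegral_swap (hk.mul (hA.comp measurable_snd)).aemeasurable]
    calc ∫⁻ τ, ∫⁻ t, k t τ * A τ ≤ ∫⁻ τ, wtMass * A τ := by
          refine lintegral_mono fun τ => ?_
          dsimp only
          rw [lintegral_mul_const _ (by simp only [hk_def]; fun_prop)]
          gcongr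
          have := lintegral_wt_two_mul_sub_le (τ.1 + τ.2)
          simpa only [hk_def, sub_sub] using this
      _ = wtMass * ∫⁻ τ, A τ := lintegral_const_mul _ hA
      _ ≤ wtMass * (2 + 2 * Kw) := by gcongr
      _ = _ := mul_comm _ _
  · intro t
    have hkt : Measurable (k t) := by simp only [hk_def]; fun_prop
    have e1 : ∫⁻ τ : ℝ × ℝ, k t τ * f τ.1 ≤ wtMass := by
      rw [Measure.volume_eq_prod, lintegral_prod _ (by fun_prop)]
      calc ∫⁻ x, ∫⁻ y, k t (x, y) * f x = ∫⁻ x, wtMass * f x := by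
            congr 1; ext x
            rw [lintegral_mul_const _ (by fun_prop)]
            congr 1
            exact lintegral_sub_left_eq_self (μ := volume) (fun y => wt y ^ 2) (2 * t - x)
        _ = wtMass * ∫⁻ x, f x := lintegral_const_mul _ hf
        _ ≤ wtMass * 1 := by gcongr
        _ = wtMass := mul_one _
    have e2 : ∫⁻ τ : ℝ × ℝ, k t τ * g τ.2 ≤ wtMass := by
      rw [Measure.volume_eq_prod, lintegral_prod_symm _ (by fun_prop)]
      calc ∫⁻ y, ∫⁻ x, k t (x, y) * g y = ∫⁻ y, wtMass * g y := by
            congr 1; ext y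
            rw [lintegral_mul_const _ (by fun_prop)]
            congr 1
            rw [wtMass, ← lintegral_sub_left_eq_self (fun y => wt y ^ 2) (2 * t - y)]
            congr 1; ext x
            simp only [hk_def]
            congr 2; ring
        _ = wtMass * ∫⁻ x, g x := lintegral_const_mul _ hg
        _ ≤ wtMass * 1 := by gcongr
        _ = wtMass := mul_one _
    have e3 : ∫⁻ τ : ℝ × ℝ, k t τ * w (τ.1 - τ.2) ≤ wtMass * Kw := by
      rw [Measure.volume_eq_prod, lintegral_prod_symm _ (by fun_prop)]
      -- With `b = x - y` as variable, the `y`-integral meets only the squared weight and the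
      -- `b`-integral only `w`.
      have e4 : ∀ y, ∫⁻ x, k t (x, y) * w (x - y) = ∫⁻ b, wt (2 * t - b - 2 * y) ^ 2 * w b := by
        intro y
        rw [← lintegral_sub_right_eq_self (fun b => wt (2 * t - b - 2 * y) ^ 2 * w b) y]
        congr 1; ext x
        simp only [hk_def]
        congr 3; ring
      simp_rw [e4]
      rw [lintegral_lintegral_swap (by simp only [Function.uncurry_def]; fun_prop)]
      calc _ ≤ ∫⁻ b, wtMass * w b := by
            refine lintegral_mono fun b => ?_
            dsimp only
            rw [lintegral_mul_const _ (by fun_prop)]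
            gcongr
            exact lintegral_wt_sub_two_mul_le _
        _ = wtMass * Kw := lintegral_const_mul _ hw
    simp only [hB_def, mul_add]
    rw [lintegral_add_left (by fun_prop), lintegral_add_left (by fun_prop)]
    calc _ ≤ wtMass + wtMass + wtMass * Kw := by gcongr
      _ ≤ wtMass + wtMass + (wtMass * Kw + wtMass * Kw) := by gcongr; exact le_self_add
      _ = _ := by ring

theorem exists_exponent {θ : ℝ} (h0 : 0 ≤ θ) (h1 : θ ≤ 1) :
    ∃ p : ℝ≥0∞, 1 ≤ p ∧ (p⁻¹).toReal = θ := by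
  refine ⟨(ENNReal.ofReal θ)⁻¹, ?_, ?_⟩
  · rw [ENNReal.one_le_inv, ENNReal.ofReal_le_one]; exact h1
  · rw [inv_inv, ENNReal.toReal_ofReal h0]

/-- Averaging allows the reciprocal exponents to be lowered, so that their sum becomes exactly `1/p₀
+ δ`, the case already treated. -/
theorem eLpNorm_timeOp_le {p₀ p₁ p₂ : ℝ≥0∞} (h₀ : 1 ≤ p₀) (h₁ : 1 ≤ p₁) (h₂ : 1 ≤ p₂)
    (h : (p₀⁻¹).toReal < (p₁⁻¹).toReal + (p₂⁻¹).toReal) :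
    ∃ K : ℝ≥0∞, K < ⊤ ∧ ∀ F G : ℝ → ℝ≥0∞, Measurable F → Measurable G →
      eLpNorm (timeOp F G) p₀ volume ≤ eLpNorm F p₁ volume * eLpNorm G p₂ volume * K := by
  have a0 := toReal_inv_nonneg p₀
  have a1 := toReal_inv_nonneg p₁
  have a2 := toReal_inv_nonneg p₂
  have b1 := toReal_inv_le_one h₁
  have b2 := toReal_inv_le_one h₂
  -- The cap at `1` keeps the exponent `1 - δ` nonnegative. Below, `1/r₁` is as large as `1/p₁` and
  -- the total allow, and `1/r₂` is the rest, which then lies between `0` and `1/p₂`.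
  set δ := min 1 ((p₁⁻¹).toReal + (p₂⁻¹).toReal - (p₀⁻¹).toReal) with hδ
  have hδ0 : 0 < δ := lt_min zero_lt_one (by linarith)
  have hδ1 : δ ≤ 1 := min_le_left _ _
  have hδ2 : δ ≤ (p₁⁻¹).toReal + (p₂⁻¹).toReal - (p₀⁻¹).toReal := min_le_right _ _
  have hθ : min (p₁⁻¹).toReal ((p₀⁻¹).toReal + δ) ≤ (p₁⁻¹).toReal := min_le_left _ _
  have hθ' : min (p₁⁻¹).toReal ((p₀⁻¹).toReal + δ) ≤ (p₀⁻¹).toReal + δ := min_le_right _ _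
  have hθ2 : (p₀⁻¹).toReal + δ - (p₂⁻¹).toReal ≤ min (p₁⁻¹).toReal ((p₀⁻¹).toReal + δ) :=
    le_min (by linarith) (by linarith)
  have hθ0 : 0 ≤ min (p₁⁻¹).toReal ((p₀⁻¹).toReal + δ) := le_min a1 (by linarith)
  obtain ⟨r₁, hr₁, er₁⟩ := exists_exponent hθ0 (hθ.trans b1)
  obtain ⟨r₂, hr₂, er₂⟩ := exists_exponent
    (θ := (p₀⁻¹).toReal + δ - min (p₁⁻¹).toReal ((p₀⁻¹).toReal + δ)) (by linarith) (by linarith)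
  obtain ⟨K, hK, hb⟩ := eLpNorm_timeOp_le_of_add_eq h₀ hr₁ hr₂ hδ0 hδ1 (by rw [er₁, er₂]; ring)
  refine ⟨8 * 8 * (8 * 8 * K), by finiteness, fun F G hF hG => ?_⟩
  have h3 : eLpNorm (timeOp F G) p₀ volume ≤
      ((64 : ℝ≥0) : ℝ≥0∞) * eLpNorm (timeOp (smear F) (smear G)) p₀ volume := by
    refine eLpNorm_le_nnreal_smul_eLpNorm_of_ae_le_mul' (Eventually.of_forall fun t => ?_) _
    rw [enorm_eq_self, enorm_eq_self]
    refine (timeOp_le_timeOp_smear hF hG t).trans (le_of_eq ?_)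
    norm_num
  refine h3.trans ?_
  calc _ ≤ ((64 : ℝ≥0) : ℝ≥0∞) *
        ((eLpNorm F p₁ volume * 8) * (eLpNorm G p₂ volume * 8) * K) := by
        gcongr
        refine (hb _ _ (measurable_smear hF) (measurable_smear hG)).trans ?_
        gcongr
        · exact eLpNorm_smear_le h₁ (by rw [er₁]; exact hθ) hr₁ hF
        · exact eLpNorm_smear_le h₂ (by rw [er₂]; linarith) hr₂ hG
    _ = _ := by
        have : ((64 : ℝ≥0) : ℝ≥0∞) = 8 * 8 := by norm_num
        rw [this]; ring

/-! ### The bilinear frequency operator -/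

/-- The positive bilinear operator with kernel `wt (ν - ν₁ - ν₂) ^ 2`. -/
def freqOp (f g : ℝ → ℝ≥0∞) (ν : ℝ) : ℝ≥0∞ :=
  ∫⁻ η : ℝ × ℝ, f η.1 * g η.2 * wt (ν - η.1 - η.2) ^ 2

/-- The operator is the triple convolution `f * g * wt²`. Convolving `f` with `wt²` first raises its
exponent from `q₁` to the `r` for which Young's inequality with `g` lands exactly in `L^{q₃}`; the
hypothesis is what makes `r ≥ q₁`. -/
theorem eLpNorm_freqOp_le {q₁ q₂ q₃ : ℝ≥0∞} (h₁ : 1 ≤ q₁) (h₂ : 1 ≤ q₂) (h₃ : 1 ≤ q₃)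
    (h : 1 + (q₃⁻¹).toReal ≤ (q₁⁻¹).toReal + (q₂⁻¹).toReal) :
    ∃ K : ℝ≥0∞, K < ⊤ ∧ ∀ f g : ℝ → ℝ≥0∞, Measurable f → Measurable g →
      eLpNorm (freqOp f g) q₃ volume ≤ eLpNorm f q₁ volume * eLpNorm g q₂ volume * K := by
  have hwt := measurable_wt
  have a3 := toReal_inv_nonneg q₃
  have b1 := toReal_inv_le_one h₁
  have b2 := toReal_inv_le_one h₂
  obtain ⟨r, hr, er⟩ := exists_exponent (θ := 1 + (q₃⁻¹).toReal - (q₂⁻¹).toReal) (by linarith)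
    (by linarith)
  have hM := wtMass_lt_top
  refine ⟨2 * (1 + wtMass) ^ 2 * 2, by finiteness, fun f g hf hg => ?_⟩
  have e : freqOp f g = fun ν => ∫⁻ y, g y * (fun x => ∫⁻ z, f z * wt (x - z) ^ 2) (ν - y) := by
    ext ν
    rw [freqOp, Measure.volume_eq_prod, lintegral_prod_symm _ (by fun_prop)]
    congr 1; ext y
    dsimp only
    rw [← lintegral_const_mul _ (by fun_prop)]
    congr 1; ext z
    rw [show ν - z - y = ν - y - z by ring]
    ring
  have hm : Measurable fun x => ∫⁻ z, f z * wt (x - z) ^ 2 := by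
    have : Measurable fun p : ℝ × ℝ => f p.2 * wt (p.1 - p.2) ^ 2 := by fun_prop
    exact this.lintegral_prod_right'
  rw [e]
  calc _ ≤ eLpNorm g q₂ volume * eLpNorm (fun x => ∫⁻ z, f z * wt (x - z) ^ 2) r volume * 2 :=
        eLpNorm_conv_le h₂ hr h₃ (by rw [er]; ring) hg hm
    _ ≤ eLpNorm g q₂ volume * (eLpNorm f q₁ volume * (2 * (1 + wtMass) ^ 2)) * 2 := by
        gcongr
        exact eLpNorm_conv_kernel_le h₁ (by rw [er]; linarith) hr hf measurable_wt_sq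
          (fun x => pow_le_one' (wt_le_one x) 2) le_self_add le_add_self
    _ = _ := by ring

/-! ### The bilinear operator in phase space -/

/-- The positive bilinear operator on phase space that controls the bilinear Hilbert transform. -/
def phaseOp (F G : ℝ → ℝ → ℝ≥0∞) (t ν : ℝ) : ℝ≥0∞ :=
  ∫⁻ z : (ℝ × ℝ) × (ℝ × ℝ), F z.1.1 z.2.1 * G z.1.2 z.2.2 *
    (timeKer t z.1 * wt (ν - z.2.1 - z.2.2) ^ 2)

/-- The mixed norm `L^q_ν (L^p_t)` of a nonnegative function. -/
def mixedNorm (p q : ℝ≥0∞) (F : ℝ → ℝ → ℝ≥0∞) : ℝ≥0∞ :=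
  eLpNorm (fun ν => eLpNorm (fun t => F t ν) p volume) q volume

/-- For fixed frequencies the time operator acts on slices. Minkowski's inequality takes the time
norm inside the frequency integral, which leaves `freqOp` applied to the norms of the slices. -/
theorem mixedNorm_phaseOp_le {p₀ p₁ p₂ q₁ q₂ q₃ : ℝ≥0∞} (hp₀ : 1 ≤ p₀) (hp₁ : 1 ≤ p₁)
    (hp₂ : 1 ≤ p₂) (hq₁ : 1 ≤ q₁) (hq₂ : 1 ≤ q₂) (hq₃ : 1 ≤ q₃)
    (hp : (p₀⁻¹).toReal < (p₁⁻¹).toReal + (p₂⁻¹).toReal)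
    (hq : 1 + (q₃⁻¹).toReal ≤ (q₁⁻¹).toReal + (q₂⁻¹).toReal) :
    ∃ K : ℝ≥0∞, K < ⊤ ∧ ∀ F G : ℝ → ℝ → ℝ≥0∞, Measurable (Function.uncurry F) →
      Measurable (Function.uncurry G) →
      Measurable (fun ν => eLpNorm (fun t => F t ν) p₁ volume) →
      Measurable (fun ν => eLpNorm (fun t => G t ν) p₂ volume) →
      mixedNorm p₀ q₃ (phaseOp F G) ≤ mixedNorm p₁ q₁ F * mixedNorm p₂ q₂ G * K := by
  obtain ⟨K, hK, hKb⟩ := eLpNorm_timeOp_le hp₀ hp₁ hp₂ hp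
  obtain ⟨L, hL, hLb⟩ := eLpNorm_freqOp_le hq₁ hq₂ hq₃ hq
  refine ⟨K * L, ENNReal.mul_lt_top hK hL, fun F G hF hG hf hg => ?_⟩
  have hwt := measurable_wt
  have hker := measurable_timeKer
  set f := fun ν => eLpNorm (fun t => F t ν) p₁ volume with hf_def
  set g := fun ν => eLpNorm (fun t => G t ν) p₂ volume with hg_def
  have hFt : ∀ ν, Measurable fun t => F t ν := fun ν => hF.comp measurable_prodMk_right
  have hGt : ∀ ν, Measurable fun t => G t ν := fun ν => hG.comp measurable_prodMk_right
  have hF4 : Measurable fun z : (ℝ × ℝ) × (ℝ × ℝ) => F z.1.1 z.2.1 :=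
    hF.comp (f := fun z : (ℝ × ℝ) × (ℝ × ℝ) => (z.1.1, z.2.1)) (by fun_prop)
  have hG4 : Measurable fun z : (ℝ × ℝ) × (ℝ × ℝ) => G z.1.2 z.2.2 :=
    hG.comp (f := fun z : (ℝ × ℝ) × (ℝ × ℝ) => (z.1.2, z.2.2)) (by fun_prop)
  have hint : Measurable fun w : ℝ × ((ℝ × ℝ) × (ℝ × ℝ)) =>
      F w.2.1.1 w.2.2.1 * G w.2.1.2 w.2.2.2 * timeKer w.1 w.2.1 :=
    ((hF4.comp measurable_snd).mul (hG4.comp measurable_snd)).mul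
      (hker.comp (g := fun z : ℝ × (ℝ × ℝ) => timeKer z.1 z.2)
        (f := fun w : ℝ × ((ℝ × ℝ) × (ℝ × ℝ)) => (w.1, w.2.1)) (by fun_prop))
  have hop : Measurable fun w : ℝ × (ℝ × ℝ) =>
      timeOp (fun s => F s w.2.1) (fun s => G s w.2.2) w.1 := by
    unfold timeOp
    have : Measurable fun w : (ℝ × (ℝ × ℝ)) × (ℝ × ℝ) =>
        F w.2.1 w.1.2.1 * G w.2.2 w.1.2.2 * timeKer w.1.1 w.2 :=
      hint.comp (f := fun w : (ℝ × (ℝ × ℝ)) × (ℝ × ℝ) => (w.1.1, (w.2, w.1.2))) (by fun_prop)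
    exact this.lintegral_prod_right'
  have hphase : ∀ t ν, phaseOp F G t ν = ∫⁻ η : ℝ × ℝ,
      timeOp (fun s => F s η.1) (fun s => G s η.2) t * wt (ν - η.1 - η.2) ^ 2 := by
    intro t ν
    have hm : Measurable fun z : (ℝ × ℝ) × (ℝ × ℝ) =>
        F z.1.1 z.2.1 * G z.1.2 z.2.2 * timeKer t z.1 :=
      hint.comp (measurable_prodMk_left (x := t))
    rw [phaseOp, Measure.volume_eq_prod, lintegral_prod_symm]
    · congr 1; ext η
      rw [timeOp, ← lintegral_mul_const]
      · congr 1; ext τ; ring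
      · exact hm.comp (measurable_prodMk_right (y := η))
    · have hm2 := hm.mul (by fun_prop : Measurable fun z : (ℝ × ℝ) × (ℝ × ℝ) =>
        wt (ν - z.2.1 - z.2.2) ^ 2)
      convert hm2.aemeasurable using 1
      ext z
      simp only [Pi.mul_apply]
      ring
  have hinner : ∀ ν, eLpNorm (fun t => phaseOp F G t ν) p₀ volume ≤ freqOp f g ν * K := by
    intro ν
    simp_rw [hphase]
    have hM : Measurable fun η : ℝ × ℝ => f η.1 * g η.2 * wt (ν - η.1 - η.2) ^ 2 := by fun_prop
    rw [freqOp, ← lintegral_mul_const _ hM]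
    refine eLpNorm_lintegral_le_lintegral hp₀ ?_ (hM.mul_const _) fun η => ?_
    · exact hop.mul (by fun_prop : Measurable fun w : ℝ × (ℝ × ℝ) =>
        wt (ν - w.2.1 - w.2.2) ^ 2)
    · have hfin : wt (ν - η.1 - η.2) ^ 2 ≠ ⊤ :=
        ((pow_le_one' (wt_le_one _) 2).trans_lt ENNReal.one_lt_top).ne
      have h1 : eLpNorm (fun t => timeOp (fun s => F s η.1) (fun s => G s η.2) t
          * wt (ν - η.1 - η.2) ^ 2) p₀ volume ≤ ((wt (ν - η.1 - η.2) ^ 2).toNNReal : ℝ≥0∞) *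
          eLpNorm (timeOp (fun s => F s η.1) (fun s => G s η.2)) p₀ volume := by
        refine eLpNorm_le_nnreal_smul_eLpNorm_of_ae_le_mul' (Eventually.of_forall fun t => ?_) _
        rw [enorm_eq_self, enorm_eq_self, ENNReal.coe_toNNReal hfin, mul_comm]
      rw [ENNReal.coe_toNNReal hfin] at h1
      calc _ ≤ wt (ν - η.1 - η.2) ^ 2 * (f η.1 * g η.2 * K) := by
            refine h1.trans ?_
            gcongr
            exact hKb _ _ (hFt _) (hGt _)
        _ = _ := by ring
  unfold mixedNorm
  calc _ ≤ (K.toNNReal : ℝ≥0∞) * eLpNorm (freqOp f g) q₃ volume := by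
        refine eLpNorm_le_nnreal_smul_eLpNorm_of_ae_le_mul' (Eventually.of_forall fun ν => ?_) _
        rw [enorm_eq_self, enorm_eq_self, ENNReal.coe_toNNReal hK.ne, mul_comm]
        exact hinner ν
    _ ≤ K * (eLpNorm f q₁ volume * eLpNorm g q₂ volume * L) := by
        rw [ENNReal.coe_toNNReal hK.ne]
        gcongr
        exact hLb f g hf hg
    _ = _ := by ring

/-! ### The bilinear Hilbert transform of Gaussian atoms -/

/-- On `[0, 1/l]` the integrand is at most `l`, which contributes `1`. On `[1/l, 1]` integration by
parts leaves two boundary terms and an integral of `1 / (l y²)`, each at most `1`. That the bound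
does not depend on `l` is what makes the final estimate uniform in frequency. -/
theorem abs_integral_sin_div_le_of_pos {l : ℝ} (hl : 0 < l) :
    |∫ y in (0 : ℝ)..1, Real.sin (l * y) / y| ≤ 4 := by
  have hle : ∀ y : ℝ, |Real.sin (l * y) / y| ≤ l := by
    intro y
    rcases eq_or_ne y 0 with rfl | hy
    · simp [hl.le]
    · rw [abs_div, div_le_iff₀ (abs_pos.2 hy)]
      calc |Real.sin (l * y)| ≤ |l * y| := Real.abs_sin_le_abs
        _ = l * |y| := by rw [abs_mul, abs_of_pos hl]
  have hii : ∀ a b : ℝ, IntervalIntegrable (fun y => Real.sin (l * y) / y) volume a b := by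
    intro a b
    refine (intervalIntegrable_const (c := l)).mono_fun ?_ (Eventually.of_forall fun y => ?_)
    · exact (by fun_prop : Measurable fun y => Real.sin (l * y) / y).aestronglyMeasurable
    · exact (hle y).trans (le_abs_self l)
  have hsmall : ∀ c : ℝ, 0 ≤ c → |∫ y in (0 : ℝ)..c, Real.sin (l * y) / y| ≤ l * c := by
    intro c hc
    have := intervalIntegral.norm_integral_le_of_norm_le_const (a := 0) (b := c) (C := l)
      (f := fun y => Real.sin (l * y) / y) fun y _ => hle y
    rwa [sub_zero, abs_of_nonneg hc, Real.norm_eq_abs] at this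
  rcases le_or_gt l 1 with h1 | h1
  · have := hsmall 1 zero_le_one
    linarith
  have hl1 : l⁻¹ < 1 := inv_lt_one_of_one_lt₀ h1
  have hl0 : 0 < l⁻¹ := inv_pos.2 hl
  rw [← intervalIntegral.integral_add_adjacent_intervals (hii 0 l⁻¹) (hii l⁻¹ 1)]
  have hA := hsmall l⁻¹ hl0.le
  rw [mul_inv_cancel₀ hl.ne'] at hA
  have hpos : ∀ y ∈ Set.uIcc l⁻¹ 1, 0 < y := by
    intro y hy
    rw [Set.uIcc_of_le hl1.le] at hy
    exact hl0.trans_le hy.1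
  have hcos : IntervalIntegrable (fun y => Real.cos (l * y) / (l * y ^ 2)) volume l⁻¹ 1 := by
    refine ContinuousOn.intervalIntegrable ?_
    refine ContinuousOn.div (by fun_prop) (by fun_prop) fun y hy => ?_
    have := hpos y hy
    positivity
  have hone : IntervalIntegrable (fun y => 1 / (l * y ^ 2)) volume l⁻¹ 1 := by
    refine ContinuousOn.intervalIntegrable ?_
    refine ContinuousOn.div (by fun_prop) (by fun_prop) fun y hy => ?_
    have := hpos y hy
    positivity
  have e1 : ∫ y in l⁻¹..1, (Real.sin (l * y) / y + Real.cos (l * y) / (l * y ^ 2))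
      = -Real.cos (l * 1) / (l * 1) - -Real.cos (l * l⁻¹) / (l * l⁻¹) := by
    refine intervalIntegral.integral_eq_sub_of_hasDerivAt
      (f := fun y => -Real.cos (l * y) / (l * y)) (fun y hy => ?_) ((hii _ _).add hcos)
    have hy0 := hpos y hy
    have h2 : HasDerivAt (fun y : ℝ => l * y) l y := by simpa using (hasDerivAt_id y).const_mul l
    refine ((h2.cos.neg).div h2 (by positivity)).congr_deriv ?_
    simp only [Pi.neg_apply]
    field_simp
    ring
  have e2 : ∫ y in l⁻¹..1, 1 / (l * y ^ 2) = -1 / (l * 1) - -1 / (l * l⁻¹) := by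
    refine intervalIntegral.integral_eq_sub_of_hasDerivAt
      (f := fun y => -1 / (l * y)) (fun y hy => ?_) hone
    have hy0 := hpos y hy
    have h2 : HasDerivAt (fun y : ℝ => l * y) l y := by simpa using (hasDerivAt_id y).const_mul l
    refine ((hasDerivAt_const y (-1 : ℝ)).div h2 (by positivity)).congr_deriv ?_
    field_simp
    ring
  rw [intervalIntegral.integral_add (hii _ _) hcos] at e1
  have e3 : |∫ y in l⁻¹..1, Real.cos (l * y) / (l * y ^ 2)| ≤ ∫ y in l⁻¹..1, 1 / (l * y ^ 2) := by
    have := intervalIntegral.norm_integral_le_of_norm_le hl1.le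
      (f := fun y => Real.cos (l * y) / (l * y ^ 2)) (g := fun y => 1 / (l * y ^ 2))
      (Eventually.of_forall fun y _ => ?_) hone
    · simpa using this
    · rw [Real.norm_eq_abs, abs_div, abs_of_nonneg (by positivity : 0 ≤ l * y ^ 2)]
      gcongr
      exact Real.abs_cos_le_one _
  rw [e2, mul_inv_cancel₀ hl.ne'] at e3
  rw [mul_inv_cancel₀ hl.ne', mul_one] at e1
  have e4 : |-Real.cos l / l| ≤ 1 := by
    rw [abs_div, abs_neg, abs_of_pos hl, div_le_one hl]
    exact (Real.abs_cos_le_one l).trans h1.le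
  have e5 : |Real.cos 1| ≤ 1 := Real.abs_cos_le_one 1
  have e6 : (0 : ℝ) ≤ 1 / (l * 1) := by positivity
  rw [abs_le] at hA e3 e4 e5 ⊢
  rw [neg_div] at e3
  constructor <;> linarith [hA.1, hA.2, e3.1, e3.2, e4.1, e4.2, e5.1, e5.2]

theorem abs_integral_sin_div_le (l : ℝ) : |∫ y in (0 : ℝ)..1, Real.sin (l * y) / y| ≤ 4 := by
  rcases lt_trichotomy l 0 with h | rfl | h
  · have := abs_integral_sin_div_le_of_pos (l := -l) (by linarith)
    simpa [neg_div] using this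
  · simp
  · exact abs_integral_sin_div_le_of_pos h

/-- The Gaussian `exp (-2 x²)`. -/
def gsq (x : ℝ) : ℝ := Real.exp (-2 * x ^ 2)

theorem gsq_nonneg (x : ℝ) : 0 ≤ gsq x := (Real.exp_pos _).le

theorem gsq_neg (x : ℝ) : gsq (-x) = gsq x := by simp [gsq]

theorem gsq_mul_le_one (x : ℝ) : gsq x * (1 + 2 * x ^ 2) ≤ 1 := by
  have h1 : 1 + 2 * x ^ 2 ≤ Real.exp (2 * x ^ 2) := by linarith [Real.add_one_le_exp (2 * x ^ 2)]
  calc gsq x * (1 + 2 * x ^ 2) ≤ gsq x * Real.exp (2 * x ^ 2) := by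
        gcongr; exact gsq_nonneg x
    _ = 1 := by rw [gsq, ← Real.exp_add]; simp

theorem gsq_le_one (x : ℝ) : gsq x ≤ 1 := by
  unfold gsq; rw [Real.exp_le_one_iff]; nlinarith [sq_nonneg x]

theorem integrable_gsq : Integrable gsq := by
  exact integrable_exp_neg_mul_sq (b := 2) (by norm_num)

theorem integrable_gsq_mul : Integrable fun x => gsq x * (2 + |x|) := by
  have h1 : Integrable fun x : ℝ => x * Real.exp (-2 * x ^ 2) :=
    integrable_mul_exp_neg_mul_sq (by norm_num)
  refine ((integrable_gsq.const_mul 2).add h1.abs).congr (Eventually.of_forall fun x => ?_)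
  simp only [Pi.add_apply, abs_mul, gsq, Real.abs_exp]
  ring

/-- Mean value inequality on `[-1, 1]`, where the Gaussian decay of the derivative is traded for the
single factor `1 / (1 + |b|)` that is needed. -/
theorem abs_gsq_sub_le {b y : ℝ} (hy : |y| ≤ 1) : |gsq (y - b) - gsq b| * (1 + |b|) ≤ 4 * |y| := by
  have hder : ∀ s : ℝ, HasDerivAt (fun s => gsq (s - b)) (gsq (s - b) * (-4 * (s - b))) s := by
    intro s
    have h1 : HasDerivAt (fun s => -2 * (s - b) ^ 2) (-4 * (s - b)) s := by
      refine ((((hasDerivAt_id s).sub_const b).pow 2).const_mul (-2)).congr_deriv ?_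
      simp; ring
    exact h1.exp
  have key := (convex_Icc (-1 : ℝ) 1).norm_image_sub_le_of_norm_hasDerivWithin_le
    (f := fun s => gsq (s - b)) (C := 4 / (1 + |b|)) (fun s _ => (hder s).hasDerivWithinAt)
    (fun s hs => ?_) (x := 0) (y := y) (by simp) (abs_le.1 hy)
  · simp only [zero_sub, gsq_neg, Real.norm_eq_abs, sub_zero] at key
    calc _ ≤ 4 / (1 + |b|) * |y| * (1 + |b|) := by gcongr
      _ = _ := by field_simp
  · rw [le_div_iff₀ (by positivity), Real.norm_eq_abs, abs_mul, abs_mul,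
      abs_of_nonneg (gsq_nonneg _)]
    have h1 := gsq_mul_le_one (s - b)
    have h2 : |b| ≤ 1 + |s - b| := by
      have : b = s - (s - b) := by ring
      calc |b| = |s - (s - b)| := by rw [← this]
        _ ≤ |s| + |s - b| := abs_sub _ _
        _ ≤ _ := by gcongr; exact abs_le.2 hs
    have h3 := gsq_nonneg (s - b)
    rw [← sq_abs (s - b)] at h1
    set r := |s - b|
    have hr : 0 ≤ r := abs_nonneg _
    have h4 : |(-4 : ℝ)| = 4 := by norm_num
    rw [h4]
    calc gsq (s - b) * (4 * r) * (1 + |b|) ≤ gsq (s - b) * (4 * r) * (1 + (1 + r)) := by gcongr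
      _ = 4 * (gsq (s - b) * (2 * r + r ^ 2)) := by ring
      _ ≤ 4 * (gsq (s - b) * (1 + 2 * r ^ 2)) := by
        refine mul_le_mul_of_nonneg_left (mul_le_mul_of_nonneg_left ?_ h3) (by norm_num)
        nlinarith [sq_nonneg (r - 1)]
      _ ≤ 4 := by linarith

/-- The phase factor `exp (2 π i y ξ)`. -/
def osc (ξ y : ℝ) : ℂ := Complex.exp ((2 * Real.pi * ξ * y : ℝ) * Complex.I)

theorem norm_osc (ξ y : ℝ) : ‖osc ξ y‖ = 1 := Complex.norm_exp_ofReal_mul_I _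

theorem osc_sub_osc_neg (ξ y : ℝ) :
    osc ξ y - osc ξ (-y) = 2 * Complex.I * (Real.sin (2 * Real.pi * ξ * y) : ℝ) := by
  have h : (2 * Real.pi * ξ * -y : ℝ) = -(2 * Real.pi * ξ * y) := by ring
  rw [osc, osc, h, Complex.exp_mul_I, Complex.exp_mul_I]
  push_cast
  rw [Complex.cos_neg, Complex.sin_neg]
  ring

/-- The antisymmetrized integrand of the Hilbert transform of a Gaussian atom. -/
def atomDiff (b ξ y : ℝ) : ℂ :=
  (osc ξ y * gsq (y - b) - osc ξ (-y) * gsq (-y - b)) / y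

theorem measurable_atomDiff : Measurable fun w : (ℝ × ℝ) × ℝ => atomDiff w.1.1 w.1.2 w.2 := by
  have h1 : Continuous fun w : (ℝ × ℝ) × ℝ => osc w.1.2 w.2 * gsq (w.2 - w.1.1) := by
    unfold osc gsq; fun_prop
  have h2 : Continuous fun w : (ℝ × ℝ) × ℝ => osc w.1.2 (-w.2) * gsq (-w.2 - w.1.1) := by
    unfold osc gsq; fun_prop
  unfold atomDiff
  exact (h1.sub h2).measurable.div (by fun_prop)

theorem measurable_atomDiff_right (b ξ : ℝ) : Measurable (atomDiff b ξ) := by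
  have h1 : Continuous fun y : ℝ => osc ξ y * gsq (y - b) := by unfold osc gsq; fun_prop
  have h2 : Continuous fun y : ℝ => osc ξ (-y) * gsq (-y - b) := by unfold osc gsq; fun_prop
  unfold atomDiff
  exact (h1.sub h2).measurable.div (by fun_prop)

/-- The Gaussian amplitude is frozen at `y = 0`. The frozen part is a pure sine over `y`, controlled
only after integration; in the rest the increments of the Gaussian cancel the `1 / y` pointwise. -/
theorem atomDiff_eq (b ξ y : ℝ) :
    atomDiff b ξ y = 2 * Complex.I * gsq b * (Real.sin (2 * Real.pi * ξ * y) / y : ℝ)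
      + (osc ξ y * (gsq (y - b) - gsq b : ℝ) - osc ξ (-y) * (gsq (-y - b) - gsq b : ℝ)) / y := by
  have h := osc_sub_osc_neg ξ y
  have : atomDiff b ξ y = gsq b * (osc ξ y - osc ξ (-y)) / y
      + (osc ξ y * (gsq (y - b) - gsq b : ℝ) - osc ξ (-y) * (gsq (-y - b) - gsq b : ℝ)) / y := by
    rw [atomDiff]; push_cast; ring
  rw [this, h]
  push_cast
  ring

theorem norm_remainder_le {b ξ y : ℝ} (hy0 : 0 < y) (hy1 : y ≤ 1) :
    ‖(osc ξ y * (gsq (y - b) - gsq b : ℝ) - osc ξ (-y) * (gsq (-y - b) - gsq b : ℝ)) / (y : ℂ)‖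
      ≤ 8 / (1 + |b|) := by
  have hb : 0 < 1 + |b| := by positivity
  have h1 : |gsq (y - b) - gsq b| ≤ 4 * y / (1 + |b|) := by
    rw [le_div_iff₀ hb]
    have := abs_gsq_sub_le (b := b) (y := y) (by rw [abs_of_pos hy0]; exact hy1)
    rwa [abs_of_pos hy0] at this
  have h2 : |gsq (-y - b) - gsq b| ≤ 4 * y / (1 + |b|) := by
    rw [le_div_iff₀ hb]
    have := abs_gsq_sub_le (b := b) (y := -y) (by rw [abs_neg, abs_of_pos hy0]; exact hy1)
    rwa [abs_neg, abs_of_pos hy0] at this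
  rw [norm_div, Complex.norm_real, Real.norm_eq_abs, abs_of_pos hy0, div_le_iff₀ hy0]
  refine (norm_sub_le _ _).trans ?_
  rw [norm_mul, norm_mul, norm_osc, norm_osc, Complex.norm_real, Complex.norm_real, one_mul,
    one_mul, Real.norm_eq_abs, Real.norm_eq_abs]
  calc _ ≤ 4 * y / (1 + |b|) + 4 * y / (1 + |b|) := add_le_add h1 h2
    _ = _ := by ring

theorem norm_atomDiff_le_of_one_lt {b ξ y : ℝ} (hy : 1 < y) :
    ‖atomDiff b ξ y‖ ≤ (gsq (y - b) + gsq (y + b)) / y := by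
  have hy0 : 0 < y := by linarith
  rw [atomDiff, norm_div, Complex.norm_real, Real.norm_eq_abs, abs_of_pos hy0]
  gcongr
  refine (norm_sub_le _ _).trans (le_of_eq ?_)
  rw [norm_mul, norm_mul, norm_osc, norm_osc, Complex.norm_real, Complex.norm_real, one_mul,
    one_mul, Real.norm_of_nonneg (gsq_nonneg _), Real.norm_of_nonneg (gsq_nonneg _),
    ← gsq_neg (-y - b)]
  ring_nf

/-- An integrable majorant of `atomDiff b ξ`. -/
def atomDom (b ξ y : ℝ) : ℝ :=
  (Set.Ioc (0 : ℝ) 1).indicator (fun _ => 8 + 4 * Real.pi * |ξ|) y + (gsq (y - b) + gsq (y + b))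

/-- A crude bound that grows with `|ξ|`. It serves only for absolute convergence and Fubini; the
uniform estimate is that of the integral. -/
theorem norm_atomDiff_le {b ξ y : ℝ} (hy : 0 < y) : ‖atomDiff b ξ y‖ ≤ atomDom b ξ y := by
  have hg1 := gsq_nonneg (y - b)
  have hg2 := gsq_nonneg (y + b)
  rcases le_or_gt y 1 with h1 | h1
  · rw [atomDom, Set.indicator_of_mem (Set.mem_Ioc.2 ⟨hy, h1⟩)]
    have hr := norm_remainder_le (b := b) (ξ := ξ) hy h1
    have hr' : 8 / (1 + |b|) ≤ 8 := div_le_self (by norm_num) (by linarith [abs_nonneg b])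
    rw [atomDiff_eq]
    refine (norm_add_le _ _).trans ?_
    have hs : ‖2 * Complex.I * (gsq b : ℂ) * ((Real.sin (2 * Real.pi * ξ * y) / y : ℝ) : ℂ)‖
        ≤ 4 * Real.pi * |ξ| := by
      rw [norm_mul, norm_mul, norm_mul, Complex.norm_I, Complex.norm_real, Complex.norm_real,
        Real.norm_of_nonneg (gsq_nonneg b), Real.norm_eq_abs, abs_div, abs_of_pos hy]
      have h2 : |Real.sin (2 * Real.pi * ξ * y)| ≤ 2 * Real.pi * |ξ| * y := by
        refine Real.abs_sin_le_abs.trans (le_of_eq ?_)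
        rw [abs_mul, abs_mul, abs_of_pos hy, abs_of_pos Real.two_pi_pos]
      calc ‖(2 : ℂ)‖ * 1 * gsq b * (|Real.sin (2 * Real.pi * ξ * y)| / y)
          ≤ 2 * 1 * 1 * ((2 * Real.pi * |ξ| * y) / y) := by
            have := gsq_le_one b
            rw [RCLike.norm_ofNat]
            gcongr
        _ = 4 * Real.pi * |ξ| := by field_simp; ring
    linarith
  · rw [atomDom, Set.indicator_of_notMem (by simp [h1]), zero_add]
    refine (norm_atomDiff_le_of_one_lt h1).trans ?_
    exact div_le_self (by positivity) h1.le

theorem integrable_atomDom (b ξ : ℝ) : Integrable (atomDom b ξ) := by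
  refine Integrable.add ?_ ((integrable_gsq.comp_sub_right b).add (integrable_gsq.comp_add_right b))
  exact (integrable_indicator_iff measurableSet_Ioc).2 (integrableOn_const (by simp))

theorem integral_atomDom (b ξ : ℝ) :
    ∫ y, atomDom b ξ y = 8 + 4 * Real.pi * |ξ| + 2 * ∫ y, gsq y := by
  unfold atomDom
  have i1 := integrable_gsq.comp_sub_right b
  have i2 := integrable_gsq.comp_add_right b
  rw [integral_add (g := fun y => gsq (y - b) + gsq (y + b)) ((integrable_indicator_iff measurableSet_Ioc).2 (integrableOn_const (by simp)))
    (i1.add i2), integral_add i1 i2,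
    integral_sub_right_eq_self, integral_add_right_eq_self, integral_indicator measurableSet_Ioc]
  simp
  ring

theorem integrableOn_atomDiff (b ξ : ℝ) : IntegrableOn (atomDiff b ξ) (Set.Ioi 0) := by
  refine (integrable_atomDom b ξ).integrableOn.mono'
    (measurable_atomDiff_right b ξ).aestronglyMeasurable ?_
  filter_upwards [self_mem_ae_restrict measurableSet_Ioi] with y hy
  exact norm_atomDiff_le hy

/-- The principal value of the Hilbert transform integral of a Gaussian atom with centre `b` and
frequency `ξ`. -/
def bhtKer (b ξ : ℝ) : ℂ := ∫ y in Set.Ioi (0 : ℝ), atomDiff b ξ y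

theorem measurable_bhtKer : Measurable fun w : ℝ × ℝ => bhtKer w.1 w.2 := by
  have := measurable_atomDiff.stronglyMeasurable
  exact (this.integral_prod_right' (ν := volume.restrict (Set.Ioi 0))).measurable

/-- For `y ≤ 1` the frozen sine part gives `16 = 2 · 2 · 4` and the Lipschitz part `8`; absolute
values inside the sine integral would lose a logarithm of `ξ`. For `y > 1` the Gaussians sit at
`±b`, and `1 / y` is at most `(2 + |y ∓ b|) / (1 + |b|)`, whose numerator they absorb. -/
theorem exists_norm_bhtKer_le : ∃ C : ℝ, 0 ≤ C ∧ ∀ b ξ : ℝ, ‖bhtKer b ξ‖ ≤ C * (1 + |b|)⁻¹ := by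
  set M := ∫ x, gsq x * (2 + |x|) with hM
  have hM0 : 0 ≤ M := integral_nonneg fun x => mul_nonneg (gsq_nonneg x) (by positivity)
  refine ⟨16 + 8 + 2 * M, by positivity, fun b ξ => ?_⟩
  have hb : 0 < 1 + |b| := by positivity
  have hint := integrableOn_atomDiff b ξ
  have hsplit : bhtKer b ξ = (∫ y in Set.Ioc (0 : ℝ) 1, atomDiff b ξ y)
      + ∫ y in Set.Ioi (1 : ℝ), atomDiff b ξ y := by
    rw [bhtKer, ← Set.Ioc_union_Ioi_eq_Ioi zero_le_one]
    refine setIntegral_union (Set.Ioc_disjoint_Ioi le_rfl) measurableSet_Ioi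
      (hint.mono_set Set.Ioc_subset_Ioi_self) (hint.mono_set (Set.Ioi_subset_Ioi zero_le_one))
  have hgb : gsq b ≤ 2 * (1 + |b|)⁻¹ := by
    rw [← div_eq_mul_inv, le_div_iff₀ hb]
    have h1 := gsq_mul_le_one b
    have h2 := gsq_le_one b
    have h3 := gsq_nonneg b
    rw [← sq_abs] at h1
    calc gsq b * (1 + |b|) ≤ gsq b * (2 * (1 + 2 * |b| ^ 2)) := by
          gcongr; nlinarith [sq_nonneg (|b| - 1), abs_nonneg b]
      _ ≤ 2 := by linarith
  have hfar : ‖∫ y in Set.Ioi (1 : ℝ), atomDiff b ξ y‖ ≤ 2 * M * (1 + |b|)⁻¹ := by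
    have i1 := integrable_gsq_mul.comp_sub_right b
    have i2 := integrable_gsq_mul.comp_add_right b
    have h1 : ∀ y ∈ Set.Ioi (1 : ℝ), ‖atomDiff b ξ y‖ ≤
        (gsq (y - b) * (2 + |y - b|) + gsq (y + b) * (2 + |y + b|)) * (1 + |b|)⁻¹ := by
      intro y hy
      have hy1 : 1 < y := hy
      have hy0 : 0 < y := by linarith
      refine (norm_atomDiff_le_of_one_lt hy).trans ?_
      rw [← div_eq_mul_inv, div_le_div_iff₀ hy0 hb]
      have k1 : 1 + |b| ≤ y * (2 + |y - b|) := by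
        have : |b| ≤ y + |y - b| := by
          calc |b| = |y - (y - b)| := by ring_nf
            _ ≤ |y| + |y - b| := abs_sub _ _
            _ = _ := by rw [abs_of_pos hy0]
        nlinarith [abs_nonneg (y - b)]
      have k2 : 1 + |b| ≤ y * (2 + |y + b|) := by
        have : |b| ≤ y + |y + b| := by
          calc |b| = |(y + b) - y| := by ring_nf
            _ ≤ |y + b| + |y| := abs_sub _ _
            _ = _ := by rw [abs_of_pos hy0]; ring
        nlinarith [abs_nonneg (y + b)]
      have g1 := mul_le_mul_of_nonneg_left k1 (gsq_nonneg (y - b))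
      have g2 := mul_le_mul_of_nonneg_left k2 (gsq_nonneg (y + b))
      linarith
    calc _ ≤ ∫ y in Set.Ioi (1 : ℝ),
          (gsq (y - b) * (2 + |y - b|) + gsq (y + b) * (2 + |y + b|)) * (1 + |b|)⁻¹ := by
          refine norm_integral_le_of_norm_le ((i1.add i2).mul_const _).integrableOn ?_
          filter_upwards [self_mem_ae_restrict measurableSet_Ioi] with y hy
          exact h1 y hy
      _ ≤ ∫ y, (gsq (y - b) * (2 + |y - b|) + gsq (y + b) * (2 + |y + b|)) * (1 + |b|)⁻¹ := by
          refine setIntegral_le_integral ((i1.add i2).mul_const _) (Eventually.of_forall fun y => ?_)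
          have := gsq_nonneg (y - b)
          have := gsq_nonneg (y + b)
          simp only [Pi.zero_apply]
          positivity
      _ = 2 * M * (1 + |b|)⁻¹ := by
          rw [integral_mul_const, integral_add i1 i2,
            integral_sub_right_eq_self (fun x => gsq x * (2 + |x|)),
            integral_add_right_eq_self (fun x => gsq x * (2 + |x|))]
          ring
  have hnear : ‖∫ y in Set.Ioc (0 : ℝ) 1, atomDiff b ξ y‖ ≤ (16 + 8) * (1 + |b|)⁻¹ := by
    set S : ℝ → ℂ := fun y =>
      2 * Complex.I * gsq b * ((Real.sin (2 * Real.pi * ξ * y) / y : ℝ) : ℂ) with hS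
    have hbd : ∀ y : ℝ, ‖Real.sin (2 * Real.pi * ξ * y) / y‖ ≤ 2 * Real.pi * |ξ| := by
      intro y
      rcases eq_or_ne y 0 with rfl | hy
      · simp; positivity
      · rw [Real.norm_eq_abs, abs_div, div_le_iff₀ (abs_pos.2 hy)]
        refine Real.abs_sin_le_abs.trans (le_of_eq ?_)
        rw [abs_mul, abs_mul, abs_of_pos Real.two_pi_pos]
    have hsi : IntegrableOn (fun y => Real.sin (2 * Real.pi * ξ * y) / y) (Set.Ioc 0 1) := by
      refine Measure.integrableOn_of_bounded (M := 2 * Real.pi * |ξ|) (by simp) ?_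
        (Eventually.of_forall hbd)
      exact (by fun_prop : Measurable fun y => Real.sin (2 * Real.pi * ξ * y) / y)
        |>.aestronglyMeasurable
    have hSi : IntegrableOn S (Set.Ioc 0 1) := (hsi.ofReal (𝕜 := ℂ)).const_mul _
    have hdi := hint.mono_set (Set.Ioc_subset_Ioi_self : Set.Ioc (0 : ℝ) 1 ⊆ _)
    have e : ∫ y in Set.Ioc (0 : ℝ) 1, atomDiff b ξ y = (∫ y in Set.Ioc (0 : ℝ) 1, S y)
        + ∫ y in Set.Ioc (0 : ℝ) 1, (atomDiff b ξ y - S y) := by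
      rw [← integral_add (g := fun y => atomDiff b ξ y - S y) hSi (hdi.sub hSi)]
      congr 1; ext y; simp
    rw [e]
    refine (norm_add_le _ _).trans ?_
    have n1 : ‖∫ y in Set.Ioc (0 : ℝ) 1, S y‖ ≤ 16 * (1 + |b|)⁻¹ := by
      have h3 : ∫ y in Set.Ioc (0 : ℝ) 1, S y = 2 * Complex.I * gsq b *
          ((∫ y in (0 : ℝ)..1, Real.sin (2 * Real.pi * ξ * y) / y : ℝ) : ℂ) := by
        rw [hS, integral_const_mul, integral_complex_ofReal, intervalIntegral.integral_of_le zero_le_one]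
      have h4 := abs_integral_sin_div_le (2 * Real.pi * ξ)
      rw [h3, norm_mul, norm_mul, norm_mul, Complex.norm_I, Complex.norm_real, Complex.norm_real,
        Real.norm_of_nonneg (gsq_nonneg b), Real.norm_eq_abs]
      calc ‖(2 : ℂ)‖ * 1 * gsq b * |∫ y in (0 : ℝ)..1, Real.sin (2 * Real.pi * ξ * y) / y|
          ≤ 2 * 1 * (2 * (1 + |b|)⁻¹) * 4 := by
            rw [RCLike.norm_ofNat]
            gcongr
        _ = _ := by ring
    have n2 : ‖∫ y in Set.Ioc (0 : ℝ) 1, (atomDiff b ξ y - S y)‖ ≤ 8 * (1 + |b|)⁻¹ := by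
      have := norm_setIntegral_le_of_norm_le_const (μ := volume) (s := Set.Ioc (0 : ℝ) 1)
        (f := fun y => atomDiff b ξ y - S y) (C := 8 * (1 + |b|)⁻¹) (by simp) fun y hy => ?_
      · simpa using this
      · rw [atomDiff_eq, hS, add_sub_cancel_left, ← div_eq_mul_inv]
        exact norm_remainder_le hy.1 hy.2
    linarith
  rw [hsplit]
  refine (norm_add_le _ _).trans ?_
  linarith

/-! ### Uniform decay of short-time Fourier transforms of Schwartz functions -/

theorem norm_schwartzStft_le (ψ u : 𝓢(ℝ, ℂ)) (t ν : ℝ) :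
    ‖schwartzStft ψ u t ν‖ ≤ SchwartzMap.seminorm ℂ 0 0 u * ∫ x, ‖ψ x‖ := by
  unfold schwartzStft
  calc _ ≤ ∫ x, SchwartzMap.seminorm ℂ 0 0 u * ‖ψ (x - t)‖ := by
        refine norm_integral_le_of_norm_le ((ψ.integrable.norm.comp_sub_right t).const_mul _)
          (Eventually.of_forall fun x => ?_)
        rw [norm_mul, norm_mul, norm_char, one_mul]
        gcongr
        exact SchwartzMap.norm_le_seminorm ℂ u x
    _ = _ := by rw [integral_const_mul, integral_sub_right_eq_self (fun x => ‖ψ x‖)]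

theorem continuous_mulX : Continuous mulX :=
  (SchwartzMap.smulLeftCLM ℂ (fun x : ℝ => (x : ℂ))).continuous

theorem mulX_zero : mulX 0 = 0 := map_zero (SchwartzMap.smulLeftCLM ℂ (fun x : ℝ => (x : ℂ)))

/-- The induction is that of `schwartzStft_decay`, with the bound kept as a continuous function of
`u` vanishing at `0`; this is what makes the extended transform a tempered distribution. -/
theorem schwartzStft_decay_continuous (a b : ℕ) : ∀ ψ : 𝓢(ℝ, ℂ), ∃ Q : 𝓢(ℝ, ℂ) → ℝ,
    Continuous Q ∧ Q 0 = 0 ∧ ∀ u t ν, |t| ^ a * |ν| ^ b * ‖schwartzStft ψ u t ν‖ ≤ Q u := by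
  induction a with
  | zero =>
    induction b with
    | zero =>
      intro ψ
      refine ⟨fun u => SchwartzMap.seminorm ℂ 0 0 u * ∫ x, ‖ψ x‖, ?_, by simp, fun u t ν => ?_⟩
      · exact ((schwartz_withSeminorms ℂ ℝ ℂ).continuous_seminorm (0, 0)).mul_const _
      · simpa using norm_schwartzStft_le ψ u t ν
    | succ b ih =>
      intro ψ
      obtain ⟨Q, hQc, hQ0, hQ⟩ := ih ψ
      obtain ⟨R, hRc, hR0, hR⟩ := ih (SchwartzMap.derivCLM ℂ ℂ ψ)
      refine ⟨fun u => (Q (SchwartzMap.derivCLM ℂ ℂ u) + R u) / (2 * Real.pi),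
        ((hQc.comp (SchwartzMap.derivCLM ℂ ℂ).continuous).add hRc).div_const _,
        by simp [hQ0, hR0], fun u t ν => ?_⟩
      rw [le_div_iff₀ (by positivity)]
      have e : 2 * Real.pi * |ν| * ‖schwartzStft ψ u t ν‖
          ≤ ‖schwartzStft ψ (SchwartzMap.derivCLM ℂ ℂ u) t ν‖
            + ‖schwartzStft (SchwartzMap.derivCLM ℂ ℂ ψ) u t ν‖ := by
        refine le_trans (le_of_eq ?_) (norm_add_le _ _)
        rw [← freq_mul_schwartzStft, norm_mul]
        simp [abs_of_pos Real.pi_pos]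
      calc |t| ^ 0 * |ν| ^ (b + 1) * ‖schwartzStft ψ u t ν‖ * (2 * Real.pi)
          = |t| ^ 0 * |ν| ^ b * (2 * Real.pi * |ν| * ‖schwartzStft ψ u t ν‖) := by ring
        _ ≤ |t| ^ 0 * |ν| ^ b * (‖schwartzStft ψ (SchwartzMap.derivCLM ℂ ℂ u) t ν‖
            + ‖schwartzStft (SchwartzMap.derivCLM ℂ ℂ ψ) u t ν‖) := by gcongr
        _ ≤ _ := by rw [mul_add]; exact add_le_add (hQ _ t ν) (hR u t ν)
  | succ a ih =>
    intro ψ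
    obtain ⟨Q, hQc, hQ0, hQ⟩ := ih ψ
    obtain ⟨R, hRc, hR0, hR⟩ := ih (mulX ψ)
    refine ⟨fun u => Q (mulX u) + R u, (hQc.comp continuous_mulX).add hRc,
      by simp [hQ0, hR0, mulX_zero], fun u t ν => ?_⟩
    have e : |t| * ‖schwartzStft ψ u t ν‖
        ≤ ‖schwartzStft ψ (mulX u) t ν‖ + ‖schwartzStft (mulX ψ) u t ν‖ := by
      refine le_trans (le_of_eq ?_) (norm_sub_le _ _)
      rw [← time_mul_schwartzStft, norm_mul, Complex.norm_real, Real.norm_eq_abs]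
    calc |t| ^ (a + 1) * |ν| ^ b * ‖schwartzStft ψ u t ν‖
        = |t| ^ a * |ν| ^ b * (|t| * ‖schwartzStft ψ u t ν‖) := by ring
      _ ≤ |t| ^ a * |ν| ^ b *
          (‖schwartzStft ψ (mulX u) t ν‖ + ‖schwartzStft (mulX ψ) u t ν‖) := by gcongr
      _ ≤ _ := by rw [mul_add]; exact add_le_add (hQ _ t ν) (hR u t ν)

theorem exists_enorm_schwartzStft_le (ψ : 𝓢(ℝ, ℂ)) : ∃ Q : 𝓢(ℝ, ℂ) → ℝ,
    Continuous Q ∧ Q 0 = 0 ∧ (∀ u, 0 ≤ Q u) ∧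
      ∀ u t ν, ‖schwartzStft ψ u t ν‖ₑ ≤ ENNReal.ofReal (Q u) * (wt t ^ 2 * wt ν ^ 2) := by
  obtain ⟨Q0, c0, z0, h0⟩ := schwartzStft_decay_continuous 0 0 ψ
  obtain ⟨Q1, c1, z1, h1⟩ := schwartzStft_decay_continuous 2 0 ψ
  obtain ⟨Q2, c2, z2, h2⟩ := schwartzStft_decay_continuous 0 2 ψ
  obtain ⟨Q3, c3, z3, h3⟩ := schwartzStft_decay_continuous 2 2 ψ
  have hpos : ∀ u, 0 ≤ 4 * (Q0 u + Q1 u + Q2 u + Q3 u) := by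
    intro u
    have := h0 u 0 0
    have := h1 u 0 0
    have := h2 u 0 0
    have := h3 u 0 0
    simp only [pow_zero, one_mul, abs_zero, zero_pow two_ne_zero, zero_mul, mul_zero] at *
    have := norm_nonneg (schwartzStft ψ u 0 0)
    linarith
  refine ⟨fun u => 4 * (Q0 u + Q1 u + Q2 u + Q3 u), by fun_prop, by simp [*], hpos,
    fun u t ν => ?_⟩
  rw [wt, wt, ← ENNReal.ofReal_pow (by positivity), ← ENNReal.ofReal_pow (by positivity),
    ← ENNReal.ofReal_mul (by positivity), ← ENNReal.ofReal_mul (hpos u), ← ofReal_norm]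
  apply ENNReal.ofReal_le_ofReal
  rw [← mul_pow, ← mul_inv, inv_pow, ← div_eq_mul_inv, le_div_iff₀ (by positivity), mul_pow]
  have hp : ∀ s : ℝ, (1 + |s|) ^ 2 ≤ 2 * (1 + |s| ^ 2) := by
    intro s; nlinarith [sq_nonneg (|s| - 1)]
  set G := ‖schwartzStft ψ u t ν‖
  calc G * ((1 + |t|) ^ 2 * (1 + |ν|) ^ 2)
      ≤ G * ((2 * (1 + |t| ^ 2)) * (2 * (1 + |ν| ^ 2))) := by
        gcongr
        · exact hp t
        · exact hp ν
    _ = 4 * (|t| ^ 0 * |ν| ^ 0 * G + |t| ^ 2 * |ν| ^ 0 * G + |t| ^ 0 * |ν| ^ 2 * G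
          + |t| ^ 2 * |ν| ^ 2 * G) := by ring
    _ ≤ _ := by
        have := h0 u t ν
        have := h1 u t ν
        have := h2 u t ν
        have := h3 u t ν
        gcongr

/-- The Gaussian `exp (-2 x²)` as a Schwartz function. -/
def gsqWindow : 𝓢(ℝ, ℂ) := SchwartzMap.smulLeftCLM ℂ (gaussian 0) (gaussian 0)

theorem gsqWindow_apply (x : ℝ) : gsqWindow x = gsq x := by
  have h : gsqWindow x = gaussian 0 x • gaussian 0 x :=
    SchwartzMap.smulLeftCLM_apply_apply (gaussian 0).hasTemperateGrowth _ x
  have h2 : gaussian 0 x = gexp 0 x := rfl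
  rw [h, h2, gexp, smul_eq_mul, ← Complex.exp_add, gsq]
  push_cast
  congr 1; ring

theorem measurable_schwartzStft (ψ u : 𝓢(ℝ, ℂ)) :
    Measurable fun z : ℝ × ℝ => schwartzStft ψ u z.1 z.2 := by
  unfold schwartzStft
  have hψ := ψ.continuous
  have hu := u.continuous
  have : Continuous fun w : (ℝ × ℝ) × ℝ =>
      u w.2 * (Complex.exp (-2 * Real.pi * Complex.I * w.2 * w.1.2) * ψ (w.2 - w.1.1)) := by
    fun_prop
  exact this.stronglyMeasurable.integral_prod_right'.measurable

/-- Covariance under time-frequency shifts: only a unimodular phase appears. Thus one decay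
constant, that of `gaussian 0`, serves all atoms. -/
theorem norm_schwartzStft_stftAtom (t ν a μ : ℝ) :
    ‖schwartzStft gsqWindow (stftAtom t ν) a μ‖
      = ‖schwartzStft gsqWindow (gaussian 0) (a - t) (μ + ν)‖ := by
  have e : schwartzStft gsqWindow (stftAtom t ν) a μ
      = Complex.exp (-2 * Real.pi * Complex.I * t * (μ + ν : ℝ)) *
        schwartzStft gsqWindow (gaussian 0) (a - t) (μ + ν) := by
    unfold schwartzStft
    rw [← integral_const_mul, ← integral_add_right_eq_self _ t]
    congr 1; ext x
    have h2 : gaussian 0 x = gexp 0 x := rfl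
    have h3 : x + t - a = x - (a - t) := by ring
    rw [stftAtom_apply, h2, gexp, add_sub_cancel_right, h3]
    have h4 : ∀ p q r s w v : ℂ, p * q = r * v → w = s → p * s * (q * 1) = r * (w * (v * 1)) := by
      intro p q r s w v h h'
      rw [h', mul_one, mul_one, mul_right_comm, h]; ring
    have h5 := h4 (Complex.exp (-2 * Real.pi * Complex.I * (x + t : ℝ) * ν))
      (Complex.exp (-2 * Real.pi * Complex.I * (x + t : ℝ) * μ))
      (Complex.exp (-2 * Real.pi * Complex.I * t * (μ + ν : ℝ)))
      (Real.exp (-x ^ 2) : ℂ) (Complex.exp (-(x : ℂ) ^ 2 + 0 * x))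
      (Complex.exp (-2 * Real.pi * Complex.I * x * (μ + ν : ℝ))) ?_ ?_
    · simp only [mul_one] at h5
      linear_combination (gsqWindow (x - (a - t))) * h5
    · rw [← Complex.exp_add, ← Complex.exp_add]
      push_cast
      congr 1; ring
    · push_cast
      congr 1; ring
  rw [e, norm_mul, norm_char, one_mul]

/-! ### The extended bilinear Hilbert transform -/

/-- Phase space for a pair of functions: two times and two frequencies. -/
abbrev Phase := (ℝ × ℝ) × (ℝ × ℝ)

/-- The coefficient of the product of two time-frequency atoms, transformed by `BH`. -/
def bhtCoef (f g : 𝓢'(ℝ, ℂ)) (z : Phase) : ℂ :=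
  stft f z.1.1 z.2.1 * stft g z.1.2 z.2.2 * bhtKer ((z.1.1 - z.1.2) / 2) (z.2.1 - z.2.2)

/-- The pairing of a test function with the product of two transformed atoms. -/
def atomPair (u : 𝓢(ℝ, ℂ)) (z : Phase) : ℂ :=
  schwartzStft gsqWindow u ((z.1.1 + z.1.2) / 2) (-(z.2.1 + z.2.2))

/-- The absolute value of the short-time Fourier transform. -/
def absStft (f : 𝓢'(ℝ, ℂ)) (t ν : ℝ) : ℝ≥0∞ := ‖stft f t ν‖ₑ

theorem measurable_absStft (f : 𝓢'(ℝ, ℂ)) : Measurable (Function.uncurry (absStft f)) :=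
  (continuous_stft f).enorm.measurable

theorem eLpNorm_absStft (p : ℝ≥0∞) (f : 𝓢'(ℝ, ℂ)) (ν : ℝ) :
    eLpNorm (fun t => absStft f t ν) p volume = eLpNorm (fun t => stft f t ν) p volume :=
  eLpNorm_congr_enorm_ae (Eventually.of_forall fun t => by rw [absStft, enorm_enorm])

theorem mixedNorm_absStft (p q : ℝ≥0∞) (f : 𝓢'(ℝ, ℂ)) :
    mixedNorm p q (absStft f) = modNorm p q f := by
  simp only [mixedNorm, modNorm, eLpNorm_absStft]

theorem measurable_comp_phase {X : Type*} [MeasurableSpace X] {k : ℝ → ℝ → X}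
    (hk : Measurable fun w : ℝ × ℝ => k w.1 w.2) {a b : Phase → ℝ} (ha : Measurable a)
    (hb : Measurable b) : Measurable fun z => k (a z) (b z) :=
  Measurable.comp (g := fun w : ℝ × ℝ => k w.1 w.2) (f := fun z => (a z, b z)) hk (ha.prodMk hb)

theorem measurable_bhtCoef (f g : 𝓢'(ℝ, ℂ)) : Measurable (bhtCoef f g) := by
  have hf := measurable_comp_phase (continuous_stft f).measurable
    (a := fun z => z.1.1) (b := fun z => z.2.1) (by fun_prop) (by fun_prop)
  have hg := measurable_comp_phase (continuous_stft g).measurable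
    (a := fun z => z.1.2) (b := fun z => z.2.2) (by fun_prop) (by fun_prop)
  have hk := measurable_comp_phase measurable_bhtKer
    (a := fun z => (z.1.1 - z.1.2) / 2) (b := fun z => z.2.1 - z.2.2) (by fun_prop) (by fun_prop)
  exact (hf.mul hg).mul hk

theorem measurable_atomPair (u : 𝓢(ℝ, ℂ)) : Measurable (atomPair u) :=
  measurable_comp_phase (measurable_schwartzStft gsqWindow u)
    (a := fun z => (z.1.1 + z.1.2) / 2) (b := fun z => -(z.2.1 + z.2.2)) (by fun_prop) (by fun_prop)

theorem measurable_phaseOp_integrand {F G : ℝ → ℝ → ℝ≥0∞} (hF : Measurable (Function.uncurry F))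
    (hG : Measurable (Function.uncurry G)) (t ν : ℝ) :
    Measurable fun z : Phase => F z.1.1 z.2.1 * G z.1.2 z.2.2 *
      (timeKer t z.1 * wt (ν - z.2.1 - z.2.2) ^ 2) := by
  have h1 := measurable_comp_phase (k := F) hF
    (a := fun z => z.1.1) (b := fun z => z.2.1) (by fun_prop) (by fun_prop)
  have h2 := measurable_comp_phase (k := G) hG
    (a := fun z => z.1.2) (b := fun z => z.2.2) (by fun_prop) (by fun_prop)
  have h3 := measurable_wt
  have h4 : Measurable fun z : Phase => timeKer t z.1 * wt (ν - z.2.1 - z.2.2) ^ 2 := by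
    unfold timeKer
    fun_prop
  exact (h1.mul h2).mul h4

theorem wt_half_le (x : ℝ) : wt (x / 2) ≤ 2 * wt x := by
  have := wt_le_mul_wt (x := x / 2) (y := x) (c := 2) zero_le_two (by
    rw [abs_div, abs_two]; linarith [abs_nonneg x])
  simpa using this

theorem wt_neg (x : ℝ) : wt (-x) = wt x := by simp [wt]

/-- One estimate for two uses: at `(t, ν) = (0, 0)` with arbitrary `u` it gives convergence and
continuity, and with `u = stftAtom t ν` the pointwise bound on the transform. The `8` is `2` from
halving `t₁ - t₂` and `2²` from halving in the squared weight. -/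
theorem exists_lintegral_bhtCoef_mul_atomPair_le : ∃ K : ℝ≥0∞, K < ⊤ ∧
    ∀ (f g : 𝓢'(ℝ, ℂ)) (u : 𝓢(ℝ, ℂ)) (t ν : ℝ) (Q : ℝ≥0∞),
      (∀ a μ, ‖schwartzStft gsqWindow u a μ‖ₑ ≤ Q * (wt (a - t) ^ 2 * wt (μ + ν) ^ 2)) →
      ∫⁻ z, ‖bhtCoef f g z * atomPair u z‖ₑ ≤ K * Q * phaseOp (absStft f) (absStft g) t ν := by
  obtain ⟨C, hC0, hC⟩ := exists_norm_bhtKer_le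
  refine ⟨ENNReal.ofReal C * 8, by finiteness, fun f g u t ν Q hQ => ?_⟩
  have hker : ∀ x ξ : ℝ, ‖bhtKer (x / 2) ξ‖ₑ ≤ ENNReal.ofReal C * (2 * wt x) := by
    intro x ξ
    calc ‖bhtKer (x / 2) ξ‖ₑ ≤ ENNReal.ofReal C * wt (x / 2) := by
          rw [wt, ← ENNReal.ofReal_mul hC0, ← ofReal_norm]
          exact ENNReal.ofReal_le_ofReal (hC _ _)
      _ ≤ _ := by gcongr; exact wt_half_le x
  have hm := measurable_phaseOp_integrand (measurable_absStft f) (measurable_absStft g) t ν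
  rw [phaseOp, ← lintegral_const_mul _ hm]
  refine lintegral_mono fun z => ?_
  have h1 : wt ((z.1.1 + z.1.2) / 2 - t) ≤ 2 * wt (2 * t - z.1.1 - z.1.2) := by
    have e1 : (z.1.1 + z.1.2) / 2 - t = (z.1.1 + z.1.2 - 2 * t) / 2 := by ring
    have e2 : 2 * t - z.1.1 - z.1.2 = -(z.1.1 + z.1.2 - 2 * t) := by ring
    rw [e1, e2, wt_neg]
    exact wt_half_le _
  have h2 : wt (-(z.2.1 + z.2.2) + ν) = wt (ν - z.2.1 - z.2.2) := by congr 1; ring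
  dsimp only
  unfold bhtCoef atomPair
  rw [enorm_mul, enorm_mul, enorm_mul]
  calc _ ≤ ‖stft f z.1.1 z.2.1‖ₑ * ‖stft g z.1.2 z.2.2‖ₑ *
        (ENNReal.ofReal C * (2 * wt (z.1.1 - z.1.2))) *
        (Q * ((2 * wt (2 * t - z.1.1 - z.1.2)) ^ 2 * wt (ν - z.2.1 - z.2.2) ^ 2)) := by
        gcongr
        · exact hker _ _
        · refine (hQ _ _).trans ?_
          rw [h2]
          gcongr
    _ = _ := by
      unfold absStft timeKer
      ring

theorem integrable_bhtCoef_mul_atomPair {f g : 𝓢'(ℝ, ℂ)}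
    (h : phaseOp (absStft f) (absStft g) 0 0 < ⊤) (u : 𝓢(ℝ, ℂ)) :
    Integrable fun z => bhtCoef f g z * atomPair u z := by
  obtain ⟨K, hK, hb⟩ := exists_lintegral_bhtCoef_mul_atomPair_le
  obtain ⟨Q, -, -, -, hQ⟩ := exists_enorm_schwartzStft_le gsqWindow
  refine ⟨((measurable_bhtCoef f g).mul (measurable_atomPair u)).aestronglyMeasurable, ?_⟩
  refine (hb f g u 0 0 (ENNReal.ofReal (Q u)) fun a μ => ?_).trans_lt (by finiteness)
  simpa using hQ u a μ

theorem atomPair_add (u v : 𝓢(ℝ, ℂ)) (z : Phase) :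
    atomPair (u + v) z = atomPair u z + atomPair v z := by
  unfold atomPair schwartzStft
  rw [← integral_add (integrable_schwartzStft _ _ _ _) (integrable_schwartzStft _ _ _ _)]
  congr 1; ext x
  rw [add_apply]; ring

theorem atomPair_smul (c : ℂ) (u : 𝓢(ℝ, ℂ)) (z : Phase) :
    atomPair (c • u) z = c * atomPair u z := by
  unfold atomPair schwartzStft
  rw [← integral_const_mul]
  congr 1; ext x
  rw [smul_apply, smul_eq_mul]; ring

/-- The normalizing constant of the Gaussian inversion formula. -/
def invConst : ℂ := ((∫ x, gsq x : ℝ) : ℂ)⁻¹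

/-- The extended bilinear Hilbert transform of two tempered distributions whose short-time Fourier
transforms have finite interaction. -/
def bhtDist (f g : 𝓢'(ℝ, ℂ)) (h : phaseOp (absStft f) (absStft g) 0 0 < ⊤) : 𝓢'(ℝ, ℂ) :=
  ContinuousLinearMap.toPointwiseConvergenceCLM _ _ _ _
    { toFun := fun u => invConst ^ 2 * ∫ z, bhtCoef f g z * atomPair u z
      map_add' := by
        intro u v
        rw [← mul_add, ← integral_add (integrable_bhtCoef_mul_atomPair h u)
          (integrable_bhtCoef_mul_atomPair h v)]
        congr 2; ext z
        rw [atomPair_add]; ring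
      map_smul' := by
        intro c u
        rw [RingHom.id_apply, smul_eq_mul, mul_left_comm, ← integral_const_mul c]
        congr 2; ext z
        rw [atomPair_smul]; ring
      cont := by
        obtain ⟨K, hK, hb⟩ := exists_lintegral_bhtCoef_mul_atomPair_le
        obtain ⟨Q, hQc, hQ0, hQpos, hQ⟩ := exists_enorm_schwartzStft_le gsqWindow
        refine continuous_const.mul ?_
        -- By linearity the difference is the pairing with `u - v`, and `Q` is continuous with `Q 0
        -- = 0`.
        have hdiff : ∀ u v : 𝓢(ℝ, ℂ), ‖(∫ z, bhtCoef f g z * atomPair u z)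
            - ∫ z, bhtCoef f g z * atomPair v z‖
            ≤ (K * phaseOp (absStft f) (absStft g) 0 0).toReal * Q (u - v) := by
          intro u v
          have e : (∫ z, bhtCoef f g z * atomPair u z) - ∫ z, bhtCoef f g z * atomPair v z
              = ∫ z, bhtCoef f g z * atomPair (u - v) z := by
            rw [← integral_sub (integrable_bhtCoef_mul_atomPair h u)
              (integrable_bhtCoef_mul_atomPair h v)]
            congr 1; ext z
            have := atomPair_add (u - v) v z
            rw [sub_add_cancel] at this
            rw [this]; ring
          rw [e]
          have h1 := hb f g (u - v) 0 0 (ENNReal.ofReal (Q (u - v))) fun a μ => by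
            simpa using hQ (u - v) a μ
          have h2 := (enorm_integral_le_lintegral_enorm
            (fun z => bhtCoef f g z * atomPair (u - v) z)).trans h1
          have h3 := ENNReal.toReal_mono (by finiteness) h2
          rw [toReal_enorm] at h3
          refine h3.trans (le_of_eq ?_)
          rw [ENNReal.toReal_mul, ENNReal.toReal_mul, ENNReal.toReal_mul,
            ENNReal.toReal_ofReal (hQpos _)]
          ring
        rw [continuous_iff_continuousAt]
        intro v
        rw [ContinuousAt, tendsto_iff_norm_sub_tendsto_zero]
        refine squeeze_zero (fun _ => norm_nonneg _) (fun u => hdiff u v) ?_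
        have : Continuous fun u : 𝓢(ℝ, ℂ) =>
            (K * phaseOp (absStft f) (absStft g) 0 0).toReal * Q (u - v) := by fun_prop
        simpa [hQ0] using this.tendsto v }

theorem bhtDist_apply (f g : 𝓢'(ℝ, ℂ)) (h : phaseOp (absStft f) (absStft g) 0 0 < ⊤)
    (u : 𝓢(ℝ, ℂ)) :
    bhtDist f g h u = invConst ^ 2 * ∫ z, bhtCoef f g z * atomPair u z := rfl

theorem exists_absStft_bhtDist_le : ∃ K : ℝ≥0∞, K < ⊤ ∧ ∀ (f g : 𝓢'(ℝ, ℂ))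
    (h : phaseOp (absStft f) (absStft g) 0 0 < ⊤) (t ν : ℝ),
    absStft (bhtDist f g h) t ν ≤ K * phaseOp (absStft f) (absStft g) t ν := by
  obtain ⟨K, hK, hb⟩ := exists_lintegral_bhtCoef_mul_atomPair_le
  obtain ⟨Q, -, -, -, hQ⟩ := exists_enorm_schwartzStft_le gsqWindow
  refine ⟨‖invConst ^ 2‖ₑ * (K * ENNReal.ofReal (Q (gaussian 0))), by finiteness,
    fun f g h t ν => ?_⟩
  rw [absStft, stft, bhtDist_apply, enorm_mul, mul_assoc]
  gcongr
  refine (enorm_integral_le_lintegral_enorm _).trans (hb f g _ t ν _ fun a μ => ?_)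
  rw [← ofReal_norm, norm_schwartzStft_stftAtom, ofReal_norm]
  exact hQ _ _ _

/-! ### Bilinearity of the phase-space coefficients -/

theorem bhtCoef_add_left (f f' g : 𝓢'(ℝ, ℂ)) (z : Phase) :
    bhtCoef (f + f') g z = bhtCoef f g z + bhtCoef f' g z := by
  have : ∀ t ν, stft (f + f') t ν = stft f t ν + stft f' t ν := fun _ _ => rfl
  simp only [bhtCoef, this]; ring

theorem bhtCoef_add_right (f g g' : 𝓢'(ℝ, ℂ)) (z : Phase) :
    bhtCoef f (g + g') z = bhtCoef f g z + bhtCoef f g' z := by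
  have : ∀ t ν, stft (g + g') t ν = stft g t ν + stft g' t ν := fun _ _ => rfl
  simp only [bhtCoef, this]; ring

theorem bhtCoef_smul_left (c : ℂ) (f g : 𝓢'(ℝ, ℂ)) (z : Phase) :
    bhtCoef (c • f) g z = c * bhtCoef f g z := by
  have : ∀ t ν, stft (c • f) t ν = c * stft f t ν := fun _ _ => rfl
  simp only [bhtCoef, this]; ring

theorem bhtCoef_smul_right (c : ℂ) (f g : 𝓢'(ℝ, ℂ)) (z : Phase) :
    bhtCoef f (c • g) z = c * bhtCoef f g z := by
  have : ∀ t ν, stft (c • g) t ν = c * stft g t ν := fun _ _ => rfl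
  simp only [bhtCoef, this]; ring

/-! ### Finiteness of the interaction at the origin -/

theorem phaseOp_zero_le {F G : ℝ → ℝ → ℝ≥0∞} (hF : Measurable (Function.uncurry F))
    (hG : Measurable (Function.uncurry G)) {t ν : ℝ} (ht : |2 * t| ≤ 1) (hν : |ν| ≤ 1) :
    phaseOp F G 0 0 ≤ 16 * phaseOp F G t ν := by
  have hm := measurable_phaseOp_integrand hF hG t ν
  rw [phaseOp, phaseOp, ← lintegral_const_mul _ hm]
  refine lintegral_mono fun z => ?_
  have h1 := wt_le_two_mul_wt_add (x := 2 * 0 - z.1.1 - z.1.2) ht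
  have h2 := wt_le_two_mul_wt_add (x := 0 - z.2.1 - z.2.2) hν
  dsimp only
  unfold timeKer
  calc _ ≤ F z.1.1 z.2.1 * G z.1.2 z.2.2 * (wt (z.1.1 - z.1.2) *
        (2 * wt (2 * 0 - z.1.1 - z.1.2 + 2 * t)) ^ 2 * (2 * wt (0 - z.2.1 - z.2.2 + ν)) ^ 2) := by
        gcongr
    _ = _ := by
        have e1 : 2 * 0 - z.1.1 - z.1.2 + 2 * t = 2 * t - z.1.1 - z.1.2 := by ring
        have e2 : 0 - z.2.1 - z.2.2 + ν = ν - z.2.1 - z.2.2 := by ring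
        rw [e1, e2]; ring

theorem exists_abs_le_of_ae {P : ℝ → Prop} (h : ∀ᵐ x, P x) {r : ℝ} (hr : 0 < r) :
    ∃ x, |x| ≤ r ∧ P x := by
  have hd : Dense {x | P x} := Measure.dense_of_ae h
  obtain ⟨x, hx, hP⟩ := hd.exists_mem_open Metric.isOpen_ball ⟨0, Metric.mem_ball_self hr⟩
  rw [Metric.mem_ball, Real.dist_eq, sub_zero] at hP
  exact ⟨x, hP.le, hx⟩

/-- Essential suprema control almost every point, not the origin. A good point close to it suffices,
since the kernel varies slowly at unit scale. -/
theorem phaseOp_zero_lt_top {F G : ℝ → ℝ → ℝ≥0∞} (hF : Measurable (Function.uncurry F))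
    (hG : Measurable (Function.uncurry G)) (h : mixedNorm ⊤ ⊤ (phaseOp F G) < ⊤) :
    phaseOp F G 0 0 < ⊤ := by
  rw [mixedNorm, eLpNorm_exponent_top] at h
  obtain ⟨ν, hν, h1⟩ := exists_abs_le_of_ae
    (ENNReal.ae_le_essSup (μ := volume)
      fun ν => ‖eLpNorm (fun t => phaseOp F G t ν) ⊤ volume‖ₑ) one_pos
  rw [enorm_eq_self] at h1
  have h2 := h1.trans_lt h
  rw [eLpNorm_exponent_top] at h2
  obtain ⟨t, ht, h3⟩ := exists_abs_le_of_ae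
    (ENNReal.ae_le_essSup (μ := volume) fun t => ‖phaseOp F G t ν‖ₑ) (r := 1 / 2) (by norm_num)
  rw [enorm_eq_self] at h3
  have h4 := h3.trans_lt h2
  refine (phaseOp_zero_le hF hG ?_ hν).trans_lt (ENNReal.mul_lt_top (by simp) h4)
  rw [abs_mul, abs_two]; linarith

/-! ### Gaussian inversion for Schwartz functions -/

/-- The Gaussian window `exp (-x²)`. -/
def gwin (x : ℝ) : ℝ := Real.exp (-x ^ 2)

theorem gwin_nonneg (x : ℝ) : 0 ≤ gwin x := (Real.exp_pos _).le

theorem gwin_le_one (x : ℝ) : gwin x ≤ 1 := by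
  unfold gwin; rw [Real.exp_le_one_iff]; nlinarith [sq_nonneg x]

theorem gwin_mul_gwin (x : ℝ) : gwin x * gwin x = gsq x := by
  rw [gwin, ← Real.exp_add, gsq]; congr 1; ring

theorem integral_gsq_ne_zero : ((∫ x, gsq x : ℝ) : ℂ) ≠ 0 := by
  have : ∫ x, gsq x = √(Real.pi / 2) := integral_gaussian 2
  rw [this]
  exact_mod_cast (Real.sqrt_pos.2 (by positivity)).ne'

/-- For fixed `t` the transform in `ν` is the Fourier transform of the Schwartz function `f φ(· -
t)`, and Fourier inversion applies. -/
theorem integral_stft_mul_osc (f : 𝓢(ℝ, ℂ)) (t x : ℝ) :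
    ∫ ν, stft (f : 𝓢'(ℝ, ℂ)) t ν * osc ν x = f x * gwin (x - t) := by
  set h : 𝓢(ℝ, ℂ) := SchwartzMap.smulLeftCLM ℂ (stftAtom t 0) f with hh
  have happ : ∀ y, h y = f y * gwin (y - t) := by
    intro y
    have : h y = stftAtom t 0 y • f y :=
      SchwartzMap.smulLeftCLM_apply_apply (stftAtom t 0).hasTemperateGrowth _ y
    rw [this, stftAtom_apply, gwin, smul_eq_mul]
    simp [mul_comm]
  have hF : ∀ ν, (FourierTransform.fourier h) ν = stft (f : 𝓢'(ℝ, ℂ)) t ν := by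
    intro ν
    rw [SchwartzMap.fourier_coe, Real.fourier_eq', stft, SchwartzMap.coe_apply]
    congr 1; ext y
    rw [happ, stftAtom_apply, gwin, smul_eq_mul, smul_eq_mul]
    have : ((-2 * Real.pi * inner ℝ y ν : ℝ) : ℂ) * Complex.I
        = -2 * Real.pi * Complex.I * y * ν := by
      simp only [RCLike.inner_apply, conj_trivial]
      push_cast; ring
    rw [this]; ring
  rw [← happ]
  have inv : h x = (FourierTransformInv.fourierInv (FourierTransform.fourier h)) x := by
    rw [FourierTransform.fourierInv_fourier_eq]
  rw [inv, SchwartzMap.fourierInv_coe, Real.fourierInv_eq']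
  congr 1; ext ν
  rw [hF, osc, smul_eq_mul, mul_comm]
  congr 3
  simp only [RCLike.inner_apply, conj_trivial]
  ring_nf

theorem integral_gwin_mul_stft_mul_osc (f : 𝓢(ℝ, ℂ)) (x : ℝ) :
    ∫ t, (gwin (x - t) : ℂ) * ∫ ν, stft (f : 𝓢'(ℝ, ℂ)) t ν * osc ν x
      = f x * ((∫ y, gsq y : ℝ) : ℂ) := by
  simp_rw [integral_stft_mul_osc]
  have : ∀ t, (gwin (x - t) : ℂ) * (f x * (gwin (x - t) : ℂ)) = f x * ((gsq (x - t) : ℝ) : ℂ) := by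
    intro t
    rw [← gwin_mul_gwin]; push_cast; ring
  simp_rw [this]
  rw [integral_const_mul, integral_complex_ofReal, integral_sub_left_eq_self gsq]

/-- An integrable weight on the line. -/
def decayWt (s : ℝ) : ℝ := (1 + ‖s‖) ^ (-((2 : ℕ) : ℝ))

theorem decayWt_nonneg (s : ℝ) : 0 ≤ decayWt s := by unfold decayWt; positivity

theorem integrable_decayWt : Integrable decayWt :=
  integrable_one_add_norm (by simp)

theorem exists_norm_stft_coe_le (f : 𝓢(ℝ, ℂ)) : ∃ C : ℝ, 0 ≤ C ∧ ∀ t ν,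
    ‖stft (f : 𝓢'(ℝ, ℂ)) t ν‖ * (1 + |ν|) ≤ C * (decayWt t * decayWt ν) := by
  -- Order `2` for integrability; the third power in `ν` pays for the factor `1 + |ν|`, which later
  -- absorbs the growth of `atomDom` in the frequency.
  obtain ⟨C, hC⟩ := stft_coe_decay f 2 3
  have hC0 : 0 ≤ C := by
    have := hC 0 0
    simp only [norm_zero, add_zero, Real.one_rpow, mul_one] at this
    exact (norm_nonneg _).trans this
  refine ⟨C, hC0, fun t ν => ?_⟩
  have h1 : (1 + ‖ν‖) ^ (-((3 : ℕ) : ℝ)) * (1 + |ν|) = decayWt ν := by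
    rw [decayWt, Real.norm_eq_abs]
    nth_rw 2 [← Real.rpow_one (1 + |ν|)]
    rw [← Real.rpow_add (by positivity)]
    norm_num
  calc _ ≤ C * ((1 + ‖t‖) ^ (-((2 : ℕ) : ℝ)) * (1 + ‖ν‖) ^ (-((3 : ℕ) : ℝ))) * (1 + |ν|) := by
        gcongr
        exact hC t ν
    _ = C * (decayWt t * ((1 + ‖ν‖) ^ (-((3 : ℕ) : ℝ)) * (1 + |ν|))) := by
        rw [decayWt]; ring
    _ = _ := by rw [h1]

/-- The product of the short-time Fourier transforms of two functions. -/
def stftProd (f g : 𝓢'(ℝ, ℂ)) (z : Phase) : ℂ := stft f z.1.1 z.2.1 * stft g z.1.2 z.2.2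

theorem continuous_stftProd (f g : 𝓢'(ℝ, ℂ)) : Continuous (stftProd f g) := by
  have hf : Continuous fun z : Phase => stft f z.1.1 z.2.1 :=
    Continuous.comp (g := fun w : ℝ × ℝ => stft f w.1 w.2) (f := fun z : Phase => (z.1.1, z.2.1))
      (continuous_stft f) (by fun_prop)
  have hg : Continuous fun z : Phase => stft g z.1.2 z.2.2 :=
    Continuous.comp (g := fun w : ℝ × ℝ => stft g w.1 w.2) (f := fun z : Phase => (z.1.2, z.2.2))
      (continuous_stft g) (by fun_prop)
  exact hf.mul hg

theorem integrable_norm_stftProd_mul (f g : 𝓢(ℝ, ℂ)) :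
    Integrable fun z : Phase => ‖stftProd (f : 𝓢'(ℝ, ℂ)) (g : 𝓢'(ℝ, ℂ)) z‖
      * ((1 + |z.2.1|) * (1 + |z.2.2|)) := by
  obtain ⟨C, hC0, hC⟩ := exists_norm_stft_coe_le f
  obtain ⟨D, hD0, hD⟩ := exists_norm_stft_coe_le g
  have hw := integrable_decayWt
  have h4 : Integrable fun z : Phase => (decayWt z.1.1 * decayWt z.1.2)
      * (decayWt z.2.1 * decayWt z.2.2) := (hw.mul_prod hw).mul_prod (hw.mul_prod hw)
  refine (h4.const_mul (C * D)).mono' ?_ (Eventually.of_forall fun z => ?_)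
  · have := continuous_stftProd (f : 𝓢'(ℝ, ℂ)) (g : 𝓢'(ℝ, ℂ))
    exact Continuous.aestronglyMeasurable (by fun_prop)
  · rw [Real.norm_of_nonneg (by positivity), stftProd, norm_mul]
    have h1 := hC z.1.1 z.2.1
    have h2 := hD z.1.2 z.2.2
    calc _ = (‖stft (f : 𝓢'(ℝ, ℂ)) z.1.1 z.2.1‖ * (1 + |z.2.1|))
          * (‖stft (g : 𝓢'(ℝ, ℂ)) z.1.2 z.2.2‖ * (1 + |z.2.2|)) := by ring
      _ ≤ (C * (decayWt z.1.1 * decayWt z.2.1)) * (D * (decayWt z.1.2 * decayWt z.2.2)) := by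
        have := decayWt_nonneg z.1.1
        have := decayWt_nonneg z.2.1
        gcongr
      _ = _ := by ring

theorem integrable_stftProd (f g : 𝓢(ℝ, ℂ)) :
    Integrable (stftProd (f : 𝓢'(ℝ, ℂ)) (g : 𝓢'(ℝ, ℂ))) := by
  refine (integrable_norm_stftProd_mul f g).mono'
    (continuous_stftProd _ _).aestronglyMeasurable (Eventually.of_forall fun z => ?_)
  refine le_mul_of_one_le_right (norm_nonneg _) ?_
  nlinarith [abs_nonneg z.2.1, abs_nonneg z.2.2]

/-- The product of two time-frequency atoms, evaluated at two points. -/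
def atomProd (x x' : ℝ) (z : Phase) : ℂ :=
  (gwin (x - z.1.1) * osc z.2.1 x) * (gwin (x' - z.1.2) * osc z.2.2 x')

theorem norm_atomProd_le (x x' : ℝ) (z : Phase) : ‖atomProd x x' z‖ ≤ 1 := by
  rw [atomProd, norm_mul, norm_mul, norm_mul, norm_osc, norm_osc, Complex.norm_real,
    Complex.norm_real, Real.norm_of_nonneg (gwin_nonneg _), Real.norm_of_nonneg (gwin_nonneg _),
    mul_one, mul_one]
  exact mul_le_one₀ (gwin_le_one _) (gwin_nonneg _) (gwin_le_one _)

theorem continuous_atomProd (x x' : ℝ) : Continuous (atomProd x x') := by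
  unfold atomProd gwin osc; fun_prop

theorem integrable_stftProd_mul_atomProd (f g : 𝓢(ℝ, ℂ)) (x x' : ℝ) :
    Integrable fun z => stftProd (f : 𝓢'(ℝ, ℂ)) (g : 𝓢'(ℝ, ℂ)) z * atomProd x x' z := by
  refine (integrable_stftProd f g).norm.mono'
    ((continuous_stftProd _ _).mul (continuous_atomProd x x')).aestronglyMeasurable
    (Eventually.of_forall fun z => ?_)
  rw [norm_mul]
  exact mul_le_of_le_one_right (norm_nonneg _) (norm_atomProd_le x x' z)

theorem mul_eq_integral_stftProd (f g : 𝓢(ℝ, ℂ)) (x x' : ℝ) :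
    f x * g x' = invConst ^ 2 *
      ∫ z, stftProd (f : 𝓢'(ℝ, ℂ)) (g : 𝓢'(ℝ, ℂ)) z * atomProd x x' z := by
  have hint := integrable_stftProd_mul_atomProd f g x x'
  have e1 : ∫ z, stftProd (f : 𝓢'(ℝ, ℂ)) (g : 𝓢'(ℝ, ℂ)) z * atomProd x x' z
      = (f x * ((∫ y, gsq y : ℝ) : ℂ)) * (g x' * ((∫ y, gsq y : ℝ) : ℂ)) := by
    rw [Measure.volume_eq_prod] at hint ⊢
    rw [integral_prod _ hint, ← integral_gwin_mul_stft_mul_osc, ← integral_gwin_mul_stft_mul_osc,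
      Measure.volume_eq_prod, ← integral_prod_mul]
    congr 1; ext τ
    have : ∀ a b c d : ℂ, (a * b) * (c * d) = (a * c) * (b * d) := fun a b c d => by ring
    rw [this, ← integral_prod_mul, ← integral_const_mul]
    congr 1; ext η
    rw [stftProd, atomProd]
    ring
  rw [e1, invConst]
  have := integral_gsq_ne_zero
  field_simp

/-- The modulated Gaussian in the spatial variable that factors out of a product of atoms. -/
def atomOut (x : ℝ) (z : Phase) : ℂ :=
  osc (z.2.1 + z.2.2) x * gsq (x - (z.1.1 + z.1.2) / 2)

theorem continuous_atomOut : Continuous fun w : ℝ × Phase => atomOut w.1 w.2 := by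
  unfold atomOut osc gsq; fun_prop

theorem norm_atomOut_le (x : ℝ) (z : Phase) : ‖atomOut x z‖ ≤ 1 := by
  rw [atomOut, norm_mul, norm_osc, one_mul, Complex.norm_real,
    Real.norm_of_nonneg (gsq_nonneg _)]
  exact gsq_le_one _

/-- With `u = x - (t₁ + t₂)/2` and `v = y - (t₁ - t₂)/2` one has `x + y - t₁ = u + v` and `x - y -
t₂ = u - v`, and `(u + v)² + (u - v)² = 2u² + 2v²`. The phases regroup in the same way. -/
theorem atomProd_eq (x y : ℝ) (z : Phase) :
    atomProd (x + y) (x - y) z = atomOut x z *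
      (osc (z.2.1 - z.2.2) y * gsq (y - (z.1.1 - z.1.2) / 2)) := by
  unfold atomProd atomOut osc gwin gsq
  push_cast
  rw [← Complex.exp_add, ← Complex.exp_add, ← Complex.exp_add, ← Complex.exp_add,
    ← Complex.exp_add, ← Complex.exp_add]
  congr 1
  ring

/-- The antisymmetrized integrand of the bilinear Hilbert transform. -/
def bhtDiff (f g : 𝓢(ℝ, ℂ)) (x y : ℝ) : ℂ := (f (x + y) * g (x - y) - f (x - y) * g (x + y)) / y

theorem bhtDiff_eq (f g : 𝓢(ℝ, ℂ)) (x y : ℝ) :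
    bhtDiff f g x y = invConst ^ 2 * ∫ z, stftProd (f : 𝓢'(ℝ, ℂ)) (g : 𝓢'(ℝ, ℂ)) z *
      atomOut x z * atomDiff ((z.1.1 - z.1.2) / 2) (z.2.1 - z.2.2) y := by
  have h2 := mul_eq_integral_stftProd f g (x + -y) (x - -y)
  rw [← sub_eq_add_neg, sub_neg_eq_add] at h2
  have i2 := integrable_stftProd_mul_atomProd f g (x - y) (x + y)
  rw [bhtDiff, mul_eq_integral_stftProd f g (x + y) (x - y), h2, ← mul_sub,
    ← integral_sub (integrable_stftProd_mul_atomProd f g _ _) i2, mul_div_assoc,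
    ← integral_div]
  congr 2; ext z
  have e2 := atomProd_eq x (-y) z
  rw [← sub_eq_add_neg, sub_neg_eq_add] at e2
  rw [atomProd_eq, e2, atomDiff]
  ring

/-- The majorant `atomDom` has mass `O(1 + |ν₁ - ν₂|)`, absorbed by the weighted integrability of
`stftProd`. This justifies exchanging the `y`-integral with phase space. -/
theorem integrable_bhtDiff_kernel (f g : 𝓢(ℝ, ℂ)) (x : ℝ) :
    Integrable (fun w : ℝ × Phase => stftProd (f : 𝓢'(ℝ, ℂ)) (g : 𝓢'(ℝ, ℂ)) w.2 *
      atomOut x w.2 * atomDiff ((w.2.1.1 - w.2.1.2) / 2) (w.2.2.1 - w.2.2.2) w.1)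
      ((volume.restrict (Set.Ioi 0)).prod volume) := by
  set V := stftProd (f : 𝓢'(ℝ, ℂ)) (g : 𝓢'(ℝ, ℂ)) with hV
  have hVc : Continuous V := continuous_stftProd _ _
  have hout : Continuous (atomOut x) := by unfold atomOut osc gsq; fun_prop
  have hdm : Measurable fun w : ℝ × Phase =>
      atomDiff ((w.2.1.1 - w.2.1.2) / 2) (w.2.2.1 - w.2.2.2) w.1 := by
    have : Measurable fun w : ℝ × Phase =>
      (((w.2.1.1 - w.2.1.2) / 2, w.2.2.1 - w.2.2.2), w.1) := by fun_prop
    exact Measurable.comp (g := fun w : (ℝ × ℝ) × ℝ => atomDiff w.1.1 w.1.2 w.2)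
      (f := fun w : ℝ × Phase => (((w.2.1.1 - w.2.1.2) / 2, w.2.2.1 - w.2.2.2), w.1))
      measurable_atomDiff this
  have hmeas : Measurable fun w : ℝ × Phase => V w.2 * atomOut x w.2 *
      atomDiff ((w.2.1.1 - w.2.1.2) / 2) (w.2.2.1 - w.2.2.2) w.1 :=
    ((hVc.measurable.comp measurable_snd).mul (hout.measurable.comp measurable_snd)).mul hdm
  rw [integrable_prod_iff' hmeas.aestronglyMeasurable]
  refine ⟨Eventually.of_forall fun z =>
    (integrableOn_atomDiff ((z.1.1 - z.1.2) / 2) (z.2.1 - z.2.2)).const_mul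
      (V z * atomOut x z), ?_⟩
  set G := ∫ y, gsq y with hG
  have hG0 : 0 ≤ G := integral_nonneg gsq_nonneg
  refine ((integrable_norm_stftProd_mul f g).const_mul (8 + 4 * Real.pi + 2 * G)).mono' ?_
    (Eventually.of_forall fun z => ?_)
  · have := hmeas.norm.stronglyMeasurable
    exact (this.integral_prod_left' (μ := volume.restrict (Set.Ioi 0))).aestronglyMeasurable
  · rw [Real.norm_of_nonneg (integral_nonneg fun _ => norm_nonneg _)]
    simp_rw [norm_mul]
    rw [integral_const_mul]
    set b := (z.1.1 - z.1.2) / 2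
    set ξ := z.2.1 - z.2.2 with hξ
    have h1 : ∫ y in Set.Ioi (0 : ℝ), ‖atomDiff b ξ y‖ ≤ 8 + 4 * Real.pi * |ξ| + 2 * G := by
      rw [← integral_atomDom b ξ]
      calc _ ≤ ∫ y in Set.Ioi (0 : ℝ), atomDom b ξ y := by
            refine setIntegral_mono_on (integrableOn_atomDiff b ξ).norm
              (integrable_atomDom b ξ).integrableOn measurableSet_Ioi fun y hy => ?_
            exact norm_atomDiff_le hy
        _ ≤ _ := by
            refine setIntegral_le_integral (integrable_atomDom b ξ)
              (Eventually.of_forall fun y => ?_)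
            refine add_nonneg (Set.indicator_nonneg (fun _ _ => by positivity) _) ?_
            exact add_nonneg (gsq_nonneg _) (gsq_nonneg _)
    have h2 : |ξ| ≤ |z.2.1| + |z.2.2| := abs_sub _ _
    have h3 : 8 + 4 * Real.pi * |ξ| + 2 * G
        ≤ (8 + 4 * Real.pi + 2 * G) * ((1 + |z.2.1|) * (1 + |z.2.2|)) := by
      have hp := Real.pi_pos
      have ha := abs_nonneg z.2.1
      have hb := abs_nonneg z.2.2
      have hone : 1 ≤ (1 + |z.2.1|) * (1 + |z.2.2|) := by nlinarith
      have hxi : |ξ| ≤ (1 + |z.2.1|) * (1 + |z.2.2|) := by nlinarith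
      calc 8 + 4 * Real.pi * |ξ| + 2 * G = 8 * 1 + 4 * Real.pi * |ξ| + 2 * G * 1 := by ring
        _ ≤ 8 * ((1 + |z.2.1|) * (1 + |z.2.2|)) + 4 * Real.pi * ((1 + |z.2.1|) * (1 + |z.2.2|))
          + 2 * G * ((1 + |z.2.1|) * (1 + |z.2.2|)) := by gcongr
        _ = _ := by ring
    calc _ ≤ ‖V z‖ * 1 * ((8 + 4 * Real.pi + 2 * G) * ((1 + |z.2.1|) * (1 + |z.2.2|))) := by
          gcongr
          · exact norm_atomOut_le x z
          · exact h1.trans h3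
      _ = _ := by ring

theorem integrableOn_bhtDiff (f g : 𝓢(ℝ, ℂ)) (x : ℝ) :
    IntegrableOn (bhtDiff f g x) (Set.Ioi 0) := by
  have := (integrable_bhtDiff_kernel f g x).integral_prod_left.const_mul (invConst ^ 2)
  refine this.congr (Eventually.of_forall fun y => ?_)
  exact (bhtDiff_eq f g x y).symm

theorem integral_bhtDiff (f g : 𝓢(ℝ, ℂ)) (x : ℝ) :
    ∫ y in Set.Ioi (0 : ℝ), bhtDiff f g x y
      = invConst ^ 2 * ∫ z, bhtCoef (f : 𝓢'(ℝ, ℂ)) (g : 𝓢'(ℝ, ℂ)) z * atomOut x z := by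
  simp_rw [bhtDiff_eq]
  rw [integral_const_mul, integral_integral_swap (integrable_bhtDiff_kernel f g x)]
  congr 2; ext z
  rw [integral_const_mul, bhtCoef, bhtKer, stftProd]
  ring

/-- Folding the negative half-line onto the positive one gives an integrand that is absolutely
integrable down to `0`, so the principal value becomes an ordinary integral. -/
theorem truncatedBHT_eq (f g : 𝓢(ℝ, ℂ)) (x : ℝ) {ε : ℝ} (hε : 0 < ε) :
    truncatedBHT f g x ε = ∫ y in Set.Ioi ε, bhtDiff f g x y := by
  set k : ℝ → ℂ := fun y => f (x + y) * g (x - y) / (y : ℂ) with hk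
  have hset : {y : ℝ | ε < |y|} = Set.Ioi ε ∪ Set.Iio (-ε) := by
    ext y
    simp only [Set.mem_ofPred_eq, Set.mem_union, Set.mem_Ioi, Set.mem_Iio, lt_abs, lt_neg]
  have hms : MeasurableSet {y : ℝ | ε < |y|} := by
    rw [hset]; exact measurableSet_Ioi.union measurableSet_Iio
  have hkm : Measurable k := by
    have hf := f.continuous
    have hg := g.continuous
    have : Continuous fun y => f (x + y) * g (x - y) := by fun_prop
    exact this.measurable.div (by fun_prop)
  have hki : IntegrableOn k {y : ℝ | ε < |y|} := by
    have h1 : Integrable fun y => ‖f (x + y)‖ * (SchwartzMap.seminorm ℂ 0 0 g / ε) :=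
      (f.integrable.comp_add_left x).norm.mul_const _
    refine h1.integrableOn.mono' hkm.aestronglyMeasurable ?_
    filter_upwards [self_mem_ae_restrict hms] with y hy
    have hy' : ε < |y| := hy
    rw [hk, norm_div, norm_mul, Complex.norm_real, Real.norm_eq_abs, mul_div_assoc]
    gcongr
    exact SchwartzMap.norm_le_seminorm ℂ g _
  have h1 : IntegrableOn k (Set.Ioi ε) := hki.mono_set (by rw [hset]; exact Set.subset_union_left)
  have h2 : IntegrableOn k (Set.Iio (-ε)) :=
    hki.mono_set (by rw [hset]; exact Set.subset_union_right)
  have h3 : IntegrableOn (fun y => k (-y)) (Set.Ioi ε) := by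
    have := h2.comp_neg
    simpa using this
  have e : truncatedBHT f g x ε = ∫ y in {y : ℝ | ε < |y|}, k y := rfl
  have hdisj : Disjoint (Set.Ioi ε) (Set.Iio (-ε)) := by
    rw [Set.disjoint_left]
    intro y hy hy'
    rw [Set.mem_Ioi] at hy
    rw [Set.mem_Iio] at hy'
    linarith
  rw [e, hset, setIntegral_union hdisj measurableSet_Iio h1 h2, ← integral_Iic_eq_integral_Iio,
    ← integral_comp_neg_Ioi, ← integral_add h1 h3]
  congr 1; ext y
  rw [hk, bhtDiff]
  dsimp only
  rw [← sub_eq_add_neg, sub_neg_eq_add]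
  push_cast
  rw [div_neg]
  ring

theorem tendsto_truncatedBHT (f g : 𝓢(ℝ, ℂ)) (x : ℝ) :
    Tendsto (truncatedBHT f g x) (𝓝[>] 0) (𝓝 (∫ y in Set.Ioi (0 : ℝ), bhtDiff f g x y)) := by
  have hcov : AECover (volume.restrict (Set.Ioi (0 : ℝ))) (𝓝[>] (0 : ℝ)) fun ε => Set.Ioi ε :=
    aecover_Ioi_of_Ioi (tendsto_id.mono_left nhdsWithin_le_nhds)
  refine (hcov.integral_tendsto_of_countably_generated (integrableOn_bhtDiff f g x)).congr' ?_
  filter_upwards [self_mem_nhdsWithin] with ε hε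
  have hε' : 0 < ε := hε
  rw [truncatedBHT_eq f g x hε', Measure.restrict_restrict measurableSet_Ioi,
    Set.inter_eq_self_of_subset_left (Set.Ioi_subset_Ioi hε'.le)]

theorem integrable_bhtCoef (f g : 𝓢(ℝ, ℂ)) :
    Integrable (bhtCoef (f : 𝓢'(ℝ, ℂ)) (g : 𝓢'(ℝ, ℂ))) := by
  obtain ⟨C, hC0, hC⟩ := exists_norm_bhtKer_le
  refine ((integrable_stftProd f g).norm.mul_const C).mono'
    (measurable_bhtCoef _ _).aestronglyMeasurable (Eventually.of_forall fun z => ?_)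
  rw [bhtCoef, norm_mul]
  refine mul_le_mul_of_nonneg_left ((hC _ _).trans ?_) (norm_nonneg _)
  exact mul_le_of_le_one_right hC0 (inv_le_one_of_one_le₀ (by simp))

theorem integral_mul_atomOut (u : 𝓢(ℝ, ℂ)) (z : Phase) :
    ∫ x, u x * atomOut x z = atomPair u z := by
  unfold atomPair schwartzStft
  congr 1; ext x
  rw [atomOut, osc, gsqWindow_apply]
  congr 3
  push_cast; ring_nf

/-- A second use of Fubini, between `x` and phase space: pairing the outer Gaussian with `u` gives
`atomPair`. -/
theorem isBHT_bhtDist (f g : 𝓢(ℝ, ℂ))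
    (h : phaseOp (absStft (f : 𝓢'(ℝ, ℂ))) (absStft (g : 𝓢'(ℝ, ℂ))) 0 0 < ⊤) :
    IsBHT f g (bhtDist f g h) := by
  refine ⟨fun x => ∫ y in Set.Ioi (0 : ℝ), bhtDiff f g x y, tendsto_truncatedBHT f g,
    fun u => ?_⟩
  have hint : Integrable (fun w : ℝ × Phase =>
      u w.1 * bhtCoef (f : 𝓢'(ℝ, ℂ)) (g : 𝓢'(ℝ, ℂ)) w.2 * atomOut w.1 w.2)
      (volume.prod volume) := by
    have h1 := u.integrable.mul_prod (integrable_bhtCoef f g) (μ := volume)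
    refine h1.norm.mono' (h1.aestronglyMeasurable.mul
      continuous_atomOut.aestronglyMeasurable) (Eventually.of_forall fun w => ?_)
    rw [norm_mul]
    exact mul_le_of_le_one_right (norm_nonneg _) (norm_atomOut_le _ _)
  have e1 : ∀ x, u x * ∫ y in Set.Ioi (0 : ℝ), bhtDiff f g x y = invConst ^ 2 *
      ∫ z, u x * bhtCoef (f : 𝓢'(ℝ, ℂ)) (g : 𝓢'(ℝ, ℂ)) z * atomOut x z := by
    intro x
    rw [integral_bhtDiff, mul_left_comm, ← integral_const_mul (u x)]
    congr 2; ext z; ring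
  simp_rw [e1]
  refine ⟨hint.integral_prod_left.const_mul _, ?_⟩
  rw [bhtDist_apply, integral_const_mul, integral_integral_swap hint]
  congr 2; ext z
  rw [← integral_mul_atomOut, ← integral_const_mul]
  congr 1; ext x; ring

/-! ### Boundedness on modulation spaces -/

theorem measurable_eLpNorm_absStft (p : ℝ≥0∞) (f : 𝓢'(ℝ, ℂ)) :
    Measurable fun ν => eLpNorm (fun t => absStft f t ν) p volume := by
  simp_rw [eLpNorm_absStft]
  exact measurable_inner p f

theorem toReal_inv_add {p q : ℝ≥0∞} (hp : 1 ≤ p) (hq : 1 ≤ q) :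
    (p⁻¹ + q⁻¹).toReal = (p⁻¹).toReal + (q⁻¹).toReal :=
  ENNReal.toReal_add (ne_top_of_le_ne_top ENNReal.one_ne_top (ENNReal.inv_le_one.2 hp))
    (ne_top_of_le_ne_top ENNReal.one_ne_top (ENNReal.inv_le_one.2 hq))

theorem bhtExtendsBoundedly {p₀ p₁ p₂ q₁ q₂ q₃ : ℝ≥0∞} (hp₀ : 1 ≤ p₀) (hp₁ : 1 ≤ p₁)
    (hp₂ : 1 ≤ p₂) (hq₁ : 1 ≤ q₁) (hq₂ : 1 ≤ q₂) (hq₃ : 1 ≤ q₃)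
    (hp : 1 / p₀ < 1 / p₁ + 1 / p₂) (hq : 1 + 1 / q₃ ≤ 1 / q₁ + 1 / q₂) :
    BHTExtendsBoundedly p₁ q₁ p₂ q₂ p₀ q₃ := by
  simp only [one_div] at hp hq
  have hinv : ∀ {p : ℝ≥0∞}, 1 ≤ p → p⁻¹ ≠ ⊤ := fun h =>
    ne_top_of_le_ne_top ENNReal.one_ne_top (ENNReal.inv_le_one.2 h)
  have hp' : (p₀⁻¹).toReal < (p₁⁻¹).toReal + (p₂⁻¹).toReal := by
    rw [← toReal_inv_add hp₁ hp₂]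
    exact ENNReal.toReal_strict_mono (ENNReal.add_ne_top.2 ⟨hinv hp₁, hinv hp₂⟩) hp
  have hq' : 1 + (q₃⁻¹).toReal ≤ (q₁⁻¹).toReal + (q₂⁻¹).toReal := by
    rw [← toReal_inv_add hq₁ hq₂, ← ENNReal.toReal_one,
      ← ENNReal.toReal_add ENNReal.one_ne_top (hinv hq₃)]
    exact ENNReal.toReal_mono (ENNReal.add_ne_top.2 ⟨hinv hq₁, hinv hq₂⟩) hq
  have a0 := toReal_inv_nonneg p₀
  have a3 := toReal_inv_nonneg q₃
  have hfin : ∀ (F : modulationSpace p₁ q₁) (G : modulationSpace p₂ q₂),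
      phaseOp (absStft (F : 𝓢'(ℝ, ℂ))) (absStft (G : 𝓢'(ℝ, ℂ))) 0 0 < ⊤ := by
    intro F G
    -- The exponent conditions persist when `p₀` and `q₃` are raised to infinity; the resulting
    -- uniform bound makes the defining integral converge.
    obtain ⟨K, hK, hb⟩ := mixedNorm_phaseOp_le (p₀ := ⊤) (q₃ := ⊤) le_top hp₁ hp₂ hq₁ hq₂ le_top
      (by simp only [ENNReal.inv_top, ENNReal.toReal_zero]; linarith)
      (by simp only [ENNReal.inv_top, ENNReal.toReal_zero]; linarith)
    refine phaseOp_zero_lt_top (measurable_absStft _) (measurable_absStft _) ?_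
    refine (hb _ _ (measurable_absStft _) (measurable_absStft _) (measurable_eLpNorm_absStft _ _)
      (measurable_eLpNorm_absStft _ _)).trans_lt ?_
    rw [mixedNorm_absStft, mixedNorm_absStft]
    exact ENNReal.mul_lt_top (ENNReal.mul_lt_top F.2 G.2) hK
  obtain ⟨K, hK, hb⟩ := mixedNorm_phaseOp_le hp₀ hp₁ hp₂ hq₁ hq₂ hq₃ hp' hq'
  obtain ⟨L, hL, hLb⟩ := exists_absStft_bhtDist_le
  have hbound : ∀ (F : modulationSpace p₁ q₁) (G : modulationSpace p₂ q₂),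
      modNorm p₀ q₃ (bhtDist F G (hfin F G)) ≤ ((L * K).toNNReal : ℝ≥0∞) *
        modNorm p₁ q₁ (F : 𝓢'(ℝ, ℂ)) * modNorm p₂ q₂ (G : 𝓢'(ℝ, ℂ)) := by
    intro F G
    have h1 : ∀ ν, eLpNorm (fun t => absStft (bhtDist F G (hfin F G)) t ν) p₀ volume
        ≤ L * eLpNorm (fun t => phaseOp (absStft (F : 𝓢'(ℝ, ℂ))) (absStft (G : 𝓢'(ℝ, ℂ))) t ν)
          p₀ volume := by
      intro ν
      rw [← ENNReal.coe_toNNReal hL.ne]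
      refine eLpNorm_le_nnreal_smul_eLpNorm_of_ae_le_mul' (Eventually.of_forall fun t => ?_) _
      rw [enorm_eq_self, enorm_eq_self, ENNReal.coe_toNNReal hL.ne]
      exact hLb F G (hfin F G) t ν
    have h2 : mixedNorm p₀ q₃ (absStft (bhtDist F G (hfin F G)))
        ≤ L * mixedNorm p₀ q₃ (phaseOp (absStft (F : 𝓢'(ℝ, ℂ))) (absStft (G : 𝓢'(ℝ, ℂ)))) := by
      unfold mixedNorm
      rw [← ENNReal.coe_toNNReal hL.ne]
      refine eLpNorm_le_nnreal_smul_eLpNorm_of_ae_le_mul' (Eventually.of_forall fun ν => ?_) _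
      rw [enorm_eq_self, enorm_eq_self, ENNReal.coe_toNNReal hL.ne]
      exact h1 ν
    rw [mixedNorm_absStft] at h2
    rw [ENNReal.coe_toNNReal (ENNReal.mul_lt_top hL hK).ne]
    calc _ ≤ L * (modNorm p₁ q₁ (F : 𝓢'(ℝ, ℂ)) * modNorm p₂ q₂ (G : 𝓢'(ℝ, ℂ)) * K) := by
          refine h2.trans ?_
          rw [← mixedNorm_absStft p₁, ← mixedNorm_absStft p₂]
          gcongr
          exact hb _ _ (measurable_absStft _) (measurable_absStft _)
            (measurable_eLpNorm_absStft _ _) (measurable_eLpNorm_absStft _ _)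
      _ = _ := by ring
  refine ⟨LinearMap.mk₂ ℂ (fun F G => ⟨bhtDist F G (hfin F G), ?_⟩) ?_ ?_ ?_ ?_,
    (L * K).toNNReal, fun f g => ?_, fun F G => ?_⟩
  · exact (hbound F G).trans_lt (ENNReal.mul_lt_top (ENNReal.mul_lt_top ENNReal.coe_lt_top F.2) G.2)
  · intro F F' G
    ext u
    have e : bhtDist (F + F' : modulationSpace p₁ q₁) G (hfin (F + F') G) u
        = bhtDist F G (hfin F G) u + bhtDist F' G (hfin F' G) u := by
      rw [bhtDist_apply, bhtDist_apply, bhtDist_apply, ← mul_add,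
        ← integral_add (integrable_bhtCoef_mul_atomPair (hfin F G) u)
          (integrable_bhtCoef_mul_atomPair (hfin F' G) u)]
      congr 2; ext z
      rw [Submodule.coe_add, bhtCoef_add_left, add_mul]
    exact e
  · intro c F G
    ext u
    have e : bhtDist (c • F : modulationSpace p₁ q₁) G (hfin (c • F) G) u
        = c * bhtDist F G (hfin F G) u := by
      rw [bhtDist_apply, bhtDist_apply, mul_left_comm, ← integral_const_mul c]
      congr 2; ext z
      rw [Submodule.coe_smul, bhtCoef_smul_left, mul_assoc]
    exact e
  · intro F G G'
    ext u
    have e : bhtDist F (G + G' : modulationSpace p₂ q₂) (hfin F (G + G')) u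
        = bhtDist F G (hfin F G) u + bhtDist F G' (hfin F G') u := by
      rw [bhtDist_apply, bhtDist_apply, bhtDist_apply, ← mul_add,
        ← integral_add (integrable_bhtCoef_mul_atomPair (hfin F G) u)
          (integrable_bhtCoef_mul_atomPair (hfin F G') u)]
      congr 2; ext z
      rw [Submodule.coe_add, bhtCoef_add_right, add_mul]
    exact e
  · intro c F G
    ext u
    have e : bhtDist F (c • G : modulationSpace p₂ q₂) (hfin F (c • G)) u
        = c * bhtDist F G (hfin F G) u := by
      rw [bhtDist_apply, bhtDist_apply, mul_left_comm, ← integral_const_mul c]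
      congr 2; ext z
      rw [Submodule.coe_smul, bhtCoef_smul_right, mul_assoc]
    exact e
  · exact isBHT_bhtDist f g (hfin (ofSchwartz p₁ q₁ f) (ofSchwartz p₂ q₂ g))
  · exact hbound F G

end ModulationBHT

end

theorem theorem4p4 :
    (∀ p₀ p₁ p₂ q₁ q₂ q₃ : ℝ≥0∞,
      1 ≤ p₀ → 1 ≤ p₁ → 1 ≤ p₂ → 1 ≤ q₁ → 1 ≤ q₂ → 1 ≤ q₃ →
      1 / p₀ < 1 / p₁ + 1 / p₂ → 1 + 1 / q₃ ≤ 1 / q₁ + 1 / q₂ →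
      ModulationBHT.BHTExtendsBoundedly p₁ q₁ p₂ q₂ p₀ q₃) ∧
    (∀ p p' q q' : ℝ≥0∞, 1 ≤ p → 1 ≤ q → 1 / p + 1 / p' = 1 → 1 / q + 1 / q' = 1 →
      ∀ ε : ℝ, 0 < ε →
        ModulationBHT.BHTExtendsBoundedly p q p' q' (ENNReal.ofReal (1 + ε)) ⊤) := by
  refine ⟨fun p₀ p₁ p₂ q₁ q₂ q₃ h0 h1 h2 h3 h4 h5 hp hq =>
    ModulationBHT.bhtExtendsBoundedly h0 h1 h2 h3 h4 h5 hp hq,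
    fun p p' q q' hp hq hpp hqq ε hε => ?_⟩
  have hconj : ∀ {a b : ℝ≥0∞}, 1 / a + 1 / b = 1 → 1 ≤ b := by
    intro a b h
    have h1 : 1 / b ≤ 1 := le_add_self.trans_eq h
    rwa [one_div, ENNReal.inv_le_one] at h1
  have hε1 : (1 : ℝ≥0∞) < ENNReal.ofReal (1 + ε) := by
    rw [← ENNReal.ofReal_one]
    exact (ENNReal.ofReal_lt_ofReal_iff (by linarith)).2 (by linarith)
  -- For conjugate exponents both sums equal `1`: strictly above `1 / (1 + ε)` in time, and the
  -- equality case with `q₃ = ∞` in frequency.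
  refine ModulationBHT.bhtExtendsBoundedly hε1.le hp (hconj hpp) hq (hconj hqq) le_top ?_ ?_
  · rw [hpp, one_div, ENNReal.inv_lt_one]
    exact hε1
  · rw [hqq]; simp
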